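/- **Setting.** Let $\mathbb{C}(q)$ be the field of rational functions in an indeterminate $q$ and let $\mathbf{U}_q=U_q(\mathfrak{sl}_2)$ be the $\mathbb{C}(q)$-algebra generated by $E,F,K^{\pm1}$ with $KK^{-1}=K^{-1}K=1$, $KE=q^2EK$, $KF=q^{-2}FK$, $EF-FE=\frac{K-K^{-1}}{q-q^{-1}}$. It acts on tensor products through $\Delta K^{\pm1}=K^{\pm1}\otimes K^{\pm1}$, $\Delta E=E\otimes1+K\otimes E$, $\Delta F=F\otimes K^{-1}+1\otimes F$. Let $V_n$ be the irreducible module with basis $v_n,v_{n-2},\dots,v_{-n}$ and, with $[j]=\frac{q^j-q^{-j}}{q-q^{-1}}$, action $K^{\pm1}v_p=q^{\pm p}v_p$, $Ev_p=[\tfrac{n+p}{2}+1]v_{p+2}$, $Fv_p=[\tfrac{n-p}{2}+1]v_{p-2}$ (where $v_{n+2}=v_{-n-2}=0$). **The variety.** Let $D$ be a vector space of dimension $d=\mathbf{d}_1+\dots+\mathbf{d}_k$ over a finite field, where $\mathbf{d}=(\mathbf{d}_1,\dots,\mathbf{d}_k)\in(\mathbb{Z}_{\ge0})^k$. The tensor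 product variety $\mathfrak{T}(\mathbf{d})$ is the set of triples $(\mathbf{D},W,t)$ where $\mathbf{D}=(0=\mathbf{D}_0\subset\dots\subset\mathbf{D}_k=D)$ is a flag of subspaces with $\dim\mathbf{D}_i/\mathbf{D}_{i-1}=\mathbf{d}_i$, $W\subset D$ is a subspace and $t\in\operatorname{End}D$ satisfies $t(\mathbf{D}_i)\subset\mathbf{D}_{i-1}$ and $\operatorname{im}t\subset W\subset\ker t$. For a subspace $U$ put $\alpha(U,\mathbf{D})_i=\dim (U\cap\mathbf{D}_i)/(U\cap\mathbf{D}_{i-1})$. For a variety $Z$ over the ground field, $\chi_q(Z)$ denotes the number of points of $Z$ over a field with $q^2$ elements, as a polynomial in $q$: its value at $q=\sqrt{|L|}$ is $|Z(L)|$ for every finite extension $L$ of the ground field. Let $A_s$ be the strata of $\mathfrak{T}(\mathbf{d})$ given by fixing $s=(\alpha(W,\mathbf{D}),\alpha(\operatorname{im}t,\mathbf{D}),\alpha(\ker t,\mathbf{D}))$. With $\pi_1(\mathbf{D},U,W,t)=(\mathbf{D},U,t)$ and $\pi_2(\mathbf{D},U,W,t)=(\mathbf{D},W,t)$ on the quadruples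 with $U\subset W$, $\dim W=\dim U+1$ and $(\mathbf{D},U,t),(\mathbf{D},W,t)\in\mathfrak{T}(\mathbf{d})$, operators on the functions $f:\mathfrak{T}(\mathbf{d})\to\mathbb{C}(q)$ that are constant on the strata are defined by $$Ef=q^{-\dim\pi_1^{-1}(\cdot)}(\pi_1)_!\pi_2^*f,\qquad Ff=q^{-\dim\pi_2^{-1}(\cdot)}(\pi_2)_!\pi_1^*f,\qquad (K^{\pm1}f)(\mathbf{D},W,t)=q^{\pm(d-2\dim W)}f(\mathbf{D},W,t),$$ where $(\pi_1)_!\pi_2^*$ is linear with $(\pi_1)_!\pi_2^*\mathbf 1_{A_s}(x)=\chi_q(\pi_1^{-1}(x)\cap\pi_2^{-1}(A_s))$, and likewise $(\pi_2)_!\pi_1^*$. Let $\mathcal{T}_s(\mathbf{d})$ be the space of $GL(D)$-invariant functions $f:\mathfrak{T}(\mathbf{d})\to\mathbb{C}(q)$ such that $f(\mathbf{D},W,t)$ depends only on $\dim W$ and $\alpha(\ker t,\mathbf{D})$. **Crossingless matches.** Place boxes $1,\dots,k$ from left to right on a line, box $i$ carrying $\mathbf{d}_i$ vertices. A lower crossingless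 match $b$ is a set of disjoint non-crossing curves above the line, each joining two vertices in different boxes, such that no unmatched vertex lies below a curve; $\mu(b)$ is the number of unmatched vertices. Joining these to one upper box with $\mu$ vertices identifies the $b$ with $\mu(b)=\mu$ with the set $CM^{\mu}_{\mathbf{d}}$ of crossingless matches from $\mathbf{d}$ to $\mu$. Put $\mathbf{n}^b_i=\mathbf{d}_i-\#\{\text{right endpoints of curves of } b\text{ in box }i\}$. An oriented lower crossingless match $\mathbf{a}$ consists of such a match $\bar{\mathbf{a}}$ and an orientation (up or down) of each unmatched vertex such that those oriented down are to the right of those oriented up; each curve is oriented to the left (down arrow at its left endpoint, up arrow at its right endpoint). Let $|\mathbf{a}|$ be the number of all vertices, matched or not, with a down arrow, and put $$Y_{\mathbf{a}}=\{(\mathbf{D},W,t)\in\mathfrak{T}(\mathbf{d})\mid\alpha(\ker t,\mathbf{D})=\mathbf{n}^{\bar{\mathbf{a}}},\ \dim W=|\mathbf{a}|\}.$$ **Theorem.** The operators $E,F,K^{\pm1}$ preserve $\mathcal{T}_s(\mathbf{d})$ and make it a $\mathbf{U}_q$-module, which is isomorphic to $V_{\mathbf{d}_1}\otimes\cdots\otimes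 V_{\mathbf{d}_k}$. The functions $\mathbf 1_{Y_{\mathbf{a}}}$, for $\mathbf{a}$ running over the oriented lower crossingless matches, form a basis $\mathcal{B}_s$ of $\mathcal{T}_s(\mathbf{d})$ that is adapted to a decomposition into a direct sum of irreducible representations: $\mathcal{T}_s(\mathbf{d})$ is the direct sum, over the lower crossingless matches $b$, of the subspaces $\operatorname{Span}\{\mathbf 1_{Y_{\mathbf{a}}}\mid\bar{\mathbf{a}}=b\}$, each of which is an irreducible submodule, and for $b\in CM^{\mu}_{\mathbf{d}}$ the map $$\mathbf 1_{Y_{\mathbf{a}}}\mapsto v_{\mu-2(\#\text{ of unmatched down arrows in }\mathbf{a})}$$ extends linearly to an isomorphism of $\mathbf{U}_q$-modules $\operatorname{Span}\{\mathbf 1_{Y_{\mathbf{a}}}\mid\bar{\mathbf{a}}=b\}\cong V_\mu$. -/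

import Mathlib

open scoped TensorProduct BigOperators
open Module (finrank)

universe u v

noncomputable section

namespace QTensor

/-! ## The quantum group -/

/-- The field of rational functions `ℂ(q)`. -/
abbrev Cq : Type := RatFunc ℂ

/-- The indeterminate `q`. -/
def q : Cq := RatFunc.X

/-- The quantum integer `[n] = (q ^ n - q ^ (-n)) / (q - q⁻¹)`. -/
def qint (n : ℤ) : Cq := (q ^ n - q ^ (-n)) / (q - q⁻¹)

/-- The generators of the quantum group of `sl₂`. -/
inductive Gen
  | E
  | F
  | K
  | Kinv

/-- The defining relations of the quantum group of `sl₂`. -/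
inductive Rel : FreeAlgebra Cq Gen → FreeAlgebra Cq Gen → Prop
  | K_Kinv : Rel (FreeAlgebra.ι Cq Gen.K * FreeAlgebra.ι Cq Gen.Kinv) 1
  | Kinv_K : Rel (FreeAlgebra.ι Cq Gen.Kinv * FreeAlgebra.ι Cq Gen.K) 1
  | K_E : Rel (FreeAlgebra.ι Cq Gen.K * FreeAlgebra.ι Cq Gen.E)
      (q ^ 2 • (FreeAlgebra.ι Cq Gen.E * FreeAlgebra.ι Cq Gen.K))
  | K_F : Rel (FreeAlgebra.ι Cq Gen.K * FreeAlgebra.ι Cq Gen.F)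
      ((q ^ 2)⁻¹ • (FreeAlgebra.ι Cq Gen.F * FreeAlgebra.ι Cq Gen.K))
  | E_F : Rel (FreeAlgebra.ι Cq Gen.E * FreeAlgebra.ι Cq Gen.F
        - FreeAlgebra.ι Cq Gen.F * FreeAlgebra.ι Cq Gen.E)
      ((q - q⁻¹)⁻¹ • (FreeAlgebra.ι Cq Gen.K - FreeAlgebra.ι Cq Gen.Kinv))

/-- The quantum group `U_q` of `sl₂`, an associative algebra over `ℂ(q)`. -/
def Uq : Type := RingQuot Rel

instance : Ring Uq := inferInstanceAs (Ring (RingQuot Rel))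

instance : Algebra Cq Uq := inferInstanceAs (Algebra Cq (RingQuot Rel))

/-- The quotient map from the free algebra. -/
def Uq.mk : FreeAlgebra Cq Gen →ₐ[Cq] Uq := RingQuot.mkAlgHom Cq Rel

theorem Uq.mk_rel {x y : FreeAlgebra Cq Gen} (h : Rel x y) : Uq.mk x = Uq.mk y :=
  RingQuot.mkAlgHom_rel Cq h

/-- The images of the generators in `U_q`. -/
def gen (g : Gen) : Uq := Uq.mk (FreeAlgebra.ι Cq g)

/-- The universal property of `U_q`: elements satisfying the relations give an algebra map. -/
def Uq.lift {A : Type*} [Ring A] [Algebra Cq A] (e f k k' : A)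
    (h1 : k * k' = 1) (h2 : k' * k = 1) (h3 : k * e = q ^ 2 • (e * k))
    (h4 : k * f = (q ^ 2)⁻¹ • (f * k)) (h5 : e * f - f * e = (q - q⁻¹)⁻¹ • (k - k')) :
    Uq →ₐ[Cq] A :=
  RingQuot.liftAlgHom Cq (s := Rel)
    ⟨FreeAlgebra.lift Cq (fun g : Gen => match g with
      | Gen.E => e
      | Gen.F => f
      | Gen.K => k
      | Gen.Kinv => k'), by
      intro x y hxy
      cases hxy <;> simp [h1, h2, h3, h4, h5]⟩

theorem gen_K_Kinv : gen Gen.K * gen Gen.Kinv = 1 := by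
  simpa [gen] using Uq.mk_rel Rel.K_Kinv

theorem gen_Kinv_K : gen Gen.Kinv * gen Gen.K = 1 := by
  simpa [gen] using Uq.mk_rel Rel.Kinv_K

theorem gen_K_E : gen Gen.K * gen Gen.E = q ^ 2 • (gen Gen.E * gen Gen.K) := by
  simpa [gen] using Uq.mk_rel Rel.K_E

theorem gen_K_F : gen Gen.K * gen Gen.F = (q ^ 2)⁻¹ • (gen Gen.F * gen Gen.K) := by
  simpa [gen] using Uq.mk_rel Rel.K_F

theorem gen_E_F : gen Gen.E * gen Gen.F - gen Gen.F * gen Gen.E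
    = (q - q⁻¹)⁻¹ • (gen Gen.K - gen Gen.Kinv) := by
  simpa [gen] using Uq.mk_rel Rel.E_F

theorem q_ne_zero : q ≠ 0 := RatFunc.X_ne_zero

theorem q_sq_sub_one_ne_zero : q ^ 2 - 1 ≠ 0 := by
  intro h
  have h1 : algebraMap (Polynomial ℂ) Cq (Polynomial.X ^ 2 - 1) = algebraMap (Polynomial ℂ) Cq 0 := by
    simpa [q, RatFunc.algebraMap_X] using h
  have h2 := RatFunc.algebraMap_injective ℂ h1
  have h3 := congrArg (Polynomial.eval 0) h2
  simp at h3

theorem q_sub_inv_ne_zero : q - q⁻¹ ≠ 0 := by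
  intro h
  apply q_sq_sub_one_ne_zero
  have h1 : q * (q - q⁻¹) = q ^ 2 - 1 := by
    rw [mul_sub, mul_inv_cancel₀ q_ne_zero]; ring
  rw [← h1, h, mul_zero]

theorem qint_zero : qint 0 = 0 := by simp [qint]

theorem qint_identity (n i : ℤ) :
    qint (n - i) * qint (i + 1) - qint i * qint (n - i + 1) = qint (n - 2 * i) := by
  have h := q_sub_inv_ne_zero
  have h0 := q_ne_zero
  unfold qint
  have e1 : q ^ (n - i) = q ^ n * (q ^ i)⁻¹ := by rw [zpow_sub₀ h0, div_eq_mul_inv]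
  have e2 : q ^ (i + 1) = q ^ i * q := by rw [zpow_add₀ h0, zpow_one]
  have e3 : q ^ (n - i + 1) = q ^ n * (q ^ i)⁻¹ * q := by rw [zpow_add₀ h0, e1, zpow_one]
  have e4 : q ^ (n - 2 * i) = q ^ n * (q ^ i)⁻¹ * (q ^ i)⁻¹ := by
    rw [show n - 2 * i = n - i - i by ring, zpow_sub₀ h0, e1, div_eq_mul_inv]
  simp only [zpow_neg, e1, e2, e3, e4]
  have hx : q ^ n ≠ 0 := zpow_ne_zero _ h0
  have hy : q ^ i ≠ 0 := zpow_ne_zero _ h0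
  generalize q ^ n = x at *
  generalize q ^ i = y at *
  have h' : q ^ 2 - 1 ≠ 0 := q_sq_sub_one_ne_zero
  rw [show q - q⁻¹ = (q ^ 2 - 1) / q by field_simp]
  field_simp
  ring

theorem gen_E_Kinv : gen Gen.E * gen Gen.Kinv = q ^ 2 • (gen Gen.Kinv * gen Gen.E) := by
  calc gen Gen.E * gen Gen.Kinv
      = gen Gen.Kinv * (gen Gen.K * gen Gen.E) * gen Gen.Kinv := by
        rw [← mul_assoc, gen_Kinv_K, one_mul]
    _ = q ^ 2 • (gen Gen.Kinv * gen Gen.E) := by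
        rw [gen_K_E, mul_smul_comm, smul_mul_assoc, ← mul_assoc, mul_assoc, gen_K_Kinv, mul_one]

/-- The comultiplication: `Δ K^{±1} = K^{±1} ⊗ K^{±1}`, `Δ E = E ⊗ 1 + K ⊗ E` and
`Δ F = F ⊗ K⁻¹ + 1 ⊗ F`. -/
def comul : Uq →ₐ[Cq] Uq ⊗[Cq] Uq :=
  Uq.lift
    (gen Gen.E ⊗ₜ 1 + gen Gen.K ⊗ₜ gen Gen.E)
    (gen Gen.F ⊗ₜ gen Gen.Kinv + 1 ⊗ₜ gen Gen.F)
    (gen Gen.K ⊗ₜ gen Gen.K)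
    (gen Gen.Kinv ⊗ₜ gen Gen.Kinv)
    (by simp [gen_K_Kinv, Algebra.TensorProduct.one_def])
    (by simp [gen_Kinv_K, Algebra.TensorProduct.one_def])
    (by simp [mul_add, add_mul, gen_K_E, TensorProduct.smul_tmul', TensorProduct.tmul_smul])
    (by
      have h : gen Gen.K * gen Gen.Kinv = gen Gen.Kinv * gen Gen.K := by
        rw [gen_K_Kinv, gen_Kinv_K]
      simp [mul_add, add_mul, gen_K_F, h, TensorProduct.smul_tmul', TensorProduct.tmul_smul])
    (by
      have e1 : gen Gen.E * gen Gen.F = gen Gen.F * gen Gen.E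
          + (q - q⁻¹)⁻¹ • (gen Gen.K - gen Gen.Kinv) := by
        rw [← gen_E_F]; abel
      have hq : q ^ 2 * (q ^ 2)⁻¹ = 1 := mul_inv_cancel₀ (pow_ne_zero 2 q_ne_zero)
      simp only [mul_add, add_mul, Algebra.TensorProduct.tmul_mul_tmul, one_mul, mul_one, gen_K_F,
        gen_E_Kinv, e1, TensorProduct.add_tmul, TensorProduct.tmul_add, TensorProduct.tmul_smul,
        ← TensorProduct.smul_tmul', TensorProduct.sub_tmul, TensorProduct.tmul_sub, smul_smul, hq,
        one_smul, smul_sub]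
      abel)

/-- The counit. -/
def counit : Uq →ₐ[Cq] Cq :=
  Uq.lift 0 0 1 1 (by simp) (by simp) (by simp) (by simp) (by simp)

/-! ## Modules over the quantum group -/

/-- A `U_q`-module: a `ℂ(q)`-vector space with an algebra map from `U_q` to its endomorphisms. -/
structure UqMod where
  carrier : Type
  [addCommGroup : AddCommGroup carrier]
  [module : Module Cq carrier]
  act : Uq →ₐ[Cq] Module.End Cq carrier

attribute [instance] UqMod.addCommGroup UqMod.module

/-- The trivial module, on which `U_q` acts through the counit. -/
def UqMod.triv : UqMod where
  carrier := Cq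
  act := (Algebra.lsmul Cq Cq Cq).comp counit

/-- The tensor product of two modules, on which `U_q` acts through the comultiplication. -/
def UqMod.tensor (M N : UqMod) : UqMod where
  carrier := M.carrier ⊗[Cq] N.carrier
  act := ((Module.endTensorEndAlgHom (R := Cq) (S := Cq) (A := Cq)
    (M := M.carrier) (N := N.carrier)).comp (Algebra.TensorProduct.map M.act N.act)).comp comul

/-- The coordinate of `x` at position `j`, read as `0` outside the range of indices. -/
def coord {n : ℕ} (x : Fin (n + 1) → Cq) (j : ℕ) : Cq :=
  if h : j < n + 1 then x ⟨j, h⟩ else 0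

/-- The vector `v_{n - 2 j}` of `V_n` (zero if `j > n`). -/
def wvec (n j : ℕ) : Fin (n + 1) → Cq := fun i => if (i : ℕ) = j then 1 else 0

/-- `E v_{n - 2 j} = [n - j + 1] v_{n - 2 j + 2}`. -/
def irrE (n : ℕ) : Module.End Cq (Fin (n + 1) → Cq) where
  toFun x := fun i => qint ((n : ℤ) - (i : ℕ)) * coord x (i + 1)
  map_add' x y := by
    funext i; simp only [coord, Pi.add_apply]; split <;> simp [mul_add]
  map_smul' c x := by
    funext i; simp only [coord, Pi.smul_apply, smul_eq_mul, RingHom.id_apply]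
    split <;> ring

/-- `F v_{n - 2 j} = [j + 1] v_{n - 2 j - 2}`. -/
def irrF (n : ℕ) : Module.End Cq (Fin (n + 1) → Cq) where
  toFun x := fun i => qint (i : ℕ) * coord x (i - 1)
  map_add' x y := by
    funext i; simp only [coord, Pi.add_apply]; split <;> simp [mul_add]
  map_smul' c x := by
    funext i; simp only [coord, Pi.smul_apply, smul_eq_mul, RingHom.id_apply]
    split <;> ring

/-- `K^{s} v_{n - 2 j} = q ^ {s (n - 2 j)} v_{n - 2 j}`. -/
def irrK (n : ℕ) (s : ℤ) : Module.End Cq (Fin (n + 1) → Cq) where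
  toFun x := fun i => q ^ (s * ((n : ℤ) - 2 * (i : ℕ))) * x i
  map_add' x y := by funext i; simp [mul_add]
  map_smul' c x := by funext i; simp; ring

theorem irrE_wvec_succ (n j : ℕ) (hj : j < n) :
    irrE n (wvec n (j + 1)) = qint ((n : ℤ) - j) • wvec n j := by
  funext i
  have := i.isLt
  simp only [irrE, LinearMap.coe_mk, AddHom.coe_mk, coord, wvec, Pi.smul_apply, smul_eq_mul]
  by_cases h : (i : ℕ) = j
  · simp [h, hj]
  · simp [h]

theorem irrE_wvec_zero (n : ℕ) : irrE n (wvec n 0) = 0 := by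
  funext i
  simp [irrE, coord, wvec]

theorem irrF_wvec (n j : ℕ) :
    irrF n (wvec n j) = qint ((j : ℤ) + 1) • wvec n (j + 1) := by
  funext i
  have := i.isLt
  simp only [irrF, LinearMap.coe_mk, AddHom.coe_mk, coord, wvec, Pi.smul_apply, smul_eq_mul]
  by_cases h : (i : ℕ) = j + 1
  · have h2 : j < n + 1 := by omega
    simp [h, h2]
  · by_cases h0 : (i : ℕ) = 0
    · simp [h0, qint]
    · have h3 : ¬ ((i : ℕ) - 1 = j) := by omega
      simp [h, h3]

/-- The irreducible module `V_n` of highest weight `q ^ n`, of dimension `n + 1`. -/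
def UqMod.irr (n : ℕ) : UqMod where
  carrier := Fin (n + 1) → Cq
  act := Uq.lift (irrE n) (irrF n) (irrK n 1) (irrK n (-1))
    (by
      refine LinearMap.ext fun x => funext fun i => ?_
      simp only [irrK, Module.End.mul_apply, LinearMap.coe_mk, AddHom.coe_mk, Module.End.one_apply]
      rw [← mul_assoc, ← zpow_add₀ q_ne_zero]; simp)
    (by
      refine LinearMap.ext fun x => funext fun i => ?_
      simp only [irrK, Module.End.mul_apply, LinearMap.coe_mk, AddHom.coe_mk, Module.End.one_apply]
      rw [← mul_assoc, ← zpow_add₀ q_ne_zero]; simp)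
    (by
      refine LinearMap.ext fun x => funext fun i => ?_
      simp only [irrK, irrE, Module.End.mul_apply, LinearMap.coe_mk, AddHom.coe_mk,
        LinearMap.smul_apply, Pi.smul_apply, smul_eq_mul, coord]
      split
      · have : q ^ (1 * ((n : ℤ) - 2 * (i : ℕ)))
            = q ^ 2 * q ^ (1 * ((n : ℤ) - 2 * ((i + 1 : ℕ) : ℤ))) := by
          rw [← zpow_natCast, ← zpow_add₀ q_ne_zero]; congr 1; push_cast; ring
        rw [this]; ring
      · simp)
    (by
      refine LinearMap.ext fun x => funext fun i => ?_
      simp only [irrK, irrF, Module.End.mul_apply, LinearMap.coe_mk, AddHom.coe_mk,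
        LinearMap.smul_apply, Pi.smul_apply, smul_eq_mul, coord]
      by_cases h0 : (i : ℕ) = 0
      · simp [h0, qint]
      split
      · have : q ^ (1 * ((n : ℤ) - 2 * (i : ℕ)))
            = (q ^ 2)⁻¹ * q ^ (1 * ((n : ℤ) - 2 * ((i - 1 : ℕ) : ℤ))) := by
          rw [← zpow_natCast, ← zpow_neg, ← zpow_add₀ q_ne_zero]; congr 1
          rw [Nat.cast_sub (by omega)]; push_cast; ring
        rw [this]; ring
      · simp)
    (by
      refine LinearMap.ext fun x => funext fun i => ?_
      have hi := i.isLt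
      have key : qint ((n : ℤ) - (i : ℕ)) * qint ((i : ℕ) + 1 : ℤ)
          - qint (i : ℕ) * qint ((n : ℤ) - (i : ℕ) + 1) = qint ((n : ℤ) - 2 * (i : ℕ)) :=
        qint_identity _ _
      simp only [irrK, irrE, irrF, Module.End.mul_apply, LinearMap.coe_mk, AddHom.coe_mk,
        LinearMap.sub_apply, LinearMap.smul_apply, Pi.sub_apply, Pi.smul_apply, smul_eq_mul]
      have hE : qint ((n : ℤ) - (i : ℕ)) * coord (fun i' : Fin (n + 1) =>
            qint ((i' : ℕ) : ℤ) * coord x (i' - 1)) (i + 1)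
          = qint ((n : ℤ) - (i : ℕ)) * qint ((i : ℕ) + 1 : ℤ) * x i := by
        by_cases h : (i : ℕ) + 1 < n + 1
        · have h2 : (i : ℕ) + 1 - 1 = i := by omega
          simp only [coord, h, dif_pos, h2, hi, mul_assoc]
          push_cast
          rfl
        · have : (n : ℤ) - (i : ℕ) = 0 := by omega
          simp [this, qint_zero]
      have hF : qint ((i : ℕ) : ℤ) * coord (fun i' : Fin (n + 1) =>
            qint ((n : ℤ) - (i' : ℕ)) * coord x (i' + 1)) (i - 1)
          = qint ((i : ℕ) : ℤ) * qint ((n : ℤ) - (i : ℕ) + 1) * x i := by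
        by_cases h : (i : ℕ) = 0
        · simp [h, qint_zero]
        · have h1 : (i : ℕ) - 1 < n + 1 := by omega
          have h2 : (i : ℕ) - 1 + 1 = i := by omega
          have h3 : (n : ℤ) - (((i : ℕ) - 1 : ℕ) : ℤ) = (n : ℤ) - (i : ℕ) + 1 := by omega
          simp only [coord, h1, dif_pos, h2, hi, h3, mul_assoc]
      rw [hE, hF, ← sub_mul, key, ← sub_mul, qint, div_eq_inv_mul, mul_assoc]
      simp only [one_mul, neg_mul])

/-- The vector `v_{n - 2 j}` as an element of the module `V_n`. -/
def UqMod.vec (n j : ℕ) : (UqMod.irr n).carrier := wvec n j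

/-- The module `V_{d_1} ⊗ ⋯ ⊗ V_{d_m}` (with the trivial module as the empty product). -/
def UqMod.tensorProd : (m : ℕ) → (Fin m → ℕ) → UqMod
  | 0, _ => UqMod.triv
  | m + 1, d => (UqMod.irr (d 0)).tensor (UqMod.tensorProd m (fun i => d i.succ))

/-! ## Crossingless matches -/

/-- The vertices: box number `i` carries `d i` vertices. -/
abbrev Vertex {m : ℕ} (d : Fin m → ℕ) : Type := Σ i : Fin m, Fin (d i)

/-- The order of the vertices from left to right. -/
def LeftOf {m : ℕ} {d : Fin m → ℕ} (x y : Vertex d) : Prop :=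
  x.1 < y.1 ∨ (x.1 = y.1 ∧ (x.2 : ℕ) < (y.2 : ℕ))

/-- A lower crossingless match. A curve is recorded as (left endpoint, right endpoint). Curves
are drawn in the half plane above the boxes; the unmatched vertices can be joined to a further
box above everything without crossing a curve, so they do not lie under a curve. -/
@[ext]
structure LowerMatch {m : ℕ} (d : Fin m → ℕ) where
  curves : Finset (Vertex d × Vertex d)
  box_lt : ∀ c ∈ curves, c.1.1 < c.2.1
  disjoint : ∀ c ∈ curves, ∀ c' ∈ curves,
    (c.1 = c'.1 ∨ c.1 = c'.2 ∨ c.2 = c'.1 ∨ c.2 = c'.2) → c = c'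
  noncrossing : ∀ c ∈ curves, ∀ c' ∈ curves,
    ¬ (LeftOf c.1 c'.1 ∧ LeftOf c'.1 c.2 ∧ LeftOf c.2 c'.2)
  unmatched_outside : ∀ x : Vertex d, (∀ c ∈ curves, c.1 ≠ x ∧ c.2 ≠ x) →
    ∀ c ∈ curves, ¬ (LeftOf c.1 x ∧ LeftOf x c.2)

namespace LowerMatch

variable {m : ℕ} {d : Fin m → ℕ}

/-- The unmatched vertices. -/
def unmatched (b : LowerMatch d) : Finset (Vertex d) :=
  Finset.univ.filter fun x => ∀ c ∈ b.curves, c.1 ≠ x ∧ c.2 ≠ x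

/-- The number `μ` of unmatched vertices; joining them to an upper box with `μ` vertices
identifies the matches with this `μ` with the crossingless matches from `d` to `μ`. -/
def mu (b : LowerMatch d) : ℕ := b.unmatched.card

/-- `n^b`: the size of a box minus the number of right endpoints of curves in that box. -/
def n (b : LowerMatch d) (i : Fin m) : ℕ :=
  d i - (b.curves.filter fun c => c.2.1 = i).card

end LowerMatch

/-- An oriented lower crossingless match. Curves are oriented to the left (their left endpoint
carries a down arrow, their right endpoint an up arrow); an orientation of the unmatched vertices
is chosen, recorded as the set `down` of those with a down arrow, such that those oriented down
are to the right of those oriented up. -/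
@[ext]
structure OrientedLowerMatch {m : ℕ} (d : Fin m → ℕ) where
  toMatch : LowerMatch d
  down : Finset (Vertex d)
  down_subset : down ⊆ toMatch.unmatched
  down_right : ∀ x ∈ down, ∀ y ∈ toMatch.unmatched, LeftOf x y → y ∈ down

/-- The tuple `a` of an oriented lower crossingless match: `a_i` is the number of vertices of
box `i`, matched or not, that carry a down arrow. -/
def OrientedLowerMatch.tuple {m : ℕ} {d : Fin m → ℕ} (a : OrientedLowerMatch d) (i : Fin m) : ℕ :=
  (a.toMatch.curves.filter fun c => c.1.1 = i).card + (a.down.filter fun x => x.1 = i).card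

/-! ## The tensor product variety -/

/-- For a flag `F` and a subspace `W`, `α(W, F)_i = dim (W ∩ F_i) / (W ∩ F_{i-1})`. -/
def alpha {k : Type u} {D : Type v} [Field k] [AddCommGroup D] [Module k D] {m : ℕ}
    (F : Fin (m + 1) → Submodule k D) (W : Submodule k D) (i : Fin m) : ℕ :=
  finrank k ↥(W ⊓ F i.succ) - finrank k ↥(W ⊓ F i.castSucc)

/-- The `k`-points of the tensor product variety. -/
@[ext]
structure TV (k : Type u) (D : Type v) [Field k] [AddCommGroup D] [Module k D] {m : ℕ}
    (d : Fin m → ℕ) where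
  flag : Fin (m + 1) → Submodule k D
  W : Submodule k D
  t : D →ₗ[k] D
  flag_zero : flag 0 = ⊥
  flag_last : flag (Fin.last m) = ⊤
  flag_le : ∀ i : Fin m, flag i.castSucc ≤ flag i.succ
  flag_dim : ∀ i : Fin m, finrank k (flag i.succ) = finrank k (flag i.castSucc) + d i
  t_flag : ∀ i : Fin m, (flag i.succ).map t ≤ flag i.castSucc
  range_le : LinearMap.range t ≤ W
  le_ker : W ≤ LinearMap.ker t

namespace TV

variable {k : Type u} {D : Type v} [Field k] [AddCommGroup D] [Module k D] {m : ℕ}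
  {d : Fin m → ℕ}

theorem baseChange_le {L : Type u} [Field L] [Algebra k L] {p : Submodule k D}
    {r : Submodule L (L ⊗[k] D)} (h : ∀ v ∈ p, (1 : L) ⊗ₜ[k] v ∈ r) : p.baseChange L ≤ r := by
  rw [Submodule.baseChange_eq_span, Submodule.span_le]
  rintro _ ⟨v, hv, rfl⟩
  exact h v hv

theorem finrank_baseChange_submodule (L : Type u) [Field L] [Algebra k L] (p : Submodule k D) :
    finrank L (p.baseChange L) = finrank k p := by
  rw [← (Submodule.toBaseChange.toLinearEquiv L p).finrank_eq, Module.finrank_baseChange]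

/-- The same point over a field extension `L` of `k`. -/
def baseChange (L : Type u) [Field L] [Algebra k L] (x : TV k D d) : TV L (L ⊗[k] D) d where
  flag i := (x.flag i).baseChange L
  W := x.W.baseChange L
  t := x.t.baseChange L
  flag_zero := by rw [x.flag_zero, Submodule.baseChange_bot]
  flag_last := by rw [x.flag_last, Submodule.baseChange_top]
  flag_le i := baseChange_le fun _ hv => Submodule.tmul_mem_baseChange_of_mem _ (x.flag_le i hv)
  flag_dim i := by
    rw [finrank_baseChange_submodule, finrank_baseChange_submodule, x.flag_dim]
  t_flag i := by
    rw [Submodule.map_le_iff_le_comap]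
    apply baseChange_le
    intro v hv
    rw [Submodule.mem_comap, LinearMap.baseChange_tmul]
    exact Submodule.tmul_mem_baseChange_of_mem _ (x.t_flag i (Submodule.mem_map_of_mem hv))
  range_le := by
    rintro _ ⟨y, rfl⟩
    induction y using TensorProduct.induction_on with
    | zero => simp
    | tmul a v =>
      rw [LinearMap.baseChange_tmul]
      exact Submodule.tmul_mem_baseChange_of_mem _ (x.range_le (LinearMap.mem_range_self _ v))
    | add y z hy hz => rw [map_add]; exact Submodule.add_mem _ hy hz
  le_ker := by
    apply baseChange_le
    intro v hv
    have h : x.t v = 0 := x.le_ker hv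
    rw [LinearMap.mem_ker, LinearMap.baseChange_tmul, h, TensorProduct.tmul_zero]

/-- The triple `(w, r, n) = (α(W, F), α(im t, F), α(ker t, F))` of a point; the points with a
given triple form the stratum `A_{w, r, n}`. -/
def label (x : TV k D d) : (Fin m → ℕ) × (Fin m → ℕ) × (Fin m → ℕ) :=
  (alpha x.flag x.W, alpha x.flag (LinearMap.range x.t), alpha x.flag (LinearMap.ker x.t))

/-- The fibre of `π₁ : (F, U, W, t) ↦ (F, U, t)` over `x`, a point of it being recorded by its
image `(F, W, t)` under `π₂`. -/
def fibreUp (x : TV k D d) : Set (TV k D d) :=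
  {y | y.flag = x.flag ∧ y.t = x.t ∧ x.W ≤ y.W ∧ finrank k y.W = finrank k x.W + 1}

/-- The fibre of `π₂ : (F, U, W, t) ↦ (F, W, t)` over `x`, a point of it being recorded by its
image `(F, U, t)` under `π₁`. -/
def fibreDown (x : TV k D d) : Set (TV k D d) :=
  {y | y.flag = x.flag ∧ y.t = x.t ∧ y.W ≤ x.W ∧ finrank k x.W = finrank k y.W + 1}

end TV

/-- `χ_q`: the number of points, as an element of `ℂ(q)`, of a variety over the finite field `k`
that has `N L` points over each finite extension `L` of `k`. It is the polynomial in `q` whose value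
at `q = √|L|` is `N L`, for every `L` (so `L` is the field with `q²` elements). -/
def chiq (k : Type u) [Field k]
    (N : (L : Type u) → [Field L] → [Algebra k L] → ℕ) : Cq :=
  open Classical in
  if h : ∃ P : Polynomial ℂ, ∀ (L : Type u) [Field L] [Algebra k L] [Finite L],
      P.eval ((Real.sqrt (Nat.card L) : ℝ) : ℂ) = (N L : ℂ)
  then algebraMap (Polynomial ℂ) Cq h.choose else 0

section Functions

variable {k : Type u} {D : Type v} [Field k] [AddCommGroup D] [Module k D] {m : ℕ}
  {d : Fin m → ℕ}

/-- The value of a function on a stratum on which it is constant (`0` if the stratum is empty). -/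
def stratumValue (f : TV k D d → Cq) (s : (Fin m → ℕ) × (Fin m → ℕ) × (Fin m → ℕ)) : Cq :=
  open Classical in
  if h : ∃ x : TV k D d, x.label = s then f h.choose else 0

/-- The operator `E f = q ^ (- dim π₁⁻¹(·)) (π₁)_! π₂^* f` on functions constant on the strata
`A_s`, where `((π₁)_! π₂^* 1_{A_s})(x) = χ_q(π₁⁻¹(x) ∩ π₂⁻¹(A_s))`. The fibre `π₁⁻¹(F, W, t)` is the
projective space of lines in `ker t / W`, of dimension `dim ker t - dim W - 1`. -/
def opE (f : TV k D d → Cq) (x : TV k D d) : Cq :=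
  q ^ (-((finrank k (LinearMap.ker x.t) : ℤ) - finrank k x.W - 1)) *
    ∑ᶠ s, stratumValue f s *
      chiq k (fun L => Nat.card {y : TV L (L ⊗[k] D) d // y ∈ (x.baseChange L).fibreUp ∧ y.label = s})

/-- The operator `F f = q ^ (- dim π₂⁻¹(·)) (π₂)_! π₁^* f` on functions constant on the strata
`A_s`. The fibre `π₂⁻¹(F, W, t)` is the projective space of hyperplanes in `W / im t`, of dimension
`dim W - rank t - 1`. -/
def opF (f : TV k D d → Cq) (x : TV k D d) : Cq :=
  q ^ (-((finrank k x.W : ℤ) - finrank k (LinearMap.range x.t) - 1)) *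
    ∑ᶠ s, stratumValue f s *
      chiq k (fun L => Nat.card {y : TV L (L ⊗[k] D) d // y ∈ (x.baseChange L).fibreDown ∧ y.label = s})

/-- The operator `K ^ s`, multiplication by `q ^ (s (dim D - 2 dim W))`. -/
def opK (s : ℤ) (f : TV k D d → Cq) (x : TV k D d) : Cq :=
  q ^ (s * ((finrank k D : ℤ) - 2 * finrank k x.W)) * f x

variable (k D d)

/-- The space of functions on the tensor product variety that are invariant under `GL(D)`. -/
def invariantFunctions : Submodule Cq (TV k D d → Cq) where
  carrier := {f | ∀ (g : D ≃ₗ[k] D) (x y : TV k D d),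
    (∀ i, y.flag i = (x.flag i).map (g : D →ₗ[k] D)) → y.W = x.W.map (g : D →ₗ[k] D) →
    y.t = (g : D →ₗ[k] D) ∘ₗ x.t ∘ₗ (g.symm : D →ₗ[k] D) → f y = f x}
  zero_mem' := by intro g x y _ _ _; rfl
  add_mem' := by
    intro f f' hf hf' g x y h1 h2 h3
    simp [hf g x y h1 h2 h3, hf' g x y h1 h2 h3]
  smul_mem' := by
    intro c f hf g x y h1 h2 h3
    simp [hf g x y h1 h2 h3]

/-- The space `T_s(d)` of invariant functions that depend only on `dim W` and `α(ker t, F)`. -/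
def Ts : Submodule Cq (TV k D d → Cq) where
  carrier := {f | f ∈ invariantFunctions k D d ∧ ∀ x y : TV k D d,
    finrank k x.W = finrank k y.W →
    alpha x.flag (LinearMap.ker x.t) = alpha y.flag (LinearMap.ker y.t) → f x = f y}
  zero_mem' := ⟨Submodule.zero_mem _, fun _ _ _ _ => rfl⟩
  add_mem' := by
    rintro f f' ⟨hf, hf2⟩ ⟨hf', hf2'⟩
    refine ⟨Submodule.add_mem _ hf hf', fun x y h1 h2 => ?_⟩
    simp [hf2 x y h1 h2, hf2' x y h1 h2]
  smul_mem' := by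
    rintro c f ⟨hf, hf2⟩
    refine ⟨Submodule.smul_mem _ c hf, fun x y h1 h2 => ?_⟩
    simp [hf2 x y h1 h2]

variable {d}

/-- The set `Y_a`. -/
def Y (a : OrientedLowerMatch d) : Set (TV k D d) :=
  {x | alpha x.flag (LinearMap.ker x.t) = a.toMatch.n ∧ finrank k x.W = ∑ i, a.tuple i}

/-- The indicator function of `Y_a`. -/
def oneY (a : OrientedLowerMatch d) : TV k D d → Cq := Set.indicator (Y k D a) (fun _ => 1)

/-- The span of the functions `1_{Y_a}` for the `a` with underlying unoriented match `b`. -/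
def spanY (b : LowerMatch d) : Submodule Cq (Ts k D d) :=
  Submodule.span Cq {f | ∃ a : OrientedLowerMatch d, a.toMatch = b ∧ (f : TV k D d → Cq) = oneY k D a}

end Functions

/-- A subspace stable under the action of `U_q`. -/
def IsSubrep {M : Type*} [AddCommGroup M] [Module Cq M] (ρ : Uq →ₐ[Cq] Module.End Cq M)
    (S : Submodule Cq M) : Prop :=
  ∀ u : Uq, ∀ x ∈ S, ρ u x ∈ S

/-- An irreducible subrepresentation. -/
def IsIrredSubrep {M : Type*} [AddCommGroup M] [Module Cq M] (ρ : Uq →ₐ[Cq] Module.End Cq M)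
    (S : Submodule Cq M) : Prop :=
  IsSubrep ρ S ∧ S ≠ ⊥ ∧ ∀ S' ≤ S, IsSubrep ρ S' → S' = ⊥ ∨ S' = S

end QTensor

end

open QTensor

noncomputable section

namespace QTensor

/-! ## Representations of the quantum group -/

/-! Both sides decompose into irreducibles indexed by the same combinatorial set: the tuples `r`
with `r_i ≤ d_i` and `r_i + 2 ∑_{j<i} r_j ≤ ∑_{j<i} d_j` (`Admissible 0 d r`), the summand of `r`
being `V_μ` with `μ = ∑ d_i - 2 ∑ r_i`.

Algebra. Clebsch-Gordan (`isoRep_clebschGordan`) is proved by exhibiting highest weight vectors in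
`V_a ⊗ V_b`. Absorbing the factors `V_{d_i}` one at a time gives the decomposition
`isoRep_tensorProd`.

Combinatorics. In a lower crossingless match the right endpoints are the first vertices of each box,
and the match is recovered from their numbers `r_i` by matching parentheses. Admissibility says that
every closing parenthesis has a partner, so matches correspond to admissible tuples
(`LowerMatch.equivAdmissible`).

Geometry. As `im t ≤ W ≤ ker t` gives `t² = 0`, `t` maps `F_i` into `ker t ∩ F_{i-1}`. Comparing
dimensions shows that `d - α(ker t, F)` is admissible, so every point determines a match `b`, and
every match arises from a point (`exists_isAt`, `exists_of_match`). If `b` has `c` curves, then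
`rank t = c` and `dim ker t = c + μ`, so `j = dim W - c` takes the values `0, …, μ`. Hence `coords`
identifies `T_s(d)` with the product over `b` of spaces of dimension `μ + 1`, and `1_{Y_a}` with a
standard basis vector.

Operators. The fibre of `π₁` is the projective space of `ker t / W`, and that of `π₂` is the space
of hyperplanes of `W / im t`. The normalised point counts are the quantum integers `[dim ker t - dim
W] = [μ - j]` and `[dim W - rank t] = [j]`, which are the matrix coefficients of `E` and `F` on
`V_μ` (`opE_coords`, `opF_coords`). The real work is that `χ_q` is taken stratum by stratum: the
fibre is filtered by the flag, each step is counted by a polynomial, and the sum telescopes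
(`card_strata`, `finsum_strata`). -/

theorem q_pow_eq_one {j : ℕ} (h : q ^ j = 1) : j = 0 := by
  have h1 : algebraMap (Polynomial ℂ) Cq (Polynomial.X ^ j) = algebraMap (Polynomial ℂ) Cq 1 := by
    simpa [q, RatFunc.algebraMap_X] using h
  have h2 := congrArg Polynomial.natDegree (RatFunc.algebraMap_injective ℂ h1)
  simpa using h2

/-- Since `q` is not a root of unity, nonzero quantum integers are invertible and `K` separates
weights. All the complete reducibility arguments below rest on these two facts. -/
theorem q_zpow_injective : Function.Injective (fun j : ℤ => q ^ j) := by
  have key : ∀ j : ℤ, q ^ j = 1 → j = 0 := by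
    intro j hj
    obtain ⟨n, rfl | rfl⟩ := j.eq_nat_or_neg
    · exact_mod_cast q_pow_eq_one (by simpa using hj)
    · simpa using q_pow_eq_one (j := n) (by simpa using hj)
  intro i j hij
  have : q ^ (i - j) = 1 := by
    rw [zpow_sub₀ q_ne_zero]
    exact (div_eq_one_iff_eq (zpow_ne_zero _ q_ne_zero)).2 hij
  have := key _ this
  omega

theorem qint_ne_zero {j : ℤ} (hj : j ≠ 0) : qint j ≠ 0 := by
  rw [qint, div_ne_zero_iff]
  refine ⟨fun h => hj ?_, q_sub_inv_ne_zero⟩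
  have := q_zpow_injective (sub_eq_zero.1 h)
  omega

theorem Uq.lift_gen {A : Type*} [Ring A] [Algebra Cq A] (e f k k' : A)
    (h1 : k * k' = 1) (h2 : k' * k = 1) (h3 : k * e = q ^ 2 • (e * k))
    (h4 : k * f = (q ^ 2)⁻¹ • (f * k)) (h5 : e * f - f * e = (q - q⁻¹)⁻¹ • (k - k')) (g : Gen) :
    Uq.lift e f k k' h1 h2 h3 h4 h5 (gen g) = match g with
      | Gen.E => e
      | Gen.F => f
      | Gen.K => k
      | Gen.Kinv => k' := by
  have := RingQuot.liftAlgHom_mkAlgHom_apply Cq (s := Rel) (FreeAlgebra.lift Cq (fun g : Gen => match g with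
      | Gen.E => e
      | Gen.F => f
      | Gen.K => k
      | Gen.Kinv => k')) (by
      intro x y hxy
      cases hxy <;> simp [h1, h2, h3, h4, h5]) (FreeAlgebra.ι Cq g)
  exact this.trans (FreeAlgebra.lift_ι_apply _ _)

/-- A property of elements of `U_q` closed under the algebra operations holds everywhere if it
holds on the generators. -/
theorem Uq.induction {P : Uq → Prop} (halg : ∀ c : Cq, P (algebraMap Cq Uq c))
    (hgen : ∀ g, P (gen g)) (hadd : ∀ a b, P a → P b → P (a + b))
    (hmul : ∀ a b, P a → P b → P (a * b)) (u : Uq) : P u := by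
  obtain ⟨x, rfl⟩ : ∃ x, Uq.mk x = u := RingQuot.mkAlgHom_surjective Cq Rel u
  induction x using FreeAlgebra.induction with
  | grade0 r => rw [AlgHom.commutes]; exact halg r
  | grade1 g => exact hgen g
  | mul a b ha hb => rw [map_mul]; exact hmul _ _ ha hb
  | add a b ha hb => rw [map_add]; exact hadd _ _ ha hb

section Representations

variable {M N P : Type*} [AddCommGroup M] [Module Cq M] [AddCommGroup N] [Module Cq N]
  [AddCommGroup P] [Module Cq P]

theorem intertwines_of_gen (ρ : Uq →ₐ[Cq] Module.End Cq M) (σ : Uq →ₐ[Cq] Module.End Cq N)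
    (φ : M →ₗ[Cq] N) (h : ∀ g x, φ (ρ (gen g) x) = σ (gen g) (φ x)) (u : Uq) (x : M) :
    φ (ρ u x) = σ u (φ x) := by
  induction u using Uq.induction generalizing x with
  | halg c => simp [Module.algebraMap_end_apply]
  | hgen g => exact h g x
  | hadd a b ha hb => simp [ha, hb]
  | hmul a b ha hb => simp [ha, hb]

/-- Isomorphic representations. -/
def IsoRep (ρ : Uq →ₐ[Cq] Module.End Cq M) (σ : Uq →ₐ[Cq] Module.End Cq N) : Prop :=
  ∃ φ : M ≃ₗ[Cq] N, ∀ u x, φ (ρ u x) = σ u (φ x)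

theorem IsoRep.of_gen {ρ : Uq →ₐ[Cq] Module.End Cq M} {σ : Uq →ₐ[Cq] Module.End Cq N}
    (φ : M ≃ₗ[Cq] N) (h : ∀ g x, φ (ρ (gen g) x) = σ (gen g) (φ x)) : IsoRep ρ σ :=
  ⟨φ, intertwines_of_gen ρ σ φ.toLinearMap h⟩

theorem IsoRep.symm {ρ : Uq →ₐ[Cq] Module.End Cq M} {σ : Uq →ₐ[Cq] Module.End Cq N}
    (h : IsoRep ρ σ) : IsoRep σ ρ := by
  obtain ⟨φ, hφ⟩ := h
  exact ⟨φ.symm, fun u x => by rw [LinearEquiv.symm_apply_eq, hφ, LinearEquiv.apply_symm_apply]⟩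

theorem IsoRep.trans {ρ : Uq →ₐ[Cq] Module.End Cq M} {σ : Uq →ₐ[Cq] Module.End Cq N}
    {τ : Uq →ₐ[Cq] Module.End Cq P} (h : IsoRep ρ σ) (h' : IsoRep σ τ) : IsoRep ρ τ := by
  obtain ⟨φ, hφ⟩ := h
  obtain ⟨ψ, hψ⟩ := h'
  exact ⟨φ.trans ψ, fun u x => by simp [hφ, hψ]⟩

/-- The product of a family of representations. -/
def piRep {ι : Type*} {M : ι → Type*} [∀ i, AddCommGroup (M i)] [∀ i, Module Cq (M i)]
    (ρ : ∀ i, Uq →ₐ[Cq] Module.End Cq (M i)) : Uq →ₐ[Cq] Module.End Cq (∀ i, M i) :=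
  AlgHom.ofLinearMap
    { toFun := fun u => LinearMap.pi fun i => ρ i u ∘ₗ LinearMap.proj i
      map_add' := fun u v => by ext; simp
      map_smul' := fun c u => by ext; simp }
    (by ext; simp) (fun u v => by ext; simp)

@[simp]
theorem piRep_apply {ι : Type*} {M : ι → Type*} [∀ i, AddCommGroup (M i)]
    [∀ i, Module Cq (M i)] (ρ : ∀ i, Uq →ₐ[Cq] Module.End Cq (M i)) (u : Uq) (x : ∀ i, M i)
    (i : ι) : piRep ρ u x i = ρ i u (x i) := rfl

theorem IsoRep.pi {ι : Type*} {M N : ι → Type*} [∀ i, AddCommGroup (M i)]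
    [∀ i, Module Cq (M i)] [∀ i, AddCommGroup (N i)] [∀ i, Module Cq (N i)]
    {ρ : ∀ i, Uq →ₐ[Cq] Module.End Cq (M i)} {σ : ∀ i, Uq →ₐ[Cq] Module.End Cq (N i)}
    (h : ∀ i, IsoRep (ρ i) (σ i)) : IsoRep (piRep ρ) (piRep σ) := by
  choose φ hφ using h
  exact ⟨LinearEquiv.piCongrRight φ, fun u x => by ext i; simp [hφ]⟩

theorem IsoRep.pi_reindex {ι κ : Type*} {M : κ → Type*} [∀ i, AddCommGroup (M i)]
    [∀ i, Module Cq (M i)] (ρ : ∀ i, Uq →ₐ[Cq] Module.End Cq (M i)) (e : ι ≃ κ) :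
    IsoRep (piRep fun i => ρ (e i)) (piRep ρ) :=
  ⟨LinearEquiv.piCongrLeft Cq M e, fun u x => by
    ext j
    obtain ⟨i, rfl⟩ := e.surjective j
    change Equiv.piCongrLeft M e _ (e i) = ρ (e i) u (Equiv.piCongrLeft M e x (e i))
    rw [Equiv.piCongrLeft_apply_apply, Equiv.piCongrLeft_apply_apply, piRep_apply]⟩

theorem IsoRep.pi_curry {ι : Type*} {κ : ι → Type*} {M : (Σ i, κ i) → Type*}
    [∀ i, AddCommGroup (M i)] [∀ i, Module Cq (M i)]
    (ρ : ∀ i, Uq →ₐ[Cq] Module.End Cq (M i)) :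
    IsoRep (piRep fun i => piRep fun j => ρ ⟨i, j⟩) (piRep ρ) :=
  IsoRep.symm ⟨LinearEquiv.piCurry Cq (fun i j => M ⟨i, j⟩), fun u x => by ext i j; rfl⟩

/-- The tensor product of two representations. -/
def tensorRep (ρ : Uq →ₐ[Cq] Module.End Cq M) (σ : Uq →ₐ[Cq] Module.End Cq N) :
    Uq →ₐ[Cq] Module.End Cq (M ⊗[Cq] N) :=
  ((Module.endTensorEndAlgHom (R := Cq) (S := Cq) (A := Cq)
    (M := M) (N := N)).comp (Algebra.TensorProduct.map ρ σ)).comp comul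

section TensorGen

variable (ρ : Uq →ₐ[Cq] Module.End Cq M) (σ : Uq →ₐ[Cq] Module.End Cq N) (x : M) (y : N)

theorem tensorRep_E : tensorRep ρ σ (gen Gen.E) (x ⊗ₜ y)
    = ρ (gen Gen.E) x ⊗ₜ y + ρ (gen Gen.K) x ⊗ₜ σ (gen Gen.E) y := by
  simp [tensorRep, comul, Uq.lift_gen, Module.endTensorEndAlgHom_apply]

theorem tensorRep_F : tensorRep ρ σ (gen Gen.F) (x ⊗ₜ y)
    = ρ (gen Gen.F) x ⊗ₜ σ (gen Gen.Kinv) y + x ⊗ₜ σ (gen Gen.F) y := by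
  simp [tensorRep, comul, Uq.lift_gen, Module.endTensorEndAlgHom_apply]

theorem tensorRep_K : tensorRep ρ σ (gen Gen.K) (x ⊗ₜ y)
    = ρ (gen Gen.K) x ⊗ₜ σ (gen Gen.K) y := by
  simp [tensorRep, comul, Uq.lift_gen, Module.endTensorEndAlgHom_apply]

theorem tensorRep_Kinv : tensorRep ρ σ (gen Gen.Kinv) (x ⊗ₜ y)
    = ρ (gen Gen.Kinv) x ⊗ₜ σ (gen Gen.Kinv) y := by
  simp [tensorRep, comul, Uq.lift_gen, Module.endTensorEndAlgHom_apply]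

end TensorGen

theorem IsoRep.tensor_left {M' : Type*} [AddCommGroup M'] [Module Cq M']
    {ρ : Uq →ₐ[Cq] Module.End Cq M} {ρ' : Uq →ₐ[Cq] Module.End Cq M'}
    (h : IsoRep ρ ρ') (σ : Uq →ₐ[Cq] Module.End Cq N) :
    IsoRep (tensorRep ρ σ) (tensorRep ρ' σ) := by
  obtain ⟨φ, hφ⟩ := h
  refine IsoRep.of_gen (TensorProduct.congr φ (LinearEquiv.refl Cq N)) fun g x => ?_
  induction x using TensorProduct.induction_on with
  | zero => simp
  | add x y hx hy => simp only [map_add, hx, hy]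
  | tmul x y =>
    cases g <;> simp [tensorRep_E, tensorRep_F, tensorRep_K, tensorRep_Kinv, hφ]

/-- Coassociativity, checked on generators. It is needed because `UqMod.tensorProd` is bracketed to
the right, while the decomposition absorbs factors from the left. -/
theorem isoRep_tensor_assoc (ρ : Uq →ₐ[Cq] Module.End Cq M) (σ : Uq →ₐ[Cq] Module.End Cq N)
    (τ : Uq →ₐ[Cq] Module.End Cq P) :
    IsoRep (tensorRep (tensorRep ρ σ) τ) (tensorRep ρ (tensorRep σ τ)) := by
  refine IsoRep.of_gen (TensorProduct.assoc Cq M N P) fun g x => ?_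
  induction x using TensorProduct.induction_on with
  | zero => simp
  | add x y hx hy => simp only [map_add, hx, hy]
  | tmul x z =>
    induction x using TensorProduct.induction_on with
    | zero => simp
    | add x y hx hy => simp only [map_add, TensorProduct.add_tmul, hx, hy]
    | tmul x y =>
      cases g <;> simp [tensorRep_E, tensorRep_F, tensorRep_K, tensorRep_Kinv,
        TensorProduct.add_tmul, TensorProduct.tmul_add, add_assoc]

theorem isoRep_pi_tensor {ι : Type*} [Fintype ι] [DecidableEq ι] {M : ι → Type*}
    [∀ i, AddCommGroup (M i)] [∀ i, Module Cq (M i)]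
    (ρ : ∀ i, Uq →ₐ[Cq] Module.End Cq (M i)) (σ : Uq →ₐ[Cq] Module.End Cq N) :
    IsoRep (tensorRep (piRep ρ) σ) (piRep fun i => tensorRep (ρ i) σ) := by
  refine IsoRep.of_gen (TensorProduct.piLeft Cq N M) fun g x => ?_
  induction x using TensorProduct.induction_on with
  | zero => simp
  | add x y hx hy => simp only [map_add, hx, hy]
  | tmul x y =>
    ext i
    cases g <;> simp [tensorRep_E, tensorRep_F, tensorRep_K, tensorRep_Kinv]

end Representations

/-! ## Irreducible representations and the Clebsch-Gordan decomposition -/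

/-- The representation `V_n`. -/
def irrRep (n : ℕ) : Uq →ₐ[Cq] Module.End Cq (Fin (n + 1) → Cq) := (UqMod.irr n).act

theorem irrRep_E (n : ℕ) : irrRep n (gen Gen.E) = irrE n := by
  simp only [irrRep, UqMod.irr, Uq.lift_gen]

theorem irrRep_F (n : ℕ) : irrRep n (gen Gen.F) = irrF n := by
  simp only [irrRep, UqMod.irr, Uq.lift_gen]

theorem irrRep_K (n : ℕ) : irrRep n (gen Gen.K) = irrK n 1 := by
  simp only [irrRep, UqMod.irr, Uq.lift_gen]

theorem irrRep_Kinv (n : ℕ) : irrRep n (gen Gen.Kinv) = irrK n (-1) := by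
  simp only [irrRep, UqMod.irr, Uq.lift_gen]

theorem irrK_wvec (n j : ℕ) (s : ℤ) :
    irrK n s (wvec n j) = q ^ (s * ((n : ℤ) - 2 * j)) • wvec n j := by
  funext i
  by_cases h : (i : ℕ) = j <;> simp [irrK, wvec, h]

theorem wvec_eq_single (n : ℕ) (i : Fin (n + 1)) : wvec n i = Pi.single i 1 := by
  funext j
  by_cases h : j = i <;> simp [wvec, h, Fin.val_inj]

theorem wvec_eq_zero {n j : ℕ} (h : n < j) : wvec n j = 0 := by
  funext i
  have := i.isLt
  simp [wvec, show (i : ℕ) ≠ j by omega]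

/-- Each application of `E` reads the next coordinate, so after `j` of them coordinate `i` would
read position `i + j`, which is out of range. -/
theorem irrE_pow_apply (n j : ℕ) (x : Fin (n + 1) → Cq) (i : Fin (n + 1)) (h : n < i + j) :
    ((irrE n) ^ j) x i = 0 := by
  induction j generalizing i with
  | zero => omega
  | succ j ih =>
    rw [pow_succ', Module.End.mul_apply]
    change qint _ * coord _ _ = 0
    rw [coord]
    split_ifs with h1
    · rw [ih ⟨i + 1, h1⟩ (by change n < i + 1 + j; omega), mul_zero]
    · rw [mul_zero]

theorem irrE_pow_eq_zero {n j : ℕ} (h : n < j) : (irrE n) ^ j = 0 := by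
  exact LinearMap.ext fun x => funext fun i => irrE_pow_apply n j x i (by omega)

/-- The coefficients `[n - i]` with `i < n` are nonzero, so `ker E` is the highest weight line. -/
theorem eq_smul_of_irrE_eq_zero {n : ℕ} {x : Fin (n + 1) → Cq} (h : irrE n x = 0) :
    x = x 0 • wvec n 0 := by
  funext i
  obtain ⟨i, hi⟩ := i
  cases i with
  | zero => simp [wvec]
  | succ i =>
    have h1 := congrFun h ⟨i, by omega⟩
    change qint ((n : ℤ) - i) * coord x (i + 1) = 0 at h1
    rw [coord, dif_pos hi] at h1
    have h2 := (mul_eq_zero.1 h1).resolve_left (qint_ne_zero (by omega))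
    simp [wvec, h2]

/-- A nonzero subspace stable under a locally nilpotent operator meets its kernel. -/
theorem exists_mem_ker_of_nilpotent {M : Type*} [AddCommGroup M] [Module Cq M]
    (T : Module.End Cq M) (S : Submodule Cq M) (hS : ∀ x ∈ S, T x ∈ S) (x : M) (hx : x ∈ S)
    (hx0 : x ≠ 0) (N : ℕ) (hN : (T ^ N) x = 0) : ∃ y ∈ S, y ≠ 0 ∧ T y = 0 := by
  induction N generalizing x with
  | zero => exact absurd hN hx0
  | succ N ih =>
    by_cases h : T x = 0
    · exact ⟨x, hx, hx0, h⟩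
    · exact ih (T x) (hS x hx) h (by rwa [pow_succ, Module.End.mul_apply] at hN)

/-- A nonzero stable subspace meets `ker E`, hence contains the highest weight vector; `F` then
produces all weight vectors because the factors `[j + 1]` are invertible. -/
theorem irrRep_irreducible (n : ℕ) (S : Submodule Cq (Fin (n + 1) → Cq))
    (hS : IsSubrep (irrRep n) S) : S = ⊥ ∨ S = ⊤ := by
  by_cases hbot : S = ⊥
  · exact Or.inl hbot
  right
  obtain ⟨x, hx, hx0⟩ := S.ne_bot_iff.1 hbot
  obtain ⟨y, hy, hy0, hEy⟩ := exists_mem_ker_of_nilpotent (irrE n) S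
    (fun x hx => by simpa [irrRep_E] using hS (gen Gen.E) x hx) x hx hx0 (n + 1)
    (by rw [irrE_pow_eq_zero (by omega)]; rfl)
  have hw : ∀ j, wvec n j ∈ S := by
    intro j
    induction j with
    | zero =>
      have hy1 := eq_smul_of_irrE_eq_zero hEy
      have hc : y 0 ≠ 0 := fun h => hy0 (by rw [hy1, h, zero_smul])
      rw [hy1] at hy
      exact (S.smul_mem_iff hc).1 hy
    | succ j ih =>
      have h1 := hS (gen Gen.F) _ ih
      rw [irrRep_F, irrF_wvec] at h1
      exact (S.smul_mem_iff (qint_ne_zero (by omega))).1 h1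
  rw [eq_top_iff]
  intro z _
  rw [← Finset.univ_sum_single z]
  refine S.sum_mem fun i _ => ?_
  have := S.smul_mem (z i) (hw i)
  rwa [wvec_eq_single, ← Pi.single_smul, smul_eq_mul, mul_one] at this

/-! ### Highest weight vectors and the maps `V_n → M` they define -/

section HighestWeight

variable {M : Type*} [AddCommGroup M] [Module Cq M] (ρ : Uq →ₐ[Cq] Module.End Cq M)

/-- A highest weight vector of weight `q ^ n`. -/
structure IsHighestWeight (n : ℕ) (v : M) : Prop where
  E_eq_zero : ρ (gen Gen.E) v = 0
  K_eq : ρ (gen Gen.K) v = q ^ (n : ℤ) • v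

/-- The divided powers of `F` applied to a vector. -/
def divPowF (v : M) : ℕ → M
  | 0 => v
  | j + 1 => (qint ((j : ℤ) + 1))⁻¹ • ρ (gen Gen.F) (divPowF v j)

variable {ρ}

theorem F_divPowF (v : M) (j : ℕ) :
    ρ (gen Gen.F) (divPowF ρ v j) = qint ((j : ℤ) + 1) • divPowF ρ v (j + 1) := by
  rw [divPowF, smul_smul, mul_inv_cancel₀ (qint_ne_zero (by omega)), one_smul]

theorem Kinv_of_K {v : M} {c : Cq} (hc : c ≠ 0) (h : ρ (gen Gen.K) v = c • v) :
    ρ (gen Gen.Kinv) v = c⁻¹ • v := by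
  have h1 : ρ (gen Gen.Kinv) (ρ (gen Gen.K) v) = v := by
    rw [← Module.End.mul_apply, ← map_mul, gen_Kinv_K, map_one, Module.End.one_apply]
  rw [h, map_smul] at h1
  rw [← h1, smul_smul, inv_mul_cancel₀ hc, one_smul, h1]

theorem E_F_apply (v : M) : ρ (gen Gen.E) (ρ (gen Gen.F) v) = ρ (gen Gen.F) (ρ (gen Gen.E) v)
    + (q - q⁻¹)⁻¹ • (ρ (gen Gen.K) v - ρ (gen Gen.Kinv) v) := by
  have := LinearMap.congr_fun (congrArg ρ gen_E_F) v
  simp only [map_sub, map_mul, map_smul, LinearMap.sub_apply, Module.End.mul_apply,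
    LinearMap.smul_apply] at this
  rw [← this]
  abel

variable {n : ℕ} {v : M} (hv : IsHighestWeight ρ n v)
include hv

theorem IsHighestWeight.K_divPowF (j : ℕ) :
    ρ (gen Gen.K) (divPowF ρ v j) = q ^ ((n : ℤ) - 2 * j) • divPowF ρ v j := by
  induction j with
  | zero => simpa [divPowF] using hv.K_eq
  | succ j ih =>
    have h := LinearMap.congr_fun (congrArg ρ gen_K_F) (divPowF ρ v j)
    simp only [map_mul, map_smul, Module.End.mul_apply, LinearMap.smul_apply] at h
    rw [divPowF, map_smul, h, ih, map_smul, smul_smul, smul_smul, smul_smul]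
    have e : q ^ ((n : ℤ) - 2 * ((j + 1 : ℕ) : ℤ)) = (q ^ 2)⁻¹ * q ^ ((n : ℤ) - 2 * j) := by
      rw [← zpow_natCast, ← zpow_neg, ← zpow_add₀ q_ne_zero]
      congr 1
      push_cast
      ring
    rw [e]
    congr 1
    ring

theorem IsHighestWeight.Kinv_divPowF (j : ℕ) :
    ρ (gen Gen.Kinv) (divPowF ρ v j) = q ^ (-((n : ℤ) - 2 * j)) • divPowF ρ v j := by
  rw [Kinv_of_K (zpow_ne_zero _ q_ne_zero) (hv.K_divPowF j), zpow_neg]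

/-- Induction along `EF = FE + (K - K⁻¹)/(q - q⁻¹)`. The inductive step is the identity
`[n-j-1][j+2] = [j+1][n-j] + [n-2j-2]`. -/
theorem IsHighestWeight.E_divPowF (j : ℕ) :
    ρ (gen Gen.E) (divPowF ρ v (j + 1)) = qint ((n : ℤ) - j) • divPowF ρ v j := by
  have hK : ∀ j : ℕ, (q - q⁻¹)⁻¹ • (ρ (gen Gen.K) (divPowF ρ v j)
      - ρ (gen Gen.Kinv) (divPowF ρ v j)) = qint ((n : ℤ) - 2 * j) • divPowF ρ v j := by
    intro j
    rw [hv.K_divPowF, hv.Kinv_divPowF, ← sub_smul, smul_smul, qint, div_eq_inv_mul]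
  have key : ∀ j : ℕ, ρ (gen Gen.E) (ρ (gen Gen.F) (divPowF ρ v j))
      = (qint ((n : ℤ) - j) * qint ((j : ℤ) + 1)) • divPowF ρ v j →
      ρ (gen Gen.E) (divPowF ρ v (j + 1)) = qint ((n : ℤ) - j) • divPowF ρ v j := by
    intro j h
    rw [divPowF, map_smul, h, smul_smul, mul_comm, mul_assoc,
      mul_inv_cancel₀ (qint_ne_zero (by omega)), mul_one]
  induction j with
  | zero =>
    apply key
    rw [E_F_apply, hK]
    have : qint 1 = 1 := by
      rw [qint, zpow_neg, zpow_one, div_self q_sub_inv_ne_zero]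
    simp [divPowF, hv.E_eq_zero, this]
  | succ j ih =>
    apply key
    rw [E_F_apply, hK, ih, map_smul, F_divPowF, smul_smul, ← add_smul]
    have := qint_identity n (j + 1)
    rw [show (n : ℤ) - (j + 1) + 1 = n - j by ring] at this
    push_cast
    rw [← this]
    congr 1
    ring

/-- If the vector of index `n + 1` were nonzero, so would be all later ones, since `E` carries each
to a nonzero multiple `[-1-i]` of its predecessor. Their infinitely many distinct `K`-eigenvalues
contradict finite dimension. -/
theorem IsHighestWeight.divPowF_eq_zero [FiniteDimensional Cq M] : divPowF ρ v (n + 1) = 0 := by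
  by_contra hne
  have h : ∀ i : ℕ, divPowF ρ v (n + 1 + i) ≠ 0 := by
    intro i
    induction i with
    | zero => exact hne
    | succ i ih =>
      intro h0
      have h1 := hv.E_divPowF (n + 1 + i)
      rw [show n + 1 + i + 1 = n + 1 + (i + 1) by ring, h0, map_zero] at h1
      exact (smul_ne_zero (qint_ne_zero (by push_cast; omega)) ih) h1.symm
  refine Set.infinite_of_injective_forall_mem (f := fun i : ℕ =>
    q ^ ((n : ℤ) - 2 * ((n + 1 + i : ℕ) : ℤ))) ?_ ?_
    (Module.End.finite_hasEigenvalue (ρ (gen Gen.K)))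
  · intro i j hij
    have := q_zpow_injective hij
    push_cast at this
    omega
  · intro i
    exact Module.End.hasEigenvalue_of_hasEigenvector
      (Module.End.hasEigenvector_iff.2
        ⟨Module.End.mem_eigenspace_iff.2 (hv.K_divPowF (n + 1 + i)), h i⟩)

omit hv in
variable (ρ n v) in
/-- The map `V_n → M` sending `v_{n - 2 j}` to the `j`-th divided power of `F` applied to a
given vector. -/
def hwMap : (Fin (n + 1) → Cq) →ₗ[Cq] M :=
  Fintype.linearCombination Cq fun j : Fin (n + 1) => divPowF ρ v j

omit hv in
theorem hwMap_wvec {j : ℕ} (hj : j ≤ n) : hwMap ρ n v (wvec n j) = divPowF ρ v j := by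
  have := wvec_eq_single n ⟨j, by omega⟩
  rw [show wvec n j = wvec n ((⟨j, by omega⟩ : Fin (n + 1)) : ℕ) from rfl, this, hwMap,
    Fintype.linearCombination_apply_single, one_smul]

theorem IsHighestWeight.intertwines [FiniteDimensional Cq M] (u : Uq) (x : Fin (n + 1) → Cq) :
    hwMap ρ n v (irrRep n u x) = ρ u (hwMap ρ n v x) := by
  refine intertwines_of_gen (irrRep n) ρ (hwMap ρ n v) (fun g x => ?_) u x
  have : hwMap ρ n v ∘ₗ irrRep n (gen g) = ρ (gen g) ∘ₗ hwMap ρ n v := by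
    refine (Pi.basisFun Cq (Fin (n + 1))).ext fun j => ?_
    obtain ⟨j, hj⟩ := j
    rw [Pi.basisFun_apply, ← wvec_eq_single, LinearMap.comp_apply, LinearMap.comp_apply,
      hwMap_wvec (by change j ≤ n; omega)]
    change hwMap ρ n v (irrRep n (gen g) (wvec n j)) = ρ (gen g) (divPowF ρ v j)
    cases g with
    | E =>
      cases j with
      | zero => rw [irrRep_E, irrE_wvec_zero, map_zero]; exact hv.E_eq_zero.symm
      | succ j =>
        rw [irrRep_E, irrE_wvec_succ n j (by omega), map_smul, hwMap_wvec (by omega),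
          hv.E_divPowF]
    | F =>
      rw [irrRep_F, irrF_wvec, map_smul, F_divPowF]
      -- At the bottom weight `j = n` both sides vanish, the right one by `divPowF_eq_zero`.
      by_cases h : j + 1 ≤ n
      · rw [hwMap_wvec h]
      · obtain rfl : j = n := by omega
        rw [wvec_eq_zero (by omega), hv.divPowF_eq_zero, map_zero]
    | K => rw [irrRep_K, irrK_wvec, map_smul, hwMap_wvec (by omega), hv.K_divPowF, one_mul]
    | Kinv =>
      rw [irrRep_Kinv, irrK_wvec, map_smul, hwMap_wvec (by omega), hv.Kinv_divPowF, neg_one_mul]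
  exact LinearMap.congr_fun this x

end HighestWeight

/-- The vector is sought as `∑ x_i • (wvec a i ⊗ wvec b (c - i))`. The coefficient of `wvec a i ⊗
wvec b (c - i - 1)` in its image under `E` is `x_{i+1} [a - i] + x_i q^{a - 2i} [b - (c - i - 1)]`;
since `[a - i] ≠ 0` for `i < c ≤ a`, its vanishing is a solvable recursion. The vector is nonzero
because its `(0, c)` coordinate is `x_0 = 1`. -/
theorem exists_isHighestWeight_tensor (a b c : ℕ) (ha : c ≤ a) (hb : c ≤ b) :
    ∃ v : (Fin (a + 1) → Cq) ⊗[Cq] (Fin (b + 1) → Cq), v ≠ 0 ∧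
      IsHighestWeight (tensorRep (irrRep a) (irrRep b)) (a + b - 2 * c) v := by
  obtain ⟨x, hx0, hx⟩ : ∃ x : ℕ → Cq, x 0 = 1 ∧ ∀ i, x (i + 1)
      = -((qint ((a : ℤ) - i))⁻¹ * q ^ ((a : ℤ) - 2 * i) * qint ((b : ℤ) - (c - (i + 1) : ℕ)))
        * x i :=
    ⟨fun i => ∏ j ∈ Finset.range i, -((qint ((a : ℤ) - j))⁻¹ * q ^ ((a : ℤ) - 2 * j)
      * qint ((b : ℤ) - (c - (j + 1) : ℕ))), by simp, fun i => by
        simp only [Finset.prod_range_succ, mul_comm]⟩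
  refine ⟨∑ i ∈ Finset.range (c + 1), x i • (wvec a i ⊗ₜ[Cq] wvec b (c - i)), ?_, ?_, ?_⟩
  · intro h
    have h1 := congrArg ((TensorProduct.lid Cq Cq).toLinearMap ∘ₗ TensorProduct.map
      (LinearMap.proj (0 : Fin (a + 1))) (LinearMap.proj (⟨c, by omega⟩ : Fin (b + 1)))) h
    rw [map_sum, Finset.sum_eq_single 0] at h1
    · simp [hx0, wvec] at h1
    · intro i _ hi
      simp [wvec, Ne.symm hi]
    · simp
  · rw [map_sum]
    simp only [map_smul, tensorRep_E, irrRep_E, irrRep_K, smul_add, Finset.sum_add_distrib]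
    -- The term `i = 0` drops from the first sum and the term `i = c` from the second, `E` killing
    -- the highest weight vector. After the shift both sums run over `i < c` and cancel termwise.
    rw [Finset.sum_range_succ', Finset.sum_range_succ (n := c)]
    simp only [irrE_wvec_zero, Nat.sub_self, TensorProduct.zero_tmul, TensorProduct.tmul_zero,
      smul_zero, add_zero]
    rw [← Finset.sum_add_distrib]
    refine Finset.sum_eq_zero fun i hi => ?_
    have hi := Finset.mem_range.1 hi
    have e : c - i = c - (i + 1) + 1 := by omega
    rw [irrE_wvec_succ a i (by omega), e, irrE_wvec_succ b _ (by omega), irrK_wvec, hx,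
      ← TensorProduct.smul_tmul', ← TensorProduct.smul_tmul', TensorProduct.tmul_smul, smul_smul,
      smul_smul, smul_smul, ← add_smul, one_mul]
    have hq : qint ((a : ℤ) - i) ≠ 0 := qint_ne_zero (by omega)
    convert zero_smul Cq _
    field_simp
    ring
  · rw [map_sum, Finset.smul_sum]
    refine Finset.sum_congr rfl fun i hi => ?_
    have hi := Finset.mem_range.1 hi
    rw [map_smul, tensorRep_K, irrRep_K, irrRep_K, irrK_wvec, irrK_wvec,
      ← TensorProduct.smul_tmul', TensorProduct.tmul_smul, smul_smul, smul_smul, smul_smul]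
    have e : q ^ ((a + b - 2 * c : ℕ) : ℤ)
        = q ^ (1 * ((a : ℤ) - 2 * i)) * q ^ (1 * ((b : ℤ) - 2 * (c - i : ℕ))) := by
      rw [← zpow_add₀ q_ne_zero]
      congr 1
      omega
    rw [e]
    congr 1
    ring

/-- The dimension count for Clebsch-Gordan: `k = min a b + 1` gives `(a + 1) * (b + 1)`. A general
`k` allows induction, and the bounds make the truncated subtractions exact. -/
theorem sum_range_clebschGordan (a b k : ℕ) (ha : k ≤ a + 1) (hb : k ≤ b + 1) :
    ∑ c ∈ Finset.range k, (a + b - 2 * c + 1) = k * (a + b + 2 - k) := by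
  induction k with
  | zero => simp
  | succ k ih =>
    rw [Finset.sum_range_succ, ih (by omega) (by omega)]
    obtain ⟨e, he⟩ : ∃ e, a + b = 2 * k + e := ⟨a + b - 2 * k, by omega⟩
    rw [he, show 2 * k + e + 2 - k = k + e + 2 by omega, show 2 * k + e - 2 * k = e by omega,
      show 2 * k + e + 2 - (k + 1) = k + e + 1 by omega]
    ring

/-- The highest weight vectors define a map from the direct sum. Its kernel is stable under the
nilpotent `E`, so if nonzero it contains a vector killed by `E`, that is, a linear relation between
the highest weight vectors. These are independent, having distinct `K`-eigenvalues; equality of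
dimensions finishes the proof. -/
theorem isoRep_clebschGordan (a b : ℕ) :
    IsoRep (piRep fun c : Fin (min a b + 1) => irrRep (a + b - 2 * c))
      (tensorRep (irrRep a) (irrRep b)) := by
  have hc : ∀ c : Fin (min a b + 1), (c : ℕ) ≤ a ∧ (c : ℕ) ≤ b := fun c => by omega
  choose v hv0 hv using fun c : Fin (min a b + 1) =>
    exists_isHighestWeight_tensor a b c (hc c).1 (hc c).2
  let Φ : (∀ c : Fin (min a b + 1), Fin (a + b - 2 * c + 1) → Cq) →ₗ[Cq]
      (Fin (a + 1) → Cq) ⊗[Cq] (Fin (b + 1) → Cq) :=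
    ∑ c : Fin (min a b + 1),
      hwMap (tensorRep (irrRep a) (irrRep b)) (a + b - 2 * c) (v c) ∘ₗ LinearMap.proj c
  have hΦ : ∀ x, Φ x = ∑ c : Fin (min a b + 1),
      hwMap (tensorRep (irrRep a) (irrRep b)) (a + b - 2 * c) (v c) (x c) :=
    fun x => by simp [Φ]
  have hΦu : ∀ u x, Φ (piRep (fun c : Fin (min a b + 1) => irrRep (a + b - 2 * c)) u x)
      = tensorRep (irrRep a) (irrRep b) u (Φ x) := by
    intro u x
    rw [hΦ, hΦ, map_sum]
    exact Finset.sum_congr rfl fun c _ => by rw [piRep_apply, (hv c).intertwines]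
  have hli : LinearIndependent Cq v := by
    refine Module.End.eigenvectors_linearIndependent' (tensorRep (irrRep a) (irrRep b) (gen Gen.K))
      (fun c : Fin (min a b + 1) => q ^ ((a + b - 2 * c : ℕ) : ℤ)) ?_ v fun c =>
        Module.End.hasEigenvector_iff.2 ⟨Module.End.mem_eigenspace_iff.2 (hv c).K_eq, hv0 c⟩
    intro c c' h
    have h1 := q_zpow_injective h
    have := hc c
    have := hc c'
    ext
    omega
  have hinj : LinearMap.ker Φ = ⊥ := by
    by_contra hne
    obtain ⟨x, hx, hx0⟩ := (Submodule.ne_bot_iff _).1 hne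
    have hpow : ∀ (N : ℕ) x c, ((piRep (fun c : Fin (min a b + 1) =>
        irrRep (a + b - 2 * c)) (gen Gen.E)) ^ N) x c = ((irrE (a + b - 2 * c)) ^ N) (x c) := by
      intro N x c
      rw [← map_pow, piRep_apply, map_pow, irrRep_E]
    obtain ⟨y, hy, hy0, hEy⟩ := exists_mem_ker_of_nilpotent
      (piRep (fun c : Fin (min a b + 1) => irrRep (a + b - 2 * c)) (gen Gen.E)) (LinearMap.ker Φ)
      (fun x hx => by rw [LinearMap.mem_ker, hΦu, LinearMap.mem_ker.1 hx, map_zero]) x hx hx0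
      (a + b + 1) (by
        funext c
        rw [hpow, irrE_pow_eq_zero (by omega)]
        rfl)
    have hyc : ∀ c, y c = y c 0 • wvec _ 0 := fun c => by
      apply eq_smul_of_irrE_eq_zero
      rw [← irrRep_E]
      exact congrFun hEy c
    have h0 : ∑ c, y c 0 • v c = 0 := by
      rw [← LinearMap.mem_ker.1 hy, hΦ]
      refine Finset.sum_congr rfl fun c _ => ?_
      conv_rhs => rw [hyc c, map_smul, hwMap_wvec (Nat.zero_le _)]
      rfl
    refine hy0 (funext fun c => ?_)
    rw [hyc c, Fintype.linearIndependent_iff.1 hli _ h0 c, zero_smul]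
    rfl
  have hdim : finrank Cq (∀ c : Fin (min a b + 1), Fin (a + b - 2 * c + 1) → Cq)
      = finrank Cq ((Fin (a + 1) → Cq) ⊗[Cq] (Fin (b + 1) → Cq)) := by
    rw [Module.finrank_pi_fintype, Module.finrank_tensorProduct]
    simp only [Module.finrank_fin_fun]
    rw [Fin.sum_univ_eq_sum_range (fun c => a + b - 2 * c + 1), sum_range_clebschGordan _ _ _
      (by omega) (by omega)]
    rcases le_total a b with h | h
    · rw [min_eq_left h, show a + b + 2 - (a + 1) = b + 1 by omega]
    · rw [min_eq_right h, show a + b + 2 - (b + 1) = a + 1 by omega, mul_comm]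
  exact ⟨LinearEquiv.ofInjectiveOfFinrankEq Φ (LinearMap.ker_eq_bot.1 hinj) hdim, hΦu⟩

/-! ## The decomposition of the tensor product -/

/-- The sum of the entries of a tuple before a given position. -/
def below {m : ℕ} (f : Fin m → ℕ) (i : Fin m) : ℕ := ∑ j, if j < i then f j else 0

theorem below_zero {m : ℕ} (f : Fin (m + 1) → ℕ) : below f 0 = 0 := by simp [below]

theorem below_succ {m : ℕ} (f : Fin (m + 1) → ℕ) (i : Fin m) :
    below f i.succ = f 0 + below (fun j => f j.succ) i := by
  simp [below, Fin.sum_univ_succ]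

/-- The tuples `r` with `r_i ≤ d_i` and `r_i ≤ p + ∑_{j < i} (d_j - 2 r_j)`. -/
def Admissible (p : ℕ) {m : ℕ} (d r : Fin m → ℕ) : Prop :=
  ∀ i, r i ≤ d i ∧ r i + 2 * below r i ≤ p + below d i

/-- One Clebsch-Gordan step: `r 0 ≤ min p (d 0)` selects a summand of `V_p ⊗ V_{d 0}`, whose highest
weight `p + d 0 - 2 * r 0` replaces `p`. -/
theorem admissible_succ_iff (p : ℕ) {m : ℕ} (d r : Fin (m + 1) → ℕ) :
    Admissible p d r ↔ r 0 ≤ min p (d 0) ∧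
      Admissible (p + d 0 - 2 * r 0) (fun i => d i.succ) (fun i => r i.succ) := by
  unfold Admissible
  rw [Fin.forall_fin_succ]
  simp only [below_zero, below_succ]
  constructor
  · rintro ⟨h0, h⟩
    refine ⟨by omega, fun i => ?_⟩
    have := h i
    omega
  · rintro ⟨h0, h⟩
    refine ⟨by omega, fun i => ?_⟩
    have := h i
    omega

/-- An admissible tuple consists of its first entry and an admissible tuple. -/
def admissibleSuccEquiv (p : ℕ) {m : ℕ} (d : Fin (m + 1) → ℕ) :
    (Σ c : Fin (min p (d 0) + 1),
      {r : Fin m → ℕ // Admissible (p + d 0 - 2 * c) (fun i => d i.succ) r}) ≃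
      {r : Fin (m + 1) → ℕ // Admissible p d r} where
  toFun x := ⟨Fin.cons (x.1 : ℕ) x.2.1, (admissible_succ_iff p d _).2
    ⟨by have := x.1.isLt; rw [Fin.cons_zero]; omega, by simpa using x.2.2⟩⟩
  invFun r := ⟨⟨r.1 0, Nat.lt_succ_of_le ((admissible_succ_iff p d _).1 r.2).1⟩,
    ⟨fun i => r.1 i.succ, ((admissible_succ_iff p d _).1 r.2).2⟩⟩
  left_inv x := by
    obtain ⟨c, r, hr⟩ := x
    rfl
  right_inv r := by
    ext i
    cases i using Fin.cases <;> simp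

theorem isoRep_irr_reindex {ι κ : Type*} (e : ι ≃ κ) (f : ι → ℕ) (g : κ → ℕ)
    (h : ∀ i, f i = g (e i)) :
    IsoRep (piRep fun i => irrRep (f i)) (piRep fun j => irrRep (g j)) := by
  obtain rfl : f = fun i => g (e i) := funext h
  exact IsoRep.pi_reindex (fun j => irrRep (g j)) e

section Unit

variable {M : Type*} [AddCommGroup M] [Module Cq M] (ρ : Uq →ₐ[Cq] Module.End Cq M)

theorem isoRep_tensor_triv :
    IsoRep (tensorRep ρ ((Algebra.lsmul Cq Cq Cq).comp counit)) ρ := by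
  refine IsoRep.of_gen (TensorProduct.rid Cq M) fun g x => ?_
  induction x using TensorProduct.induction_on with
  | zero => simp only [map_zero]
  | add x y hx hy => simp only [map_add, hx, hy]
  | tmul x y =>
    cases g <;> simp [tensorRep_E, tensorRep_F, tensorRep_K, tensorRep_Kinv, counit, Uq.lift_gen]

/-- `V_0` is a left unit, so a decomposition of `V_p ⊗ (⋯)` can be specialised to `p = 0`. -/
theorem isoRep_irr_zero_tensor : IsoRep (tensorRep (irrRep 0) ρ) ρ := by
  have hE : irrE 0 = 0 := by simpa using irrE_pow_eq_zero (n := 0) (j := 1) (by omega)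
  have hF : irrF 0 = 0 := LinearMap.ext fun x => funext fun i => by
    obtain rfl : i = 0 := Fin.fin_one_eq_zero i
    simp [irrF, qint_zero]
  have hK : ∀ s, irrK 0 s = 1 := fun s => LinearMap.ext fun x => funext fun i => by
    obtain rfl : i = 0 := Fin.fin_one_eq_zero i
    simp [irrK]
  refine IsoRep.of_gen ((TensorProduct.congr (LinearEquiv.funUnique (Fin 1) Cq Cq)
    (LinearEquiv.refl Cq M)).trans (TensorProduct.lid Cq M)) fun g x => ?_
  induction x using TensorProduct.induction_on with
  | zero => simp
  | add x y hx hy => simp only [map_add, hx, hy]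
  | tmul x y =>
    cases g <;> simp [tensorRep_E, tensorRep_F, tensorRep_K, tensorRep_Kinv, irrRep_E, irrRep_F,
      irrRep_K, irrRep_Kinv, hE, hF, hK]

theorem isoRep_pi_unit : IsoRep ρ (piRep fun _ : Unit => ρ) :=
  IsoRep.symm ⟨LinearEquiv.funUnique Unit Cq M, fun _ _ => rfl⟩

end Unit

/-- The additional left factor `V_p` makes the induction close up: after rebracketing, `V_p ⊗ V_{d
0}` splits into modules `V_{p'}`, and the induction hypothesis applies to each `V_{p'}` tensored
with the remaining factors. -/
theorem isoRep_irr_tensor_tensorProd (m : ℕ) (d : Fin m → ℕ) (p : ℕ) :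
    IsoRep (tensorRep (irrRep p) (UqMod.tensorProd m d).act)
      (piRep fun r : {r : Fin m → ℕ // Admissible p d r} =>
        irrRep (p + ∑ i, d i - 2 * ∑ i, r.1 i)) := by
  induction m generalizing p with
  | zero =>
    have h0 : IsoRep (tensorRep (irrRep p) (UqMod.tensorProd 0 d).act) (irrRep p) :=
      isoRep_tensor_triv (irrRep p)
    refine h0.trans ((isoRep_pi_unit _).trans ?_)
    have : Unique {r : Fin 0 → ℕ // Admissible p d r} :=
      ⟨⟨⟨d, fun i => i.elim0⟩⟩, fun r => Subsingleton.elim _ _⟩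
    exact isoRep_irr_reindex (Equiv.ofUnique _ _) (fun _ => p) _ (by simp)
  | succ m ih =>
    have h0 : IsoRep (tensorRep (irrRep p) (UqMod.tensorProd (m + 1) d).act)
        (tensorRep (tensorRep (irrRep p) (irrRep (d 0)))
          (UqMod.tensorProd m fun i => d i.succ).act) :=
      (isoRep_tensor_assoc (irrRep p) (irrRep (d 0))
        (UqMod.tensorProd m fun i => d i.succ).act).symm
    refine h0.trans ?_
    refine ((isoRep_clebschGordan p (d 0)).symm.tensor_left _).trans ?_
    refine (isoRep_pi_tensor (fun c : Fin (min p (d 0) + 1) => irrRep (p + d 0 - 2 * c))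
      (UqMod.tensorProd m fun i => d i.succ).act).trans ?_
    have h1 := fun c : Fin (min p (d 0) + 1) => ih (fun i => d i.succ) (p + d 0 - 2 * c)
    refine (IsoRep.pi h1).trans ?_
    refine (IsoRep.pi_curry (fun x : (Σ c : Fin (min p (d 0) + 1),
      {r : Fin m → ℕ // Admissible (p + d 0 - 2 * c) (fun i => d i.succ) r}) =>
        irrRep (p + d 0 - 2 * x.1 + ∑ i : Fin m, d i.succ - 2 * ∑ i, x.2.1 i))).trans ?_
    refine isoRep_irr_reindex (admissibleSuccEquiv p d) _ _ ?_
    rintro ⟨c, r, hr⟩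
    simp only [admissibleSuccEquiv, Equiv.coe_fn_mk, Fin.sum_univ_succ, Fin.cons_zero,
      Fin.cons_succ]
    omega

/-- The tensor product `V_{d_1} ⊗ ⋯ ⊗ V_{d_m}` is the direct sum of irreducible representations
indexed by the admissible tuples. -/
theorem isoRep_tensorProd {m : ℕ} (d : Fin m → ℕ) :
    IsoRep (UqMod.tensorProd m d).act
      (piRep fun r : {r : Fin m → ℕ // Admissible 0 d r} =>
        irrRep (∑ i, d i - 2 * ∑ i, r.1 i)) := by
  refine (isoRep_irr_zero_tensor _).symm.trans ((isoRep_irr_tensor_tensorProd m d 0).trans ?_)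
  exact isoRep_irr_reindex (Equiv.refl _) _ _ (by simp)

/-! ## Crossingless matches and admissible tuples -/

/-! ### Linear positions of vertices and partial sums of tuples -/

section Position

variable {m : ℕ} {d : Fin m → ℕ}

theorem below_add (f : Fin m → ℕ) (i : Fin m) :
    below f i + f i = ∑ j, if j ≤ i then f j else 0 := by
  have : f i = ∑ j, if j = i then f j else 0 := by simp
  rw [below]
  conv_lhs => rw [this]
  rw [← Finset.sum_add_distrib]
  refine Finset.sum_congr rfl fun j _ => ?_
  rcases lt_trichotomy j i with h | h | h
  · simp [h, h.le, h.ne]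
  · simp [h]
  · simp [h.not_gt, h.not_ge, h.ne']

theorem below_add_le (f : Fin m → ℕ) {i j : Fin m} (h : i < j) :
    below f i + f i ≤ below f j := by
  rw [below_add, below]
  refine Finset.sum_le_sum fun l _ => ?_
  split_ifs with h1 h2
  · exact le_rfl
  · exact absurd (h1.trans_lt h) h2
  · exact Nat.zero_le _
  · exact le_rfl

theorem below_add_le_sum (f : Fin m → ℕ) (i : Fin m) : below f i + f i ≤ ∑ j, f j := by
  rw [below_add]
  refine Finset.sum_le_sum fun l _ => ?_
  split_ifs <;> omega

theorem card_filter_vertex (P : Vertex d → Prop) [DecidablePred P] :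
    (Finset.univ.filter P).card = ∑ i, (Finset.univ.filter fun j : Fin (d i) => P ⟨i, j⟩).card := by
  simp only [Finset.card_filter, Fintype.sum_sigma]

/-- The position of a vertex, counted from the left. -/
def pos (x : Vertex d) : ℕ := below d x.1 + x.2

theorem leftOf_iff (x y : Vertex d) : LeftOf x y ↔ pos x < pos y := by
  have key : ∀ x y : Vertex d, x.1 < y.1 → pos x < pos y := fun x y h => by
    have := below_add_le d h
    have := x.2.isLt
    unfold pos
    omega
  constructor
  · rintro (h | ⟨h, h'⟩)
    · exact key x y h
    · have e := congrArg (below d) h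
      unfold pos
      omega
  · intro h
    rcases lt_trichotomy x.1 y.1 with h1 | h1 | h1
    · exact Or.inl h1
    · refine Or.inr ⟨h1, ?_⟩
      have e := congrArg (below d) h1
      unfold pos at h
      omega
    · exact absurd (key y x h1) h.not_gt

theorem pos_injective : Function.Injective (pos : Vertex d → ℕ) := by
  rintro ⟨i, j⟩ ⟨i', j'⟩ h
  have h1 : ¬ LeftOf (⟨i, j⟩ : Vertex d) ⟨i', j'⟩ := by rw [leftOf_iff, h]; exact lt_irrefl _
  have h2 : ¬ LeftOf (⟨i', j'⟩ : Vertex d) ⟨i, j⟩ := by rw [leftOf_iff, h]; exact lt_irrefl _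
  simp only [LeftOf, not_or, not_lt, not_and] at h1 h2
  obtain rfl : i = i' := le_antisymm h2.1 h1.1
  obtain rfl : j = j' := Fin.ext (le_antisymm (h2.2 rfl) (h1.2 rfl))
  rfl

theorem pos_lt (x : Vertex d) : pos x < ∑ i, d i := by
  have := below_add_le_sum d x.1
  have := x.2.isLt
  unfold pos
  omega

theorem exists_pos_eq {p : ℕ} (hp : p < ∑ i, d i) : ∃ x : Vertex d, pos x = p := by
  have : Function.Bijective (fun x : Vertex d => (⟨pos x, pos_lt x⟩ : Fin (∑ i, d i))) := by
    rw [Fintype.bijective_iff_injective_and_card]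
    exact ⟨fun x y h => pos_injective (congrArg Fin.val h), by simp⟩
  obtain ⟨x, hx⟩ := this.2 ⟨p, hp⟩
  exact ⟨x, congrArg Fin.val hx⟩

theorem leftOf_irrefl (x : Vertex d) : ¬ LeftOf x x := by
  rw [leftOf_iff]
  exact lt_irrefl _

theorem leftOf_trichotomy (x y : Vertex d) : LeftOf x y ∨ x = y ∨ LeftOf y x := by
  rw [leftOf_iff, leftOf_iff]
  rcases lt_trichotomy (pos x) (pos y) with h | h | h
  · exact Or.inl h
  · exact Or.inr (Or.inl (pos_injective h))
  · exact Or.inr (Or.inr h)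

end Position

/-! ### Matching parentheses -/

section Parentheses

/-- The points `x < y` are matched parentheses of a word with height function `h` and closing
parentheses at the positions in `R`. -/
structure IsPair (R : ℕ → Prop) (h : ℕ → ℤ) (x y : ℕ) : Prop where
  left : ¬ R x
  right : R y
  lt : x < y
  height : h x = h (y + 1)
  above : ∀ z, x < z → z ≤ y → h x < h z

variable {R : ℕ → Prop} {h : ℕ → ℤ}

theorem IsPair.left_unique {x x' y : ℕ} (hx : IsPair R h x y) (hx' : IsPair R h x' y) :
    x = x' := by
  have key : ∀ {x x'}, IsPair R h x y → IsPair R h x' y → ¬ x < x' := fun hx hx' hlt => by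
    have := hx.above _ hlt hx'.lt.le
    rw [hx.height, hx'.height] at this
    exact lt_irrefl _ this
  exact le_antisymm (not_lt.1 (key hx' hx)) (not_lt.1 (key hx hx'))

theorem IsPair.right_unique {x y y' : ℕ} (hy : IsPair R h x y) (hy' : IsPair R h x y') :
    y = y' := by
  have key : ∀ {y y'}, IsPair R h x y → IsPair R h x y' → ¬ y < y' := fun {y y'} hy hy' hlt => by
    have := hy'.above (y + 1) (by have := hy.lt; omega) hlt
    rw [hy.height] at this
    exact lt_irrefl _ this
  exact le_antisymm (not_lt.1 (key hy' hy)) (not_lt.1 (key hy hy'))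

theorem IsPair.noncrossing {x y x' y' : ℕ} (hp : IsPair R h x y) (hp' : IsPair R h x' y') :
    ¬ (x < x' ∧ x' < y ∧ y < y') := by
  rintro ⟨h1, h2, h3⟩
  have h4 := hp'.above (y + 1) (by omega) h3
  have h5 := hp.above x' h1 h2.le
  rw [hp.height] at h5
  omega

variable (hdown : ∀ p, R p → h (p + 1) = h p - 1) (hup : ∀ p, ¬ R p → h (p + 1) = h p + 1)
include hdown hup

/-- Here `h p` is the height before letter `p`. The partner of a closing parenthesis at `p` is the
last `z ≤ p` with `h z ≤ h (p + 1)`, which exists because `h 0 = 0`. Maximality forces an up step at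
`z`, hence equality of heights. -/
theorem exists_isPair_right (h0 : h 0 = 0) {p : ℕ} (hp : R p) (hpos : 0 ≤ h (p + 1)) :
    ∃ x, IsPair R h x p := by
  classical
  have hex : ∃ z ≤ p, h z ≤ h (p + 1) := ⟨0, Nat.zero_le _, by omega⟩
  obtain ⟨z0, hz0, hz0'⟩ := hex
  set z := Nat.findGreatest (fun z => h z ≤ h (p + 1)) p with hz
  have hzp : z ≤ p := Nat.findGreatest_le p
  have hzle : h z ≤ h (p + 1) := Nat.findGreatest_spec (P := fun z => h z ≤ h (p + 1)) hz0 hz0'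
  have habove : ∀ w, z < w → w ≤ p → h (p + 1) < h w := fun w hw hw' =>
    not_le.1 (Nat.findGreatest_is_greatest hw hw')
  have hne : z ≠ p := by
    intro e
    rw [e, hdown p hp] at hzle
    omega
  have hz1 := habove (z + 1) (by omega) (by omega)
  have hzR : ¬ R z := fun hR => by have := hdown z hR; omega
  have hz2 := hup z hzR
  exact ⟨z, hzR, hp, by omega, by omega, fun w hw hw' => by have := habove w hw hw'; omega⟩

/-- An opening parenthesis inside a matched pair closes at the first return to its height. The
return happens by `y + 1`, where the height has fallen to `h x < h z`. -/
theorem exists_isPair_left {x y z : ℕ} (hxy : IsPair R h x y) (h1 : x < z) (h2 : z < y)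
    (hz : ¬ R z) : ∃ y', y' ≤ y ∧ IsPair R h z y' := by
  classical
  have hex : ∃ w, z < w ∧ h w ≤ h z := by
    refine ⟨y + 1, by omega, ?_⟩
    rw [← hxy.height]
    exact (hxy.above z h1 h2.le).le
  obtain ⟨hw1, hw2⟩ := Nat.find_spec hex
  have hmin := fun {w} => Nat.find_min hex (m := w)
  have hle : Nat.find hex ≤ y + 1 := Nat.find_min' hex ⟨by omega, by
    rw [← hxy.height]
    exact (hxy.above z h1 h2.le).le⟩
  obtain ⟨w, hw⟩ : ∃ w, Nat.find hex = w + 1 := ⟨Nat.find hex - 1, by omega⟩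
  rw [hw] at hw1 hw2 hmin hle
  have hzup := hup z hz
  have hwz : w ≠ z := by
    rintro rfl
    omega
  have hab : ∀ v, z < v → v ≤ w → h z < h v := fun v hv hv' => by
    have := @hmin v (by omega)
    simp only [not_and, not_le] at this
    exact this hv
  have hw3 := hab w (by omega) le_rfl
  have hwR : R w := by
    by_contra hR
    have := hup w hR
    omega
  have hw4 := hdown w hwR
  exact ⟨w, by omega, hz, hwR, by omega, by omega, hab⟩

end Parentheses

/-! ### Matches and their numbers of right endpoints -/

namespace LowerMatch

variable {m : ℕ} {d : Fin m → ℕ}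

theorem leftOf_of_mem (b : LowerMatch d) {x y : Vertex d} (h : (x, y) ∈ b.curves) :
    LeftOf x y := Or.inl (b.box_lt _ h)

/-- The number of right endpoints in a box. -/
def rights (b : LowerMatch d) (i : Fin m) : ℕ := (b.curves.filter fun c => c.2.1 = i).card

theorem n_apply (b : LowerMatch d) (i : Fin m) : b.n i = d i - b.rights i := rfl

/-- The vertex is the right endpoint of a curve. -/
def IsRight (b : LowerMatch d) (y : Vertex d) : Prop := ∃ x, (x, y) ∈ b.curves

theorem rights_eq (b : LowerMatch d) (i : Fin m) [DecidablePred b.IsRight] :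
    b.rights i = (Finset.univ.filter fun j : Fin (d i) => b.IsRight ⟨i, j⟩).card := by
  refine (Finset.card_bij (fun j _ => (⟨i, j⟩ : Vertex d)) ?_ ?_ ?_ (t :=
    (b.curves.filter fun c => c.2.1 = i).image Prod.snd)).symm ▸ ?_
  · intro j hj
    obtain ⟨x, hx⟩ := (Finset.mem_filter.1 hj).2
    exact Finset.mem_image.2 ⟨(x, ⟨i, j⟩), by simp [hx], rfl⟩
  · intro j _ j' _ h
    simpa using h
  · intro y hy
    obtain ⟨⟨x, y'⟩, hc, rfl⟩ := Finset.mem_image.1 hy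
    obtain ⟨i', j⟩ := y'
    obtain ⟨hc', hi⟩ := Finset.mem_filter.1 hc
    dsimp only at hi
    subst hi
    exact ⟨j, Finset.mem_filter.2 ⟨Finset.mem_univ _, x, hc'⟩, rfl⟩
  · rw [Finset.card_image_of_injOn]
    · rfl
    · intro c hc c' hc' h
      exact b.disjoint c (Finset.mem_filter.1 hc).1 c' (Finset.mem_filter.1 hc').1
        (Or.inr (Or.inr (Or.inr h)))

/-- The curve ending at `j` starts in an earlier box and therefore passes over `j'`, which must then
be matched. Were `j'` a left endpoint, its curve would end in a later box and cross this one. So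
right endpoints form an initial segment of each box. -/
theorem isRight_of_lt (b : LowerMatch d) {i : Fin m} {j j' : Fin (d i)}
    (hj : b.IsRight ⟨i, j⟩) (hlt : j' < j) : b.IsRight ⟨i, j'⟩ := by
  obtain ⟨x, hx⟩ := hj
  have hbox : x.1 < i := b.box_lt _ hx
  have h1 : LeftOf x ⟨i, j'⟩ := Or.inl hbox
  have h2 : LeftOf (⟨i, j'⟩ : Vertex d) ⟨i, j⟩ := Or.inr ⟨rfl, hlt⟩
  by_contra hR
  obtain ⟨c, hc, hc'⟩ : ∃ c ∈ b.curves, c.1 = ⟨i, j'⟩ ∨ c.2 = ⟨i, j'⟩ := by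
    by_contra hno
    push Not at hno
    exact b.unmatched_outside ⟨i, j'⟩ hno _ hx ⟨h1, h2⟩
  obtain ⟨c1, c2⟩ := c
  rcases hc' with rfl | rfl
  · exact b.noncrossing _ hx _ hc ⟨h1, h2, Or.inl (b.box_lt _ hc)⟩
  · exact hR ⟨c1, hc⟩

theorem isRight_iff (b : LowerMatch d) (x : Vertex d) : b.IsRight x ↔ (x.2 : ℕ) < b.rights x.1 := by
  classical
  obtain ⟨i, j⟩ := x
  change _ ↔ (j : ℕ) < b.rights i
  rw [rights_eq]
  constructor
  · intro h
    have : Finset.Iic j ⊆ Finset.univ.filter fun j : Fin (d i) => b.IsRight ⟨i, j⟩ := by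
      intro j' hj'
      rcases (Finset.mem_Iic.1 hj').lt_or_eq with hlt | rfl
      · simpa using b.isRight_of_lt h hlt
      · simpa using h
    have := Finset.card_le_card this
    rw [Fin.card_Iic] at this
    omega
  · intro h
    by_contra hR
    have : (Finset.univ.filter fun j : Fin (d i) => b.IsRight ⟨i, j⟩) ⊆ Finset.Iio j := by
      intro j' hj'
      have hj' := (Finset.mem_filter.1 hj').2
      rw [Finset.mem_Iio]
      by_contra hle
      rcases (not_lt.1 hle).lt_or_eq with hlt | rfl
      · exact hR (b.isRight_of_lt hj' hlt)
      · exact hR hj'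
    have := Finset.card_le_card this
    rw [Fin.card_Iio] at this
    omega

theorem rights_le (b : LowerMatch d) (i : Fin m) : b.rights i ≤ d i := by
  classical
  rw [rights_eq]
  exact (Finset.card_filter_le _ _).trans (by simp)

/-- Otherwise `x'` lies under the curve `(x, y)` of `b`, hence is matched in `b`. If a curve of `b`
starts at `x'`, it ends before `y` by noncrossing and disjointness, so `ih` puts it in `b'`, where
`x'` already starts the curve to `y`. If one ends at `x'`, then `x'` is also a right endpoint in
`b'`, where it is a left endpoint. -/
theorem not_leftOf_of_isRight_iff (b b' : LowerMatch d) (hR : ∀ x, b.IsRight x → b'.IsRight x)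
    {x x' y : Vertex d} (hx : (x, y) ∈ b.curves) (hx' : (x', y) ∈ b'.curves)
    (ih : ∀ z w, LeftOf z y → (w, z) ∈ b.curves → (w, z) ∈ b'.curves) : ¬ LeftOf x x' := by
  intro hlt
  have hxy := b'.leftOf_of_mem hx'
  obtain ⟨⟨c1, c2⟩, hc, hc'⟩ : ∃ c ∈ b.curves, c.1 = x' ∨ c.2 = x' := by
    by_contra hno
    push Not at hno
    exact b.unmatched_outside x' hno _ hx ⟨hlt, hxy⟩
  rcases hc' with rfl | rfl
  · rcases leftOf_trichotomy c2 y with h | h | h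
    · have h1 := b'.disjoint _ (ih c2 _ h hc) _ hx' (Or.inl rfl)
      simp only [Prod.mk.injEq, true_and] at h1
      exact leftOf_irrefl _ (h1 ▸ h)
    · subst h
      have h1 := b.disjoint _ hc _ hx (Or.inr (Or.inr (Or.inr rfl)))
      simp only [Prod.mk.injEq, and_true] at h1
      exact leftOf_irrefl _ (h1 ▸ hlt)
    · exact b.noncrossing _ hx _ hc ⟨hlt, hxy, h⟩
  · obtain ⟨w, hw⟩ := hR _ ⟨c1, hc⟩
    have h1 := b'.disjoint _ hw _ hx' (Or.inr (Or.inr (Or.inl rfl)))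
    simp only [Prod.mk.injEq] at h1
    exact leftOf_irrefl _ (h1.2 ▸ hxy)

/-- The numbers fix the set of right endpoints. The partner of each is then determined by strong
induction on its position, comparing the two matches in both directions. -/
theorem rights_injective : Function.Injective (rights : LowerMatch d → Fin m → ℕ) := by
  intro b b' h
  have hR : ∀ x, b.IsRight x ↔ b'.IsRight x := fun x => by rw [isRight_iff, isRight_iff, h]
  have key : ∀ (p : ℕ) (y : Vertex d), pos y = p → ∀ x, (x, y) ∈ b.curves ↔ (x, y) ∈ b'.curves := by
    intro p
    induction p using Nat.strong_induction_on with
    | _ p ih =>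
      rintro y rfl
      have main : ∀ x x', (x, y) ∈ b.curves → (x', y) ∈ b'.curves → x = x' := by
        intro x x' hx hx'
        have h1 := not_leftOf_of_isRight_iff b b' (fun x => (hR x).1) hx hx'
          fun z w hz => (ih (pos z) ((leftOf_iff _ _).1 hz) z rfl w).1
        have h2 := not_leftOf_of_isRight_iff b' b (fun x => (hR x).2) hx' hx
          fun z w hz => (ih (pos z) ((leftOf_iff _ _).1 hz) z rfl w).2
        rcases leftOf_trichotomy x x' with h | h | h
        · exact absurd h h1
        · exact h
        · exact absurd h h2
      intro x
      constructor
      · intro hx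
        obtain ⟨x', hx'⟩ := (hR y).1 ⟨x, hx⟩
        rwa [main x x' hx hx']
      · intro hx
        obtain ⟨x', hx'⟩ := (hR y).2 ⟨x, hx⟩
        rwa [← main x' x hx' hx]
  refine LowerMatch.ext (Finset.ext fun c => ?_)
  exact key _ c.2 rfl c.1

instance : Finite (LowerMatch d) :=
  Finite.of_injective LowerMatch.curves fun _ _ h => LowerMatch.ext h

theorem card_curves (b : LowerMatch d) : b.curves.card = ∑ i, b.rights i :=
  Finset.card_eq_sum_card_fiberwise fun _ _ => Finset.mem_univ _

/-- The left endpoints of the curves ending in boxes `≤ i` and the right endpoints of those ending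
in boxes `< i` are distinct vertices of the boxes `< i`. Counting them gives the inequality. -/
theorem admissible_rights (b : LowerMatch d) : Admissible 0 d b.rights := by
  intro i
  refine ⟨b.rights_le i, ?_⟩
  have hfib : ∀ (P : Fin m → Prop) [DecidablePred P], (b.curves.filter fun c => P c.2.1).card
      = ∑ j, if P j then b.rights j else 0 := by
    intro P _
    rw [Finset.card_eq_sum_card_fiberwise (f := fun c => c.2.1) (t := Finset.univ)
      fun _ _ => Finset.mem_univ _]
    refine Finset.sum_congr rfl fun j _ => ?_
    rw [Finset.filter_filter]
    split_ifs with h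
    · exact congrArg Finset.card (Finset.filter_congr fun c _ => by aesop)
    · exact Finset.card_eq_zero.2 (Finset.filter_eq_empty_iff.2 fun c _ => by aesop)
  have h1 := hfib (· ≤ i)
  have h2 := hfib (· < i)
  rw [← below_add] at h1
  have h3 : ((b.curves.filter fun c => c.2.1 ≤ i).image Prod.fst ∪
      (b.curves.filter fun c => c.2.1 < i).image Prod.snd).card ≤ below d i := by
    have : below d i = (Finset.univ.filter fun x : Vertex d => x.1 < i).card := by
      rw [card_filter_vertex, below]
      refine Finset.sum_congr rfl fun j _ => ?_
      by_cases h : j < i <;> simp [h]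
    rw [this]
    refine Finset.card_le_card fun x hx => ?_
    rw [Finset.mem_filter]
    refine ⟨Finset.mem_univ _, ?_⟩
    rcases Finset.mem_union.1 hx with hx | hx <;> obtain ⟨c, hc, rfl⟩ := Finset.mem_image.1 hx <;>
      obtain ⟨hc, hi⟩ := Finset.mem_filter.1 hc
    · exact (b.box_lt c hc).trans_le hi
    · exact hi
  rw [Finset.card_union_of_disjoint, Finset.card_image_of_injOn, Finset.card_image_of_injOn, h1,
    h2] at h3
  · change _ ≤ 0 + below d i
    have : (∑ j, if j < i then b.rights j else 0) = below b.rights i := rfl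
    omega
  · intro c hc c' hc' h
    exact b.disjoint c (Finset.mem_filter.1 hc).1 c' (Finset.mem_filter.1 hc').1
      (Or.inr (Or.inr (Or.inr h)))
  · intro c hc c' hc' h
    exact b.disjoint c (Finset.mem_filter.1 hc).1 c' (Finset.mem_filter.1 hc').1 (Or.inl h)
  · rw [Finset.disjoint_left]
    intro x hx hx'
    obtain ⟨c, hc, rfl⟩ := Finset.mem_image.1 hx
    obtain ⟨c', hc', h⟩ := Finset.mem_image.1 hx'
    have hc := (Finset.mem_filter.1 hc).1
    have hc' := (Finset.mem_filter.1 hc').1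
    have := b.disjoint c hc c' hc' (Or.inr (Or.inl h.symm))
    subst this
    exact (b.box_lt c hc).ne (congrArg Sigma.fst h.symm)

/-- The first `r i` vertices of box `i` become closing parentheses and the others opening ones; the
matched pairs are the curves. Positions beyond the last vertex count as opening, which does no harm.
-/
theorem exists_rights_eq {r : Fin m → ℕ} (hr : Admissible 0 d r) :
    ∃ b : LowerMatch d, b.rights = r := by
  classical
  let R : ℕ → Prop := fun p => ∃ x : Vertex d, pos x = p ∧ (x.2 : ℕ) < r x.1
  let h : ℕ → ℤ := fun p => ∑ j ∈ Finset.range p, if R j then -1 else 1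
  have hdown : ∀ p, R p → h (p + 1) = h p - 1 := fun p hp => by
    simp only [h, Finset.sum_range_succ, if_pos hp, sub_eq_add_neg]
  have hup : ∀ p, ¬ R p → h (p + 1) = h p + 1 := fun p hp => by
    simp only [h, Finset.sum_range_succ, if_neg hp]
  have hR : ∀ x : Vertex d, R (pos x) ↔ (x.2 : ℕ) < r x.1 := fun x =>
    ⟨fun ⟨y, hy, hy'⟩ => pos_injective hy ▸ hy', fun hx => ⟨x, rfl, hx⟩⟩
  have hh : ∀ p, h p = p - 2 * ((Finset.range p).filter R).card := fun p => by
    induction p with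
    | zero => simp [h]
    | succ p ih =>
      rw [Finset.range_add_one, Finset.filter_insert]
      by_cases hp : R p
      · rw [hdown p hp, ih, if_pos hp, Finset.card_insert_of_notMem (by simp)]
        push_cast
        ring
      · rw [hup p hp, ih, if_neg hp]
        push_cast
        ring
  -- Up to and including a closing vertex `y` of box `i` there are at most `below r i + y.2 + 1`
  -- closing vertices, so the height after it is at least `below d i - 2 * below r i - (y.2 + 1)`.
  -- This is nonnegative by admissibility, as `y.2 + 1 ≤ r i`.
  have hnonneg : ∀ y : Vertex d, R (pos y) → 0 ≤ h (pos y + 1) := by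
    intro y hy
    rw [hR] at hy
    have h1 : ((Finset.range (pos y + 1)).filter R).card ≤ below r y.1 + (y.2 + 1) := by
      have h2 : ((Finset.range (pos y + 1)).filter R) = (Finset.univ.filter fun x : Vertex d =>
          pos x < pos y + 1 ∧ (x.2 : ℕ) < r x.1).image pos := by
        ext p
        simp only [Finset.mem_filter, Finset.mem_range, Finset.mem_image, Finset.mem_univ,
          true_and, R]
        constructor
        · rintro ⟨h1, x, rfl, h2⟩
          exact ⟨x, ⟨h1, h2⟩, rfl⟩
        · rintro ⟨x, ⟨h1, h2⟩, rfl⟩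
          exact ⟨h1, x, rfl, h2⟩
      rw [h2]
      refine Finset.card_image_le.trans ?_
      rw [card_filter_vertex]
      have h3 : (y.2 : ℕ) + 1 = ∑ i, if i = y.1 then (y.2 : ℕ) + 1 else 0 := by simp
      rw [below, h3, ← Finset.sum_add_distrib]
      refine Finset.sum_le_sum fun i _ => ?_
      have hcard : ∀ N : ℕ, (∀ j : Fin (d i), pos (⟨i, j⟩ : Vertex d) < pos y + 1 →
          (j : ℕ) < r i → (j : ℕ) < N) → (Finset.univ.filter fun j : Fin (d i) =>
          pos (⟨i, j⟩ : Vertex d) < pos y + 1 ∧ (j : ℕ) < r i).card ≤ N := by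
        intro N hN
        rw [← Finset.card_range N]
        refine Finset.card_le_card_of_injOn (fun j => (j : ℕ)) (fun j hj => ?_)
          (fun j _ j' _ hj => Fin.ext hj)
        have := (Finset.mem_filter.1 hj).2
        exact Finset.mem_coe.2 (Finset.mem_range.2 (hN j this.1 this.2))
      rcases lt_trichotomy i y.1 with hi | hi | hi
      · rw [if_pos hi, if_neg hi.ne, add_zero]
        exact hcard _ fun j _ hj => hj
      · rw [if_neg (hi ▸ lt_irrefl _), if_pos hi, zero_add]
        refine hcard _ fun j hj _ => ?_
        unfold pos at hj
        simp only [hi] at hj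
        omega
      · rw [if_neg hi.not_gt, if_neg hi.ne']
        refine hcard _ fun j hj _ => ?_
        have := (leftOf_iff y ⟨i, j⟩).1 (Or.inl hi)
        omega
    have h2 := (hr y.1).2
    rw [hh]
    have h3 : pos y = below d y.1 + y.2 := rfl
    omega
  -- Within a box the closing vertices precede the opening ones, so no pair lies in a single box.
  have hbox : ∀ x y : Vertex d, IsPair R h (pos x) (pos y) → x.1 < y.1 := by
    intro x y hxy
    rcases (leftOf_iff x y).2 hxy.lt with h1 | ⟨h1, h2⟩
    · exact h1
    · have hx := hxy.left
      have hy := hxy.right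
      rw [hR] at hx hy
      have e := congrArg r h1
      omega
  let b : LowerMatch d :=
    { curves := Finset.univ.filter fun c => IsPair R h (pos c.1) (pos c.2)
      box_lt := fun c hc => hbox _ _ (Finset.mem_filter.1 hc).2
      disjoint := by
        rintro ⟨x, y⟩ hc ⟨x', y'⟩ hc' hcc
        have hc := (Finset.mem_filter.1 hc).2
        have hc' := (Finset.mem_filter.1 hc').2
        dsimp only at hc hc' hcc
        rcases hcc with e | e | e | e
        · subst e
          rw [pos_injective (hc.right_unique hc')]
        · subst e
          exact absurd hc'.right hc.left
        · subst e
          exact absurd hc.right hc'.left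
        · subst e
          rw [pos_injective (hc.left_unique hc')]
      noncrossing := fun c hc c' hc' => by
        simp only [leftOf_iff]
        exact (Finset.mem_filter.1 hc).2.noncrossing (Finset.mem_filter.1 hc').2
      unmatched_outside := by
        rintro z hz ⟨x, y⟩ hc ⟨h1, h2⟩
        have hc := (Finset.mem_filter.1 hc).2
        rw [leftOf_iff] at h1 h2
        by_cases hzR : R (pos z)
        · obtain ⟨w, hw⟩ := exists_isPair_right hdown hup rfl hzR (hnonneg z hzR)
          obtain ⟨w, rfl⟩ := exists_pos_eq (hw.lt.trans (pos_lt z))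
          exact (hz (w, z) (by simpa using hw)).2 rfl
        · obtain ⟨w, hwy, hw⟩ := exists_isPair_left hdown hup hc h1 h2 hzR
          obtain ⟨w, rfl⟩ := exists_pos_eq (hwy.trans_lt (pos_lt y))
          exact (hz (z, w) (by simpa using hw)).1 rfl }
  have hb : ∀ y, b.IsRight y ↔ (y.2 : ℕ) < r y.1 := by
    intro y
    rw [← hR]
    constructor
    · rintro ⟨x, hx⟩
      exact (Finset.mem_filter.1 hx).2.right
    · intro hy
      obtain ⟨w, hw⟩ := exists_isPair_right hdown hup rfl hy (hnonneg y hy)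
      obtain ⟨w, rfl⟩ := exists_pos_eq (hw.lt.trans (pos_lt y))
      exact ⟨w, by simpa [b] using hw⟩
  refine ⟨b, funext fun i => ?_⟩
  have := (hr i).1
  rw [rights_eq]
  simp only [hb]
  rw [Fin.card_filter_val_lt]
  omega

/-- Lower crossingless matches correspond to admissible tuples. -/
def equivAdmissible (d : Fin m → ℕ) : LowerMatch d ≃ {r : Fin m → ℕ // Admissible 0 d r} :=
  Equiv.ofBijective (fun b => ⟨b.rights, b.admissible_rights⟩)
    ⟨fun _ _ h => rights_injective (congrArg Subtype.val h), fun r => by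
      obtain ⟨b, hb⟩ := exists_rights_eq r.2
      exact ⟨b, Subtype.ext hb⟩⟩

theorem mu_add (b : LowerMatch d) : b.mu + 2 * b.curves.card = ∑ i, d i := by
  classical
  have h1 : (Finset.univ : Finset (Vertex d)).card = ∑ i, d i := by simp
  have h2 : (Finset.univ.filter fun x : Vertex d => ¬ ∀ c ∈ b.curves, c.1 ≠ x ∧ c.2 ≠ x)
      = b.curves.image Prod.fst ∪ b.curves.image Prod.snd := by
    ext x
    simp only [Finset.mem_filter, Finset.mem_univ, true_and, Finset.mem_union, Finset.mem_image]
    constructor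
    · intro h
      push Not at h
      obtain ⟨c, hc, h⟩ := h
      by_cases h' : c.1 = x
      · exact Or.inl ⟨c, hc, h'⟩
      · exact Or.inr ⟨c, hc, h h'⟩
    · rintro (⟨c, hc, rfl⟩ | ⟨c, hc, rfl⟩) h
      · exact (h c hc).1 rfl
      · exact (h c hc).2 rfl
  have h3 := Finset.card_filter_add_card_filter_not (s := (Finset.univ : Finset (Vertex d)))
    (fun x => ∀ c ∈ b.curves, c.1 ≠ x ∧ c.2 ≠ x)
  rw [h1, h2, Finset.card_union_of_disjoint, Finset.card_image_of_injOn,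
    Finset.card_image_of_injOn] at h3
  · rw [← h3, two_mul, mu, unmatched]
  · intro c hc c' hc' h
    exact b.disjoint c hc c' hc' (Or.inr (Or.inr (Or.inr h)))
  · intro c hc c' hc' h
    exact b.disjoint c hc c' hc' (Or.inl h)
  · rw [Finset.disjoint_left]
    intro x hx hx'
    obtain ⟨c, hc, rfl⟩ := Finset.mem_image.1 hx
    obtain ⟨c', hc', h⟩ := Finset.mem_image.1 hx'
    have := b.disjoint c hc c' hc' (Or.inr (Or.inl h.symm))
    subst this
    exact (b.box_lt c hc).ne (congrArg Sigma.fst h.symm)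

end LowerMatch

/-! ### Orientations are counted by their number of down arrows -/

namespace OrientedLowerMatch

variable {m : ℕ} {d : Fin m → ℕ}

theorem sum_tuple (a : OrientedLowerMatch d) :
    ∑ i, a.tuple i = a.toMatch.curves.card + a.down.card := by
  simp only [tuple, Finset.sum_add_distrib]
  rw [← Finset.card_eq_sum_card_fiberwise fun _ _ => Finset.mem_univ _,
    ← Finset.card_eq_sum_card_fiberwise fun _ _ => Finset.mem_univ _]

/-- The sets `down` are final segments of the unmatched vertices, hence comparable by inclusion and
determined by their cardinality. -/
theorem ext_of_card {a a' : OrientedLowerMatch d} (h : a.toMatch = a'.toMatch)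
    (hc : a.down.card = a'.down.card) : a = a' := by
  refine OrientedLowerMatch.ext h ?_
  obtain ⟨b, S, hS, hS'⟩ := a
  obtain ⟨b', T, hT, hT'⟩ := a'
  obtain rfl : b = b' := h
  have : S ⊆ T ∨ T ⊆ S := by
    by_contra hno
    rw [not_or, Finset.not_subset, Finset.not_subset] at hno
    obtain ⟨⟨x, hx, hx'⟩, ⟨y, hy, hy'⟩⟩ := hno
    rcases leftOf_trichotomy x y with h | rfl | h
    · exact hy' (hS' x hx y (hT hy) h)
    · exact hx' hy
    · exact hx' (hT' y hy x (hS hx) h)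
  rcases this with h | h
  · exact Finset.eq_of_subset_of_card_le h hc.ge
  · exact (Finset.eq_of_subset_of_card_le h hc.le).symm

theorem exists_of_card (b : LowerMatch d) (j : ℕ) (hj : j ≤ b.mu) :
    ∃ a : OrientedLowerMatch d, a.toMatch = b ∧ a.down.card = j := by
  classical
  induction j with
  | zero => exact ⟨⟨b, ∅, Finset.empty_subset _, by simp⟩, rfl, rfl⟩
  | succ j ih =>
    obtain ⟨⟨b, S, hS, hS'⟩, rfl, hc⟩ := ih (by omega)
    dsimp only at hS' hc hj hS ⊢
    have hne : (b.unmatched \ S).Nonempty := by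
      rw [← Finset.card_pos, Finset.card_sdiff_of_subset hS, hc]
      change 0 < b.mu - j
      omega
    -- The rightmost vertex not yet oriented down is added, which keeps the set a final segment.
    obtain ⟨x, hx, hmax⟩ := Finset.exists_max_image _ pos hne
    obtain ⟨hx1, hx2⟩ := Finset.mem_sdiff.1 hx
    refine ⟨⟨b, insert x S, ?_, ?_⟩, rfl, ?_⟩
    · exact Finset.insert_subset hx1 hS
    · intro y hy z hz hyz
      rcases Finset.mem_insert.1 hy with rfl | hy
      · by_contra hno
        have := hmax z (Finset.mem_sdiff.2 ⟨hz, fun h => hno (Finset.mem_insert_of_mem h)⟩)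
        rw [leftOf_iff] at hyz
        omega
      · exact Finset.mem_insert_of_mem (hS' y hy z hz hyz)
    · rw [Finset.card_insert_of_notMem hx2, hc]

/-- An oriented lower crossingless match is determined by the underlying match and the number of
unmatched vertices that are oriented down. -/
def equivSigma (d : Fin m → ℕ) : OrientedLowerMatch d ≃ Σ b : LowerMatch d, Fin (b.mu + 1) :=
  Equiv.ofBijective (fun a => ⟨a.toMatch, a.down.card,
      Nat.lt_succ_of_le (Finset.card_le_card a.down_subset)⟩)
    ⟨fun a a' h => by
      have h1 : a.toMatch = a'.toMatch := congrArg Sigma.fst h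
      refine ext_of_card h1 ?_
      exact congrArg (fun s : (Σ b : LowerMatch d, Fin (b.mu + 1)) => (s.2 : ℕ)) h,
    fun ⟨b, j⟩ => by
      obtain ⟨a, rfl, hj⟩ := exists_of_card b j (Nat.le_of_lt_succ j.isLt)
      exact ⟨a, by ext1 <;> simp [hj]⟩⟩

end OrientedLowerMatch

/-! ## Counting subspaces over a finite field -/

section Subspaces

variable {L : Type*} [Field L] {V : Type*} [AddCommGroup V] [Module L V]

/-- The subspaces between `A` and `B` are the subspaces of a relative complement. -/
theorem exists_equiv_between [FiniteDimensional L V] {A B : Submodule L V} (hAB : A ≤ B) :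
    ∃ (C : Submodule L V) (e : {S : Submodule L V // A ≤ S ∧ S ≤ B} ≃ Submodule L C),
      finrank L B = finrank L A + finrank L C ∧
      ∀ S, finrank L S.1 = finrank L A + finrank L (e S) := by
  obtain ⟨C', hC'⟩ := A.exists_isCompl
  have hinf : A ⊓ (C' ⊓ B) = ⊥ := by rw [← inf_assoc, hC'.inf_eq_bot, bot_inf_eq]
  have hsup : A ⊔ (C' ⊓ B) = B := by
    rw [← sup_inf_assoc_of_le _ hAB, hC'.sup_eq_top, top_inf_eq]
  set C := C' ⊓ B with hC
  have hdim : ∀ T ≤ C, finrank L ↥(A ⊔ T) = finrank L A + finrank L T := by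
    intro T hT
    have h1 := Submodule.finrank_sup_add_finrank_inf_eq A T
    have h2 : A ⊓ T = ⊥ := le_bot_iff.1 ((inf_le_inf_left A hT).trans hinf.le)
    rwa [h2, finrank_bot, add_zero] at h1
  have hle : ∀ T : Submodule L C, T.map C.subtype ≤ C := fun T => Submodule.map_subtype_le C T
  let f : Submodule L C → {S : Submodule L V // A ≤ S ∧ S ≤ B} := fun T =>
    ⟨A ⊔ T.map C.subtype, le_sup_left, sup_le hAB ((hle T).trans inf_le_right)⟩
  have hf : Function.Bijective f := by
    -- By the modular law, a subspace `T` of the complement `C` is recovered from `A ⊔ T` as its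
    -- intersection with `C`.
    have hrec : ∀ T ≤ C, C ⊓ (A ⊔ T) = T := fun T hT => by
      rw [inf_comm, sup_comm, sup_inf_assoc_of_le _ hT, hinf, sup_bot_eq]
    constructor
    · intro T T' h
      have h1 : A ⊔ T.map C.subtype = A ⊔ T'.map C.subtype := congrArg Subtype.val h
      refine Submodule.map_injective_of_injective C.injective_subtype ?_
      rw [← hrec _ (hle T), ← hrec _ (hle T'), h1]
    · rintro ⟨S, hAS, hSB⟩
      refine ⟨S.comap C.subtype, Subtype.ext ?_⟩
      change A ⊔ (S.comap C.subtype).map C.subtype = S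
      rw [Submodule.map_comap_subtype, ← sup_inf_assoc_of_le _ hAS, hsup, inf_eq_right]
      exact hSB
  refine ⟨C, (Equiv.ofBijective f hf).symm, ?_, ?_⟩
  · rw [← hdim C le_rfl, hsup]
  · intro S
    obtain ⟨T, rfl⟩ := (Equiv.ofBijective f hf).surjective S
    rw [Equiv.symm_apply_apply]
    change finrank L ↥(A ⊔ T.map C.subtype) = _
    rw [hdim _ (hle T), Submodule.finrank_map_subtype_eq]

variable [Finite L]

theorem card_lines {n : ℕ} (h : finrank L V = n) :
    Nat.card {T : Submodule L V // finrank L T = 1} = ∑ i ∈ Finset.range n, Nat.card L ^ i := by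
  rw [← Projectivization.card_of_finrank L V h]
  exact (Nat.card_congr (Projectivization.equivSubmodule L V)).symm

/-- Annihilators identify hyperplanes with lines of the dual space. -/
theorem card_hyperplanes [FiniteDimensional L V] {n : ℕ} (h : finrank L V = n) :
    Nat.card {T : Submodule L V // finrank L V = finrank L T + 1}
      = ∑ i ∈ Finset.range n, Nat.card L ^ i := by
  rw [← card_lines (V := Module.Dual L V) (Subspace.dual_finrank_eq.trans h)]
  refine Nat.card_congr (Equiv.subtypeEquiv
    (Subspace.orderIsoFiniteDimensional (K := L) (V := V)).toEquiv fun T => ?_)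
  have h1 := Subspace.finrank_add_finrank_dualAnnihilator_eq T
  change _ ↔ finrank L T.dualAnnihilator = 1
  omega

theorem card_up [FiniteDimensional L V] {A B : Submodule L V} (hAB : A ≤ B) :
    Nat.card {S : Submodule L V // (A ≤ S ∧ S ≤ B) ∧ finrank L S = finrank L A + 1}
      = ∑ i ∈ Finset.range (finrank L B - finrank L A), Nat.card L ^ i := by
  obtain ⟨C, e, hC, he⟩ := exists_equiv_between hAB
  rw [hC, Nat.add_sub_cancel_left, ← card_lines (V := C) rfl]
  refine Nat.card_congr ((Equiv.subtypeSubtypeEquivSubtypeInter _ _).symm.trans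
    (Equiv.subtypeEquiv e fun S => ?_))
  have := he S
  omega

theorem card_down [FiniteDimensional L V] {A B : Submodule L V} (hAB : A ≤ B) :
    Nat.card {S : Submodule L V // (A ≤ S ∧ S ≤ B) ∧ finrank L B = finrank L S + 1}
      = ∑ i ∈ Finset.range (finrank L B - finrank L A), Nat.card L ^ i := by
  obtain ⟨C, e, hC, he⟩ := exists_equiv_between hAB
  rw [hC, Nat.add_sub_cancel_left, ← card_hyperplanes (V := C) rfl]
  refine Nat.card_congr ((Equiv.subtypeSubtypeEquivSubtypeInter _ _).symm.trans
    (Equiv.subtypeEquiv e fun S => ?_))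
  have := he S
  omega

end Subspaces

/-! ## Counting points -/

section Chiq

variable (k : Type u) [Field k]

/-- The polynomial chosen in `chiq` is unique: the extensions of `k` of every positive degree give
infinitely many values `√|L|` at which two candidates agree. -/
theorem chiq_eq [Finite k] (N : (L : Type u) → [Field L] → [Algebra k L] → ℕ) (P : Polynomial ℂ)
    (hP : ∀ (L : Type u) [Field L] [Algebra k L] [Finite L],
      P.eval ((Real.sqrt (Nat.card L) : ℝ) : ℂ) = (N L : ℂ)) :
    chiq k N = algebraMap (Polynomial ℂ) Cq P := by
  have hex : ∃ P : Polynomial ℂ, ∀ (L : Type u) [Field L] [Algebra k L] [Finite L],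
      P.eval ((Real.sqrt (Nat.card L) : ℝ) : ℂ) = (N L : ℂ) := ⟨P, hP⟩
  rw [chiq, dif_pos hex]
  congr 1
  refine Polynomial.eq_of_infinite_eval_eq _ _ ?_
  obtain ⟨p, hp⟩ := CharP.exists k
  have hprime : Fact p.Prime := ⟨CharP.char_is_prime k p⟩
  have hcard : 1 < Nat.card k := Finite.one_lt_card
  refine Set.infinite_of_injective_forall_mem
    (f := fun n : ℕ => ((Real.sqrt ((Nat.card k ^ (n + 1) : ℕ) : ℝ) : ℝ) : ℂ)) ?_ ?_
  · intro n n' h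
    have h1 := (Real.sqrt_inj (Nat.cast_nonneg _) (Nat.cast_nonneg _)).1 (Complex.ofReal_injective h)
    have h2 := Nat.pow_right_injective hcard (Nat.cast_injective h1)
    omega
  · intro n
    -- The extension is lifted to the universe over which `chiq` quantifies.
    have h1 : Nat.card (ULift.{u} (FiniteField.Extension k p (n + 1))) = Nat.card k ^ (n + 1) := by
      rw [Nat.card_congr Equiv.ulift, FiniteField.natCard_extension]
    have : Finite (FiniteField.Extension k p (n + 1)) := Module.finite_of_finite k
    rw [Set.mem_ofPred_eq, ← h1, hP, hex.choose_spec]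

theorem eval_sum_sqrt (L : Type*) (T : Finset ℕ) :
    (∑ e ∈ T, (Polynomial.X : Polynomial ℂ) ^ (2 * e)).eval ((Real.sqrt (Nat.card L) : ℝ) : ℂ)
      = ((∑ e ∈ T, Nat.card L ^ e : ℕ) : ℂ) := by
  rw [Polynomial.eval_finsetSum]
  push_cast
  refine Finset.sum_congr rfl fun e _ => ?_
  rw [Polynomial.eval_pow, Polynomial.eval_X, pow_mul]
  congr 1
  norm_cast
  exact Real.sq_sqrt (Nat.cast_nonneg _)

theorem sum_sub_castSucc {G : Type*} [AddCommGroup G] {m : ℕ} (g : Fin (m + 1) → G) :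
    ∑ j : Fin m, (g j.succ - g j.castSucc) = g (Fin.last m) - g 0 := by
  induction m with
  | zero => simp
  | succ m ih =>
    rw [Fin.sum_univ_castSucc]
    have := ih fun i => g i.castSucc
    simp only [Fin.castSucc_zero] at this
    simp only [Fin.succ_castSucc] at this ⊢
    rw [this, Fin.succ_last]
    abel

/-- Each stratum is counted by a sum of powers of `|L|`, so its `χ_q` is the same sum with `q ^ 2`
for `|L|`. Regrouping the strata by filtration steps makes the total telescope. The value `v` is
required only on nonempty steps, because `stratumValue` is `0` on an empty stratum. -/
theorem finsum_strata [Finite k] {Λ : Type*} [DecidableEq Λ] (N : Λ → (L : Type u) → [Field L] → [Algebra k L] → ℕ)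
    {m : ℕ} (s : Fin m → Λ) (T : Fin (m + 1) → Finset ℕ) (hT : ∀ j : Fin m, T j.castSucc ⊆ T j.succ)
    (hT0 : T 0 = ∅) (g : Λ → Cq) (v : Cq)
    (hN : ∀ (a : Λ) (L : Type u) [Field L] [Algebra k L] [Finite L], N a L =
      ∑ j, if s j = a then ∑ e ∈ T j.succ \ T j.castSucc, Nat.card L ^ e else 0)
    (hg : ∀ j, (T j.succ \ T j.castSucc).Nonempty → g (s j) = v) :
    ∑ᶠ a, g a * chiq k (N a) = v * ∑ e ∈ T (Fin.last m), q ^ (2 * e) := by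
  classical
  have hchi : ∀ a, chiq k (N a) = ∑ j, if s j = a then ∑ e ∈ T j.succ \ T j.castSucc, q ^ (2 * e)
      else 0 := by
    intro a
    rw [chiq_eq k (N a) (∑ j, if s j = a then ∑ e ∈ T j.succ \ T j.castSucc,
      Polynomial.X ^ (2 * e) else 0)]
    · rw [map_sum]
      refine Finset.sum_congr rfl fun j _ => ?_
      split_ifs
      · simp [q, RatFunc.algebraMap_X]
      · simp
    · intro L _ _ _
      rw [hN, Polynomial.eval_finsetSum, Nat.cast_sum]
      refine Finset.sum_congr rfl fun j _ => ?_
      split_ifs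
      · exact eval_sum_sqrt L _
      · simp
  have hsupp : (Function.support fun a => g a * chiq k (N a)) ⊆ (Finset.univ.image s : Finset Λ) := by
    intro a ha
    rw [Function.mem_support, hchi] at ha
    by_contra hno
    refine ha (mul_eq_zero_of_right _ (Finset.sum_eq_zero fun j _ => if_neg fun h => hno ?_))
    rw [← h]
    simp
  rw [finsum_eq_sum_of_support_subset _ hsupp]
  simp only [hchi, Finset.mul_sum]
  rw [Finset.sum_comm]
  have h1 : ∀ j, ∑ a ∈ Finset.univ.image s, g a * (if s j = a then
      ∑ e ∈ T j.succ \ T j.castSucc, q ^ (2 * e) else 0)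
      = v * (∑ e ∈ T j.succ, q ^ (2 * e) - ∑ e ∈ T j.castSucc, q ^ (2 * e)) := by
    intro j
    rw [Finset.sum_eq_single (s j), if_pos rfl, ← Finset.sum_sdiff_eq_sub (hT j)]
    · rcases (T j.succ \ T j.castSucc).eq_empty_or_nonempty with h | h
      · simp [h]
      · rw [hg j h]
    · intro a _ ha
      rw [if_neg ha.symm, mul_zero]
    · intro h
      exact absurd (Finset.mem_image_of_mem s (Finset.mem_univ j)) h
  rw [Finset.sum_congr rfl fun j _ => h1 j, ← Finset.mul_sum,
    sum_sub_castSucc fun i => ∑ e ∈ T i, q ^ (2 * e), hT0, Finset.sum_empty, sub_zero,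
    Finset.mul_sum]

/-- Points of a finite set are counted according to the step of a filtration in which they occur,
when this step determines the label. -/
theorem card_strata {Y Λ : Type*} [DecidableEq Λ] (Φ : Set Y) (hΦ : Φ.Finite) (label : Y → Λ) {m : ℕ}
    (P : Fin (m + 1) → Y → Prop) (hmono : ∀ (j : Fin m) (y : Y), P j.castSucc y → P j.succ y)
    (h0 : ∀ y ∈ Φ, ¬ P 0 y) (hlast : ∀ y ∈ Φ, P (Fin.last m) y) (s : Fin m → Λ)
    (hs : ∀ j, ∀ y ∈ Φ, ¬ P j.castSucc y → P j.succ y → label y = s j) (c : ℕ)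
    (T : Fin (m + 1) → Finset ℕ) (hT : ∀ j : Fin m, T j.castSucc ⊆ T j.succ)
    (hcard : ∀ i, Nat.card {y // y ∈ Φ ∧ P i y} = ∑ e ∈ T i, c ^ e) (a : Λ) :
    Nat.card {y // y ∈ Φ ∧ label y = a} =
      ∑ j, if s j = a then ∑ e ∈ T j.succ \ T j.castSucc, c ^ e else 0 := by
  classical
  lift Φ to Finset Y using hΦ
  simp only [Finset.mem_coe] at *
  have hconv : ∀ (p : Y → Prop) [DecidablePred p],
      (Nat.card {y // y ∈ Φ ∧ p y} : ℤ) = ∑ y ∈ Φ, if p y then 1 else 0 := fun p _ => by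
      rw [Nat.subtype_card (Φ.filter p) fun y => Finset.mem_filter, Finset.card_filter]
      push_cast
      rfl
  zify
  rw [hconv]
  -- The indicator of `P i y` jumps from `0` to `1` at exactly one step, whose label is that of `y`;
  -- the telescoping sum of the jumps is `1`.
  have hy : ∀ y ∈ Φ, (if label y = a then (1 : ℤ) else 0) = ∑ j : Fin m, if s j = a then
      ((if P j.succ y then (1 : ℤ) else 0) - if P j.castSucc y then 1 else 0) else 0 := by
    intro y hy
    have h1 := sum_sub_castSucc fun i => if P i y then (1 : ℤ) else 0
    rw [if_pos (hlast y hy), if_neg (h0 y hy), sub_zero] at h1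
    rw [show (if label y = a then (1 : ℤ) else 0) = (if label y = a then (1 : ℤ) else 0) * 1 by ring,
      ← h1, Finset.mul_sum]
    refine Finset.sum_congr rfl fun j _ => ?_
    by_cases h2 : P j.castSucc y
    · simp [h2, hmono j y h2]
    · by_cases h3 : P j.succ y
      · simp [h2, h3, hs j y hy h2 h3]
      · simp [h2, h3]
  rw [Finset.sum_congr rfl hy, Finset.sum_comm]
  refine Finset.sum_congr rfl fun j _ => ?_
  split_ifs with h
  · rw [Finset.sum_sub_distrib, ← hconv, ← hconv, hcard, hcard]
    push_cast
    rw [Finset.sum_sdiff_eq_sub (hT j)]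
  · simp

end Chiq

/-! ## The operators on the tensor product variety -/

/-! ### Jumps of `dim (W ∩ F)` when `W` changes by one dimension -/

section Dimensions

variable {L : Type*} [Field L] {V : Type*} [AddCommGroup V] [Module L V] [FiniteDimensional L V]

/-- By the dimension formula, `dim (S ∩ F)` and `dim (S + F)` share the single additional dimension:
it goes to the intersection exactly when `S + F = A + F`. -/
theorem finrank_inf_up {A S : Submodule L V} (F : Submodule L V) (h : A ≤ S)
    (hd : finrank L S = finrank L A + 1) : finrank L ↥(S ⊓ F) = finrank L ↥(A ⊓ F) +
      open Classical in if S ≤ A ⊔ F then 1 else 0 := by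
  have h1 := Submodule.finrank_sup_add_finrank_inf_eq A F
  have h2 := Submodule.finrank_sup_add_finrank_inf_eq S F
  have h3 := Submodule.finrank_mono (inf_le_inf_right F h)
  split_ifs with hS
  · have : S ⊔ F = A ⊔ F :=
      le_antisymm (sup_le hS le_sup_right) (sup_le_sup_right h F)
    rw [this] at h2
    omega
  · have : A ⊔ F < S ⊔ F := lt_of_le_of_ne (sup_le_sup_right h F) fun e =>
      hS (e ▸ le_sup_left)
    have := Submodule.finrank_lt_finrank_of_lt this
    omega

theorem finrank_inf_down {S B : Submodule L V} (F : Submodule L V) (h : S ≤ B)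
    (hd : finrank L B = finrank L S + 1) : finrank L ↥(B ⊓ F) = finrank L ↥(S ⊓ F) +
      open Classical in if B ⊓ F ≤ S then 0 else 1 := by
  have h1 := Submodule.finrank_sup_add_finrank_inf_eq S F
  have h2 := Submodule.finrank_sup_add_finrank_inf_eq B F
  have h3 := Submodule.finrank_mono (sup_le_sup_right h F)
  split_ifs with hS
  · rw [le_antisymm (le_inf hS inf_le_right) (inf_le_inf_right F h), add_zero]
  · have : S ⊓ F < B ⊓ F := lt_of_le_of_ne (inf_le_inf_right F h) fun e =>
      hS (e ▸ inf_le_left)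
    have := Submodule.finrank_lt_finrank_of_lt this
    omega

end Dimensions

namespace TV

variable {k : Type u} {D : Type v} [Field k] [AddCommGroup D] [Module k D] {m : ℕ}
  {d : Fin m → ℕ}

theorem flag_mono (x : TV k D d) : Monotone x.flag := Fin.monotone_iff_le_succ.2 x.flag_le

theorem label_eq {x y : TV k D d} (h : y.flag = x.flag) (h' : y.t = x.t) :
    y.label = (alpha x.flag y.W, alpha x.flag (LinearMap.range x.t),
      alpha x.flag (LinearMap.ker x.t)) := by
  rw [label, h, h']

/-- The labels of the strata that meet the fibre of `π₁`. -/
def upLabel (x : TV k D d) (j : Fin m) : (Fin m → ℕ) × (Fin m → ℕ) × (Fin m → ℕ) :=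
  (alpha x.flag x.W + Pi.single j 1, alpha x.flag (LinearMap.range x.t),
    alpha x.flag (LinearMap.ker x.t))

/-- The labels of the strata that meet the fibre of `π₂`. -/
def downLabel (x : TV k D d) (j : Fin m) : (Fin m → ℕ) × (Fin m → ℕ) × (Fin m → ℕ) :=
  (alpha x.flag x.W - Pi.single j 1, alpha x.flag (LinearMap.range x.t),
    alpha x.flag (LinearMap.ker x.t))

/-- The exponents in the number of points `W'` of the fibre of `π₁` with `W' ≤ W + F_i`. -/
def upExp (x : TV k D d) (i : Fin (m + 1)) : Finset ℕ :=
  Finset.range (finrank k ↥((x.W ⊔ x.flag i) ⊓ LinearMap.ker x.t) - finrank k x.W)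

/-- The exponents in the number of points `U` of the fibre of `π₂` with `W ∩ F_i ≰ U`. -/
def downExp (x : TV k D d) (i : Fin (m + 1)) : Finset ℕ :=
  Finset.Ico (finrank k x.W - finrank k ↥(LinearMap.range x.t ⊔ x.W ⊓ x.flag i))
    (finrank k x.W - finrank k (LinearMap.range x.t))

theorem upExp_zero (x : TV k D d) : x.upExp 0 = ∅ := by
  rw [upExp, x.flag_zero, sup_bot_eq, inf_eq_left.2 x.le_ker, Nat.sub_self, Finset.range_zero]

theorem upExp_last (x : TV k D d) : x.upExp (Fin.last m)
    = Finset.range (finrank k (LinearMap.ker x.t) - finrank k x.W) := by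
  rw [upExp, x.flag_last, sup_top_eq, top_inf_eq]

theorem downExp_zero (x : TV k D d) : x.downExp 0 = ∅ := by
  rw [downExp, x.flag_zero, inf_bot_eq, sup_bot_eq, Finset.Ico_self]

theorem downExp_last (x : TV k D d) : x.downExp (Fin.last m)
    = Finset.range (finrank k x.W - finrank k (LinearMap.range x.t)) := by
  rw [downExp, x.flag_last, inf_top_eq, sup_eq_right.2 x.range_le, Nat.sub_self, Finset.range_eq_Ico]

/-! ### Point counts of the fibres, stratum by stratum -/

section FiniteDimensional

variable [FiniteDimensional k D]

theorem upExp_subset (x : TV k D d) (j : Fin m) : x.upExp j.castSucc ⊆ x.upExp j.succ := by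
  have := Submodule.finrank_mono
    (inf_le_inf_right (LinearMap.ker x.t) (sup_le_sup_left (x.flag_le j) x.W))
  exact Finset.range_subset_range.2 (by omega)

theorem downExp_subset (x : TV k D d) (j : Fin m) : x.downExp j.castSucc ⊆ x.downExp j.succ := by
  have := Submodule.finrank_mono
    (sup_le_sup_left (inf_le_inf_left x.W (x.flag_le j)) (LinearMap.range x.t))
  exact Finset.Ico_subset_Ico_left (by omega)

theorem finrank_inf_flag_le (x : TV k D d) (U : Submodule k D) (j : Fin m) :
    finrank k ↥(U ⊓ x.flag j.castSucc) ≤ finrank k ↥(U ⊓ x.flag j.succ) :=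
  Submodule.finrank_mono (inf_le_inf_left U (x.flag_le j))

theorem sum_alpha (x : TV k D d) (U : Submodule k D) : ∑ i, alpha x.flag U i = finrank k U := by
  have h := sum_sub_castSucc fun i => (finrank k ↥(U ⊓ x.flag i) : ℤ)
  rw [x.flag_zero, x.flag_last, inf_bot_eq, inf_top_eq, finrank_bot] at h
  have h' : (∑ i, alpha x.flag U i : ℤ) = finrank k U := by
    rw [← sub_zero (finrank k U : ℤ), ← Nat.cast_zero, ← h]
    refine Finset.sum_congr rfl fun j _ => ?_
    have := x.finrank_inf_flag_le U j
    rw [alpha, Nat.cast_sub this]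
  exact_mod_cast h'

theorem finrank_W_of_label_eq {x y : TV k D d} (h : x.label = y.label) :
    finrank k x.W = finrank k y.W := by
  rw [← x.sum_alpha, ← y.sum_alpha]
  exact Finset.sum_congr rfl fun i _ => congrFun (congrArg Prod.fst h) i

variable [Finite k]

instance : Finite (TV k D d) := by
  have : Finite D := Module.finite_of_finite k
  have : Finite (D →ₗ[k] D) := Finite.of_injective (fun f => (f : D → D)) DFunLike.coe_injective
  exact Finite.of_injective (fun x : TV k D d => (x.flag, x.W, x.t)) fun x y h => by
    simp only [Prod.mk.injEq] at h
    exact TV.ext h.1 h.2.1 h.2.2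

/-- The fibre is filtered by the conditions `W' ≤ W + F_i`. A point entering at step `j` has `α(W')
= α(W) + e_j`, and the points satisfying condition `i` are the subspaces between `W` and `(W + F_i)
∩ ker t` of dimension one more than `W`. -/
theorem card_fibreUp (x : TV k D d) (a : (Fin m → ℕ) × (Fin m → ℕ) × (Fin m → ℕ)) :
    Nat.card {y // y ∈ x.fibreUp ∧ y.label = a} = ∑ j,
      if x.upLabel j = a then ∑ e ∈ x.upExp j.succ \ x.upExp j.castSucc, Nat.card k ^ e else 0 := by
  classical
  have hmono : ∀ {i i' : Fin (m + 1)} {S : Submodule k D}, i ≤ i' → S ≤ x.W ⊔ x.flag i →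
      S ≤ x.W ⊔ x.flag i' := fun h hS => hS.trans (sup_le_sup_left (x.flag_mono h) _)
  refine card_strata x.fibreUp (Set.toFinite _) label (fun i y => y.W ≤ x.W ⊔ x.flag i)
    (fun j y h => hmono (Fin.castSucc_le_succ j) h) ?_ ?_ x.upLabel ?_ _ x.upExp x.upExp_subset ?_ a
  · rintro y ⟨-, -, -, h⟩ h'
    rw [x.flag_zero, sup_bot_eq] at h'
    have := Submodule.finrank_mono h'
    omega
  · intro y _
    rw [x.flag_last, sup_top_eq]
    exact le_top
  · rintro j y ⟨h1, h2, h3, h4⟩ hcast hsucc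
    rw [label_eq h1 h2, upLabel]
    congr 1
    funext i
    have e1 := finrank_inf_up (x.flag i.castSucc) h3 h4
    have e2 := finrank_inf_up (x.flag i.succ) h3 h4
    have e3 := x.finrank_inf_flag_le x.W i
    rw [Pi.add_apply, alpha, alpha]
    rcases lt_trichotomy i j with h | rfl | h
    · have h5 : ¬ y.W ≤ x.W ⊔ x.flag i.succ := fun h6 =>
        hcast (hmono (Fin.le_castSucc_iff.2 (Fin.succ_lt_succ_iff.2 h)) h6)
      rw [if_neg h5] at e2
      rw [if_neg fun h6 => h5 (hmono (Fin.castSucc_le_succ i) h6)] at e1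
      rw [Pi.single_eq_of_ne h.ne]
      omega
    · rw [if_neg hcast] at e1
      rw [if_pos hsucc] at e2
      rw [Pi.single_eq_same]
      omega
    · have h5 : y.W ≤ x.W ⊔ x.flag i.castSucc :=
        hmono (Fin.le_castSucc_iff.2 (Fin.succ_lt_succ_iff.2 h)) hsucc
      rw [if_pos h5] at e1
      rw [if_pos (hmono (Fin.castSucc_le_succ i) h5)] at e2
      rw [Pi.single_eq_of_ne h.ne']
      omega
  · intro i
    rw [upExp, ← card_up (le_inf le_sup_left x.le_ker)]
    refine Nat.card_congr (Equiv.ofBijective (fun y => ⟨y.1.W, ?_⟩) ⟨?_, ?_⟩)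
    · obtain ⟨y, ⟨h1, h2, h3, h4⟩, h5⟩ := y
      exact ⟨⟨h3, le_inf h5 (y.le_ker.trans_eq (by rw [h2]))⟩, h4⟩
    · rintro ⟨y, ⟨h1, h2, _⟩, _⟩ ⟨y', ⟨h1', h2', _⟩, _⟩ h
      exact Subtype.ext (TV.ext (h1.trans h1'.symm) (congrArg Subtype.val h) (h2.trans h2'.symm))
    · rintro ⟨S, ⟨h1, h2⟩, h3⟩
      exact ⟨⟨{ x with
        W := S
        range_le := x.range_le.trans h1
        le_ker := h2.trans inf_le_right }, ⟨rfl, rfl, h1, h3⟩, h2.trans inf_le_left⟩, rfl⟩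

/-- Dually, the filtration is by `W ∩ F_i ≰ U`. A point entering at step `j` has `α(U) = α(W) -
e_j`. -/
theorem card_fibreDown (x : TV k D d) (a : (Fin m → ℕ) × (Fin m → ℕ) × (Fin m → ℕ)) :
    Nat.card {y // y ∈ x.fibreDown ∧ y.label = a} = ∑ j,
      if x.downLabel j = a then ∑ e ∈ x.downExp j.succ \ x.downExp j.castSucc, Nat.card k ^ e
      else 0 := by
  classical
  have hmono : ∀ {i i' : Fin (m + 1)} {S : Submodule k D}, i ≤ i' → ¬ x.W ⊓ x.flag i ≤ S →
      ¬ x.W ⊓ x.flag i' ≤ S := fun h hS h' => hS ((inf_le_inf_left _ (x.flag_mono h)).trans h')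
  refine card_strata x.fibreDown (Set.toFinite _) label (fun i y => ¬ x.W ⊓ x.flag i ≤ y.W)
    (fun j y h => hmono (Fin.castSucc_le_succ j) h) ?_ ?_ x.downLabel ?_ _ x.downExp
    x.downExp_subset ?_ a
  · rintro y - h
    rw [x.flag_zero, inf_bot_eq] at h
    exact h bot_le
  · rintro y ⟨-, -, -, h⟩ h'
    rw [x.flag_last, inf_top_eq] at h'
    have := Submodule.finrank_mono h'
    omega
  · rintro j y ⟨h1, h2, h3, h4⟩ hcast hsucc
    rw [label_eq h1 h2, downLabel]
    congr 1
    funext i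
    have e1 := finrank_inf_down (x.flag i.castSucc) h3 h4
    have e2 := finrank_inf_down (x.flag i.succ) h3 h4
    have e3 := x.finrank_inf_flag_le y.W i
    rw [Pi.sub_apply, alpha, alpha]
    rcases lt_trichotomy i j with h | rfl | h
    · have h5 : x.W ⊓ x.flag i.succ ≤ y.W := by
        by_contra h6
        exact hmono (Fin.le_castSucc_iff.2 (Fin.succ_lt_succ_iff.2 h)) h6 (not_not.1 hcast)
      rw [if_pos h5] at e2
      rw [if_pos ((inf_le_inf_left _ (x.flag_le i)).trans h5)] at e1
      rw [Pi.single_eq_of_ne h.ne]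
      omega
    · rw [if_pos (not_not.1 hcast)] at e1
      rw [if_neg hsucc] at e2
      rw [Pi.single_eq_same]
      omega
    · have h5 : ¬ x.W ⊓ x.flag i.castSucc ≤ y.W :=
        hmono (Fin.le_castSucc_iff.2 (Fin.succ_lt_succ_iff.2 h)) hsucc
      rw [if_neg h5] at e1
      rw [if_neg (hmono (Fin.castSucc_le_succ i) h5)] at e2
      rw [Pi.single_eq_of_ne h.ne']
      omega
  · intro i
    -- Points with `W ∩ F_i ≰ U` are counted as a complement: from all hyperplanes of `W` containing
    -- `im t` one removes those containing `im t + W ∩ F_i`. The difference of two geometric sums is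
    -- a sum over an interval of exponents, which is `downExp`.
    have hequiv : ∀ A : Submodule k D, LinearMap.range x.t ≤ A → A ≤ x.W →
        Nat.card {y // y ∈ x.fibreDown ∧ A ≤ y.W}
          = ∑ e ∈ Finset.range (finrank k x.W - finrank k A), Nat.card k ^ e := by
      intro A hA hAW
      rw [← card_down hAW]
      refine Nat.card_congr (Equiv.ofBijective (fun y => ⟨y.1.W, ?_⟩) ⟨?_, ?_⟩)
      · obtain ⟨y, ⟨h1, h2, h3, h4⟩, h5⟩ := y
        exact ⟨⟨h5, h3⟩, h4⟩
      · rintro ⟨y, ⟨h1, h2, _⟩, _⟩ ⟨y', ⟨h1', h2', _⟩, _⟩ h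
        exact Subtype.ext (TV.ext (h1.trans h1'.symm) (congrArg Subtype.val h) (h2.trans h2'.symm))
      · rintro ⟨S, ⟨h1, h2⟩, h3⟩
        exact ⟨⟨{ x with
          W := S
          range_le := hA.trans h1
          le_ker := h2.trans x.le_ker }, ⟨rfl, rfl, h2, h3⟩, h1⟩, rfl⟩
    have e1 := hequiv (LinearMap.range x.t) le_rfl x.range_le
    have e2 := hequiv (LinearMap.range x.t ⊔ x.W ⊓ x.flag i) le_sup_left
      (sup_le x.range_le inf_le_left)
    have hconv : ∀ (p : TV k D d → Prop) [DecidablePred p], Nat.card {y // y ∈ x.fibreDown ∧ p y}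
        = ((Set.toFinite x.fibreDown).toFinset.filter p).card := fun p _ =>
      Nat.subtype_card _ fun y => by simp
    rw [hconv] at e1 e2 ⊢
    have hle : finrank k x.W - finrank k ↥(LinearMap.range x.t ⊔ x.W ⊓ x.flag i)
        ≤ finrank k x.W - finrank k (LinearMap.range x.t) :=
      Nat.sub_le_sub_left (Submodule.finrank_mono le_sup_left) _
    have e3 := Finset.sum_range_add_sum_Ico (fun e => Nat.card k ^ e) hle
    have e4 := Finset.card_filter_add_card_filter_not
      (s := (Set.toFinite x.fibreDown).toFinset) fun y => x.W ⊓ x.flag i ≤ y.W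
    have e5 : (Set.toFinite x.fibreDown).toFinset.filter (fun y => LinearMap.range x.t ≤ y.W)
        = (Set.toFinite x.fibreDown).toFinset := by
      refine Finset.filter_true_of_mem fun y hy => ?_
      have hy := (Set.Finite.mem_toFinset _).1 hy
      rw [← hy.2.1]
      exact y.range_le
    have e6 : (Set.toFinite x.fibreDown).toFinset.filter
        (fun y => LinearMap.range x.t ⊔ x.W ⊓ x.flag i ≤ y.W)
        = (Set.toFinite x.fibreDown).toFinset.filter (fun y => x.W ⊓ x.flag i ≤ y.W) := by
      refine Finset.filter_congr fun y hy => ?_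
      have hy := (Set.Finite.mem_toFinset _).1 hy
      have : LinearMap.range x.t ≤ y.W := by
        rw [← hy.2.1]
        exact y.range_le
      rw [sup_le_iff, and_iff_right this]
    rw [e5] at e1
    rw [e6] at e2
    rw [downExp]
    omega

end FiniteDimensional

/-! ### Labels and counting exponents are unchanged by field extension -/

section BaseChange

variable (L : Type u) [Field L] [Algebra k L]

theorem baseChange_sup (p r : Submodule k D) :
    (p ⊔ r).baseChange L = p.baseChange L ⊔ r.baseChange L := by
  refine le_antisymm (baseChange_le fun v hv => ?_) (sup_le (Submodule.baseChange_mono L le_sup_left)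
    (Submodule.baseChange_mono L le_sup_right))
  obtain ⟨a, ha, b, hb, rfl⟩ := Submodule.mem_sup.1 hv
  rw [TensorProduct.tmul_add]
  exact Submodule.add_mem_sup (Submodule.tmul_mem_baseChange_of_mem _ ha)
    (Submodule.tmul_mem_baseChange_of_mem _ hb)

theorem range_baseChange (f : D →ₗ[k] D) :
    LinearMap.range (f.baseChange L) = (LinearMap.range f).baseChange L := by
  refine le_antisymm ?_ (baseChange_le ?_)
  · rintro _ ⟨y, rfl⟩
    induction y using TensorProduct.induction_on with
    | zero => simp
    | tmul a v =>
      rw [LinearMap.baseChange_tmul]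
      exact Submodule.tmul_mem_baseChange_of_mem _ (LinearMap.mem_range_self _ v)
    | add y z hy hz => rw [map_add]; exact Submodule.add_mem _ hy hz
  · rintro _ ⟨y, rfl⟩
    exact ⟨1 ⊗ₜ y, LinearMap.baseChange_tmul _ _ _⟩

variable [FiniteDimensional k D]

/-- One inclusion is formal; the dimensions agree by the dimension formula, since base change
commutes with sums. -/
theorem baseChange_inf (p r : Submodule k D) :
    (p ⊓ r).baseChange L = p.baseChange L ⊓ r.baseChange L := by
  refine Submodule.eq_of_le_of_finrank_eq (le_inf (Submodule.baseChange_mono L inf_le_left)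
    (Submodule.baseChange_mono L inf_le_right)) ?_
  have h1 := Submodule.finrank_sup_add_finrank_inf_eq (p.baseChange L) (r.baseChange L)
  have h2 := Submodule.finrank_sup_add_finrank_inf_eq p r
  rw [← baseChange_sup] at h1
  simp only [finrank_baseChange_submodule] at h1 ⊢
  omega

theorem ker_baseChange (f : D →ₗ[k] D) :
    LinearMap.ker (f.baseChange L) = (LinearMap.ker f).baseChange L := by
  refine (Submodule.eq_of_le_of_finrank_eq (baseChange_le fun v hv => ?_) ?_).symm
  · rw [LinearMap.mem_ker, LinearMap.baseChange_tmul, LinearMap.mem_ker.1 hv,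
      TensorProduct.tmul_zero]
  · have h1 := LinearMap.finrank_range_add_finrank_ker (f.baseChange L)
    have h2 := LinearMap.finrank_range_add_finrank_ker f
    rw [range_baseChange, Module.finrank_baseChange] at h1
    rw [finrank_baseChange_submodule] at h1 ⊢
    omega

theorem alpha_baseChange (F : Fin (m + 1) → Submodule k D) (U : Submodule k D) :
    alpha (fun i => (F i).baseChange L) (U.baseChange L) = alpha F U := by
  funext i
  rw [alpha, alpha, ← baseChange_inf, ← baseChange_inf, finrank_baseChange_submodule,
    finrank_baseChange_submodule]

variable (x : TV k D d)

theorem upLabel_baseChange : (x.baseChange L).upLabel = x.upLabel := by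
  funext j
  simp only [upLabel, baseChange, range_baseChange, ker_baseChange, alpha_baseChange]

theorem downLabel_baseChange : (x.baseChange L).downLabel = x.downLabel := by
  funext j
  simp only [downLabel, baseChange, range_baseChange, ker_baseChange, alpha_baseChange]

theorem upExp_baseChange : (x.baseChange L).upExp = x.upExp := by
  funext j
  have h1 : ((x.baseChange L).W ⊔ (x.baseChange L).flag j) ⊓ LinearMap.ker (x.baseChange L).t
      = ((x.W ⊔ x.flag j) ⊓ LinearMap.ker x.t).baseChange L := by
    rw [baseChange_inf, baseChange_sup, ← ker_baseChange]
    rfl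
  have h2 : (x.baseChange L).W = x.W.baseChange L := rfl
  rw [upExp, upExp, h1, h2, finrank_baseChange_submodule, finrank_baseChange_submodule]

theorem downExp_baseChange : (x.baseChange L).downExp = x.downExp := by
  funext j
  have h1 : LinearMap.range (x.baseChange L).t ⊔ (x.baseChange L).W ⊓ (x.baseChange L).flag j
      = (LinearMap.range x.t ⊔ x.W ⊓ x.flag j).baseChange L := by
    rw [baseChange_sup, baseChange_inf, ← range_baseChange]
    rfl
  have h2 : (x.baseChange L).W = x.W.baseChange L := rfl
  have h3 : LinearMap.range (x.baseChange L).t = (LinearMap.range x.t).baseChange L :=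
    range_baseChange L x.t
  rw [downExp, downExp, h1, h2, h3, finrank_baseChange_submodule, finrank_baseChange_submodule,
    finrank_baseChange_submodule]

end BaseChange

theorem stratumValue_eq {f : TV k D d → Cq} {a : (Fin m → ℕ) × (Fin m → ℕ) × (Fin m → ℕ)} {v : Cq}
    (hex : ∃ y : TV k D d, y.label = a) (h : ∀ y : TV k D d, y.label = a → f y = v) :
    stratumValue f a = v := by
  rw [stratumValue, dif_pos hex]
  exact h _ hex.choose_spec

/-- The normalised number of points of projective space of dimension `N - 1`; for `N = 0` the fibre
is empty and both sides are `0`. -/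
theorem q_zpow_mul_sum (N : ℕ) :
    q ^ (-((N : ℤ) - 1)) * ∑ e ∈ Finset.range N, q ^ (2 * e) = qint N := by
  have h0 := q_ne_zero
  have h1 := q_sq_sub_one_ne_zero
  have h2 := q_sub_inv_ne_zero
  have h3 : (∑ e ∈ Finset.range N, q ^ (2 * e)) * (q ^ 2 - 1) = q ^ (2 * N) - 1 := by
    simp only [pow_mul]
    exact geom_sum_mul _ _
  rw [qint, eq_div_iff h2, show q - q⁻¹ = (q ^ 2 - 1) * q⁻¹ by field_simp, mul_assoc,
    ← mul_assoc _ (q ^ 2 - 1), h3, show -((N : ℤ) - 1) = 1 - N by ring, zpow_sub₀ h0, zpow_neg,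
    zpow_natCast, zpow_one, two_mul, pow_add]
  field_simp

/-! ### The operators as multiplication by quantum integers -/

section Operators

variable [Finite k] [FiniteDimensional k D] (x : TV k D d) (f : TV k D d → Cq) (v : Cq)

/-- If `f` has a single value `v` on the strata met by the fibre, the strata recombine to the whole
projective space of `ker t / W`. The hypothesis concerns all points with the right dimension and
`α(ker t)`, not only the fibre, because `stratumValue` evaluates at an arbitrary point of a stratum.
-/
theorem opE_apply (hf : ∀ y : TV k D d, finrank k y.W = finrank k x.W + 1 →
      alpha y.flag (LinearMap.ker y.t) = alpha x.flag (LinearMap.ker x.t) → f y = v) :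
    opE f x = qint ((finrank k (LinearMap.ker x.t) : ℤ) - finrank k x.W) * v := by
  rw [opE, finsum_strata k (fun a L => Nat.card {y : TV L (L ⊗[k] D) d //
    y ∈ (x.baseChange L).fibreUp ∧ y.label = a}) x.upLabel x.upExp x.upExp_subset x.upExp_zero
    (stratumValue f) v]
  · have hle := Submodule.finrank_mono x.le_ker
    rw [upExp_last, ← Nat.cast_sub hle, mul_left_comm, q_zpow_mul_sum, mul_comm]
  · intro a L _ _ _
    rw [card_fibreUp, upLabel_baseChange, upExp_baseChange]
  · intro j hj
    classical
    -- A nonempty step has a positive count already over `k`, so its stratum has a `k`-point and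
    -- `stratumValue` takes no default value there.
    have h1 : 0 < Nat.card {y // y ∈ x.fibreUp ∧ y.label = x.upLabel j} := by
      rw [card_fibreUp]
      refine lt_of_lt_of_le ?_ (Finset.single_le_sum (fun i _ => Nat.zero_le _) (Finset.mem_univ j))
      rw [if_pos rfl]
      exact Finset.sum_pos (fun e _ => pow_pos Nat.card_pos _) hj
    obtain ⟨⟨y, ⟨-, -, -, hy⟩, hyl⟩⟩ := (Nat.card_pos_iff.1 h1).1
    refine stratumValue_eq ⟨y, hyl⟩ fun z hz => hf z ?_ (congrArg (fun l => l.2.2) hz)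
    rw [finrank_W_of_label_eq (hz.trans hyl.symm), hy]

theorem opF_apply (hf : ∀ y : TV k D d, finrank k x.W = finrank k y.W + 1 →
      alpha y.flag (LinearMap.ker y.t) = alpha x.flag (LinearMap.ker x.t) → f y = v) :
    opF f x = qint ((finrank k x.W : ℤ) - finrank k (LinearMap.range x.t)) * v := by
  rw [opF, finsum_strata k (fun a L => Nat.card {y : TV L (L ⊗[k] D) d //
    y ∈ (x.baseChange L).fibreDown ∧ y.label = a}) x.downLabel x.downExp x.downExp_subset
    x.downExp_zero (stratumValue f) v]
  · have hle := Submodule.finrank_mono x.range_le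
    rw [downExp_last, ← Nat.cast_sub hle, mul_left_comm, q_zpow_mul_sum, mul_comm]
  · intro a L _ _ _
    rw [card_fibreDown, downLabel_baseChange, downExp_baseChange]
  · intro j hj
    classical
    have h1 : 0 < Nat.card {y // y ∈ x.fibreDown ∧ y.label = x.downLabel j} := by
      rw [card_fibreDown]
      refine lt_of_lt_of_le ?_ (Finset.single_le_sum (fun i _ => Nat.zero_le _) (Finset.mem_univ j))
      rw [if_pos rfl]
      exact Finset.sum_pos (fun e _ => pow_pos Nat.card_pos _) hj
    obtain ⟨⟨y, ⟨-, -, -, hy⟩, hyl⟩⟩ := (Nat.card_pos_iff.1 h1).1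
    refine stratumValue_eq ⟨y, hyl⟩ fun z hz => hf z ?_ (congrArg (fun l => l.2.2) hz)
    rw [finrank_W_of_label_eq (hz.trans hyl.symm), hy]

end Operators

end TV

/-! ## The match of a point of the tensor product variety -/

theorem below_eq {m : ℕ} (G : Fin (m + 1) → ℕ) (g : Fin m → ℕ)
    (h : ∀ j, G j.succ = G j.castSucc + g j) (i : Fin m) : G 0 + below g i = G i.castSucc := by
  induction m with
  | zero => exact i.elim0
  | succ m ih =>
    cases i using Fin.cases with
    | zero => rw [below_zero, add_zero, Fin.castSucc_zero]
    | succ i =>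
      have h1 := ih (fun j => G j.succ) (fun j => g j.succ)
        (fun j => by rw [h, Fin.succ_castSucc]) i
      have h2 := h 0
      rw [Fin.castSucc_zero] at h2
      rw [below_succ, ← Fin.succ_castSucc, ← h1, h2]
      omega

namespace LowerMatch

variable {m : ℕ} {d : Fin m → ℕ}

theorem rights_eq_sub_n (b : LowerMatch d) (i : Fin m) : b.rights i = d i - b.n i := by
  have := b.rights_le i
  have := b.n_apply i
  omega

theorem n_injective : Function.Injective (n : LowerMatch d → Fin m → ℕ) := fun b b' h =>
  rights_injective (funext fun i => by rw [rights_eq_sub_n, rights_eq_sub_n, h])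

theorem sum_n_add (b : LowerMatch d) : ∑ i, b.n i + b.curves.card = ∑ i, d i := by
  rw [card_curves, ← Finset.sum_add_distrib]
  refine Finset.sum_congr rfl fun i _ => ?_
  have := b.rights_le i
  have := b.n_apply i
  omega

theorem mu_eq (b : LowerMatch d) : b.mu = ∑ i, d i - 2 * ∑ i, b.rights i := by
  have := b.mu_add
  rw [card_curves] at this
  omega

end LowerMatch

namespace TV

variable {k : Type u} {D : Type v} [Field k] [AddCommGroup D] [Module k D] {m : ℕ}
  {d : Fin m → ℕ}

/-- The match and the number of unmatched down arrows that describe the set `Y_a` containing a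
point. -/
structure IsAt (x : TV k D d) (b : LowerMatch d) (j : ℕ) : Prop where
  alpha_ker : alpha x.flag (LinearMap.ker x.t) = b.n
  finrank_W : finrank k x.W = b.curves.card + j

theorem mem_Y_iff (x : TV k D d) (a : OrientedLowerMatch d) :
    x ∈ Y k D a ↔ x.IsAt a.toMatch a.down.card :=
  ⟨fun h => ⟨h.1, h.2.trans a.sum_tuple⟩, fun h => ⟨h.1, h.2.trans a.sum_tuple.symm⟩⟩

theorem IsAt.match_unique {x : TV k D d} {b b' : LowerMatch d} {j j' : ℕ} (h : x.IsAt b j)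
    (h' : x.IsAt b' j') : b = b' :=
  LowerMatch.n_injective (h.alpha_ker.symm.trans h'.alpha_ker)

theorem IsAt.index_unique {x : TV k D d} {b : LowerMatch d} {j j' : ℕ} (h : x.IsAt b j)
    (h' : x.IsAt b j') : j = j' := by
  have h1 := h.finrank_W
  have h2 := h'.finrank_W
  omega

section FiniteDimensional

variable [FiniteDimensional k D]

theorem finrank_eq (x : TV k D d) : finrank k D = ∑ i, d i := by
  have h := x.sum_alpha ⊤
  rw [finrank_top] at h
  rw [← h]
  refine Finset.sum_congr rfl fun i _ => ?_
  rw [alpha, top_inf_eq, top_inf_eq, x.flag_dim i, Nat.add_sub_cancel_left]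

theorem alpha_le (x : TV k D d) (U : Submodule k D) (i : Fin m) : alpha x.flag U i ≤ d i := by
  have h1 := Submodule.finrank_sup_add_finrank_inf_eq (U ⊓ x.flag i.succ) (x.flag i.castSucc)
  rw [inf_assoc, inf_eq_right.2 (x.flag_le i)] at h1
  have h2 := Submodule.finrank_mono (sup_le (inf_le_right (a := U)) (x.flag_le i))
  have h3 := x.flag_dim i
  rw [alpha]
  omega

/-- The entry `d i - α(ker t)_i` is the increment of `dim t(F_i)`. The inequality compares
dimensions in `t(F_{i+1}) ≤ ker t ∩ F_i`, which holds because `im t ≤ W ≤ ker t`. -/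
theorem admissible (x : TV k D d) :
    Admissible 0 d fun i => d i - alpha x.flag (LinearMap.ker x.t) i := by
  have hker : ∀ i, finrank k ((x.flag i).map x.t) + finrank k ↥(LinearMap.ker x.t ⊓ x.flag i)
      = finrank k (x.flag i) := by
    intro i
    have h1 := LinearMap.finrank_range_add_finrank_ker (x.t.domRestrict (x.flag i))
    rw [LinearMap.range_domRestrict, LinearMap.ker_domRestrict] at h1
    rw [← h1]
    congr 1
    rw [← Submodule.finrank_map_subtype_eq, Submodule.map_comap_subtype, inf_comm]
  have hsucc : ∀ i : Fin m, finrank k ((x.flag i.succ).map x.t)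
      = finrank k ((x.flag i.castSucc).map x.t)
        + (d i - alpha x.flag (LinearMap.ker x.t) i) := by
    intro i
    have h1 := hker i.succ
    have h2 := hker i.castSucc
    have h3 := x.flag_dim i
    have h4 := x.alpha_le (LinearMap.ker x.t) i
    have h5 := x.finrank_inf_flag_le (LinearMap.ker x.t) i
    rw [alpha] at h4 ⊢
    omega
  have hb := below_eq (fun i => finrank k ((x.flag i).map x.t)) _ hsucc
  have hd := below_eq (fun i => finrank k (x.flag i)) d x.flag_dim
  have hb0 : finrank k ((x.flag 0).map x.t) = 0 := by
    rw [x.flag_zero, Submodule.map_bot, finrank_bot]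
  have hd0 : finrank k (x.flag 0) = 0 := by rw [x.flag_zero, finrank_bot]
  intro i
  refine ⟨Nat.sub_le _ _, ?_⟩
  have hbi := hb i
  have hdi := hd i
  dsimp only at hbi hdi ⊢
  have h1 : (x.flag i.succ).map x.t ≤ LinearMap.ker x.t ⊓ x.flag i.castSucc :=
    le_inf (LinearMap.map_le_range.trans (x.range_le.trans x.le_ker)) (x.t_flag i)
  have h2 := Submodule.finrank_mono h1
  have h3 := hker i.castSucc
  have h4 := hsucc i
  omega

theorem finrank_ker_of_alpha {x : TV k D d} {b : LowerMatch d}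
    (h : alpha x.flag (LinearMap.ker x.t) = b.n) :
    finrank k (LinearMap.ker x.t) + b.curves.card = ∑ i, d i := by
  rw [← x.sum_alpha, h, b.sum_n_add]

theorem finrank_range_of_alpha {x : TV k D d} {b : LowerMatch d}
    (h : alpha x.flag (LinearMap.ker x.t) = b.n) :
    finrank k (LinearMap.range x.t) = b.curves.card := by
  have h1 := finrank_ker_of_alpha h
  have h2 := LinearMap.finrank_range_add_finrank_ker x.t
  rw [x.finrank_eq] at h2
  omega

/-- If the match has `c` curves, then `rank t = c` and `dim ker t = c + μ`, so `dim W - c` lies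
between `0` and `μ`. -/
theorem exists_isAt (x : TV k D d) : ∃ (b : LowerMatch d) (j : Fin (b.mu + 1)), x.IsAt b j := by
  obtain ⟨b, hb⟩ := LowerMatch.exists_rights_eq x.admissible
  have hn : alpha x.flag (LinearMap.ker x.t) = b.n := funext fun i => by
    have := x.alpha_le (LinearMap.ker x.t) i
    have h := congrFun hb i
    rw [b.n_apply]
    omega
  have h1 := finrank_ker_of_alpha hn
  have h2 := finrank_range_of_alpha hn
  have h3 := Submodule.finrank_mono x.range_le
  have h4 := Submodule.finrank_mono x.le_ker
  have h5 := b.mu_add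
  exact ⟨b, ⟨finrank k x.W - b.curves.card, by omega⟩, hn, by dsimp only; omega⟩

end FiniteDimensional

/-! ### Points realising a given match -/

section Construction

variable {ι : Type*} (e : Module.Basis ι k D)

theorem finrank_span_image (s : Finset ι) :
    finrank k (Submodule.span k (e '' (s : Set ι))) = s.card := by
  have h : e '' (s : Set ι) = Set.range fun i : s => e i := by
    rw [Set.image_eq_range]
    rfl
  rw [h, finrank_span_eq_card (b := fun i : s => e i)
    (e.linearIndependent.comp (fun i : s => (i : ι)) Subtype.val_injective), Fintype.card_coe]

theorem span_image_inf [DecidableEq ι] (s s' : Finset ι) :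
    Submodule.span k (e '' (s : Set ι)) ⊓ Submodule.span k (e '' (s' : Set ι))
      = Submodule.span k (e '' ((s ∩ s' : Finset ι) : Set ι)) := by
  ext v
  rw [Submodule.mem_inf, e.mem_span_image, e.mem_span_image, e.mem_span_image, Finset.coe_inter,
    Set.subset_inter_iff]

/-- Used twice: with `P` always true for the dimensions of the flag, and with the vertices that are
not right endpoints for `α(ker t)`. -/
theorem card_filter_flag (P : Vertex d → Prop) [DecidablePred P] (g : Fin m → ℕ)
    (hg : ∀ i, (Finset.univ.filter fun j : Fin (d i) => P ⟨i, j⟩).card = g i) (i : Fin m) :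
    (Finset.univ.filter fun x : Vertex d => P x ∧ x.1.castSucc < i.succ).card
      = (Finset.univ.filter fun x : Vertex d => P x ∧ x.1.castSucc < i.castSucc).card + g i := by
  have h : ∀ Q : Fin m → Prop, [DecidablePred Q] →
      (Finset.univ.filter fun x : Vertex d => P x ∧ Q x.1).card = ∑ i, if Q i then g i else 0 := by
    intro Q _
    rw [card_filter_vertex]
    refine Finset.sum_congr rfl fun i _ => ?_
    by_cases h : Q i
    · simp only [h, and_true, if_true, hg]
    · simp [h]
  rw [h (fun j => j.castSucc < i.succ), h (fun j => j.castSucc < i.castSucc)]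
  simp only [Fin.castSucc_lt_succ_iff, Fin.castSucc_lt_castSucc_iff]
  rw [← below_add]
  rfl

variable [FiniteDimensional k D]

/-- In a basis indexed by the vertices, `t` sends each right endpoint to the left endpoint of its
curve and kills all other vertices, and the flag is spanned by initial boxes. Thus `im t` is spanned
by the left endpoints, `ker t` by the vertices that are not right endpoints, and `W` by any
intermediate set of the required size. -/
theorem exists_of_match (hd : finrank k D = ∑ i, d i) (b : LowerMatch d) {j : ℕ} (hj : j ≤ b.mu) :
    ∃ x : TV k D d, x.IsAt b j := by
  classical
  let e : Module.Basis (Vertex d) k D :=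
    (Module.finBasis k D).reindex (Fintype.equivOfCardEq (by simp [hd]))
  let t : D →ₗ[k] D := e.constr k fun y => if h : b.IsRight y then e h.choose else 0
  have ht0 : ∀ y, ¬ b.IsRight y → t (e y) = 0 := fun y hy => by
    simp only [t, Module.Basis.constr_basis, dif_neg hy]
  have ht1 : ∀ x y, (x, y) ∈ b.curves → t (e y) = e x := fun x y hxy => by
    have hy : b.IsRight y := ⟨x, hxy⟩
    simp only [t, Module.Basis.constr_basis, dif_pos hy]
    have := b.disjoint _ hxy _ hy.choose_spec (Or.inr (Or.inr (Or.inr rfl)))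
    exact congrArg e (congrArg Prod.fst this).symm
  let sub : Finset (Vertex d) → Submodule k D := fun s => Submodule.span k (e '' (s : Set (Vertex d)))
  have hmem : ∀ {s : Finset (Vertex d)} {x}, x ∈ s → e x ∈ sub s := fun hx =>
    Submodule.subset_span ⟨_, hx, rfl⟩
  have hle : ∀ {s : Finset (Vertex d)} {U : Submodule k D}, (∀ x ∈ s, e x ∈ U) → sub s ≤ U :=
    fun h => Submodule.span_le.2 (by rintro _ ⟨x, hx, rfl⟩; exact h x hx)
  have hdim : ∀ s, finrank k (sub s) = s.card := finrank_span_image e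
  let lefts : Finset (Vertex d) := b.curves.image Prod.fst
  let nonright : Finset (Vertex d) := Finset.univ.filter fun x => ¬ b.IsRight x
  have hlefts : lefts.card = b.curves.card := Finset.card_image_of_injOn fun c hc c' hc' h =>
    b.disjoint c hc c' hc' (Or.inl h)
  have hn : ∀ i, (Finset.univ.filter fun j : Fin (d i) => ¬ b.IsRight ⟨i, j⟩).card = b.n i := by
    intro i
    have h1 := Finset.card_filter_add_card_filter_not (s := (Finset.univ : Finset (Fin (d i))))
      fun j => b.IsRight ⟨i, j⟩
    rw [Finset.card_univ, Fintype.card_fin] at h1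
    rw [b.n_apply, b.rights_eq i]
    omega
  have hnonright : nonright.card = ∑ i, b.n i := by
    rw [card_filter_vertex]
    exact Finset.sum_congr rfl fun i _ => hn i
  have hsub : lefts ⊆ nonright := by
    intro x hx
    obtain ⟨c, hc, rfl⟩ := Finset.mem_image.1 hx
    refine Finset.mem_filter.2 ⟨Finset.mem_univ _, ?_⟩
    rintro ⟨y, hy⟩
    have h1 := b.disjoint _ hc _ hy (Or.inr (Or.inl rfl))
    have h2 := b.box_lt _ hc
    rw [h1] at h2
    exact lt_irrefl _ (h2.trans_eq' (by rw [h1]))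
  have hrange : LinearMap.range t = sub lefts := by
    refine le_antisymm ?_ (hle fun x hx => ?_)
    · rw [LinearMap.range_eq_map, ← e.span_eq, Submodule.map_span_le]
      rintro _ ⟨y, rfl⟩
      by_cases hy : b.IsRight y
      · obtain ⟨x, hx⟩ := hy
        rw [ht1 x y hx]
        exact hmem (Finset.mem_image_of_mem Prod.fst hx)
      · rw [ht0 y hy]
        exact Submodule.zero_mem _
    · obtain ⟨c, hc, rfl⟩ := Finset.mem_image.1 hx
      exact ⟨e c.2, ht1 _ _ hc⟩
  have hsum := b.sum_n_add
  have hker : LinearMap.ker t = sub nonright := by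
    refine (Submodule.eq_of_le_of_finrank_eq (hle fun x hx => ht0 x (Finset.mem_filter.1 hx).2)
      ?_).symm
    have h1 := LinearMap.finrank_range_add_finrank_ker t
    rw [hrange, hdim, hlefts, hd] at h1
    rw [hdim, hnonright]
    omega
  have hmu := b.mu_add
  -- There are as many left endpoints as curves and `μ` more vertices that are not right endpoints,
  -- so `j ≤ μ` leaves room for `S`.
  obtain ⟨S, hS1, hS2, hS3⟩ := Finset.exists_subsuperset_card_eq (n := b.curves.card + j) hsub
    (by omega) (by omega)
  let fl : Fin (m + 1) → Finset (Vertex d) := fun i => Finset.univ.filter fun x => x.1.castSucc < i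
  refine ⟨⟨fun i => sub (fl i), sub S, t, ?_, ?_, ?_, ?_, ?_, ?_, ?_⟩, ?_, ?_⟩
  · rw [eq_bot_iff]
    exact hle fun x hx => absurd (Finset.mem_filter.1 hx).2 (Fin.not_lt_zero _)
  · rw [eq_top_iff, ← e.span_eq, Submodule.span_le]
    rintro _ ⟨x, rfl⟩
    exact hmem (Finset.mem_filter.2 ⟨Finset.mem_univ _, Fin.castSucc_lt_last _⟩)
  · exact fun i => hle fun x hx => hmem (Finset.mem_filter.2 ⟨Finset.mem_univ _,
      (Finset.mem_filter.1 hx).2.trans (Fin.castSucc_lt_succ)⟩)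
  · intro i
    rw [hdim, hdim]
    have h := card_filter_flag (d := d) (fun _ => True) d (by simp) i
    simp only [true_and] at h
    exact h
  · intro i
    rw [Submodule.map_le_iff_le_comap]
    refine hle fun y hy => ?_
    rw [Submodule.mem_comap]
    by_cases hR : b.IsRight y
    · obtain ⟨x, hx⟩ := hR
      rw [ht1 x y hx]
      refine hmem (Finset.mem_filter.2 ⟨Finset.mem_univ _, ?_⟩)
      have h1 := (Finset.mem_filter.1 hy).2
      rw [Fin.castSucc_lt_succ_iff] at h1
      exact Fin.castSucc_lt_castSucc_iff.2 ((b.box_lt _ hx).trans_le h1)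
    · rw [ht0 y hR]
      exact Submodule.zero_mem _
  · rw [hrange]
    exact hle fun x hx => hmem (hS1 hx)
  · rw [hker]
    exact hle fun x hx => hmem (hS2 hx)
  · funext i
    change finrank k ↥(LinearMap.ker t ⊓ sub (fl i.succ))
      - finrank k ↥(LinearMap.ker t ⊓ sub (fl i.castSucc)) = b.n i
    have h1 : ∀ i, finrank k ↥(LinearMap.ker t ⊓ sub (fl i))
        = (Finset.univ.filter fun x : Vertex d => ¬ b.IsRight x ∧ x.1.castSucc < i).card := by
      intro i
      rw [hker, span_image_inf, hdim, Finset.filter_and]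
    rw [h1, h1, card_filter_flag _ _ hn, Nat.add_sub_cancel_left]
  · rw [hdim, hS3]

end Construction

end TV

/-! ## The space of functions as a representation -/

section Coordinates

variable {k : Type u} {D : Type v} [Field k] [AddCommGroup D] [Module k D] {m : ℕ} {d : Fin m → ℕ}

open TV

/-- It makes `GL(D)`-invariance automatic for functions of `dim W` and `α(ker t)`. -/
theorem alpha_ker_conj (x y : TV k D d) (g : D ≃ₗ[k] D)
    (hflag : ∀ i, y.flag i = (x.flag i).map (g : D →ₗ[k] D))
    (ht : y.t = (g : D →ₗ[k] D) ∘ₗ x.t ∘ₗ (g.symm : D →ₗ[k] D)) :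
    alpha y.flag (LinearMap.ker y.t) = alpha x.flag (LinearMap.ker x.t) := by
  have hker : LinearMap.ker y.t = (LinearMap.ker x.t).map (g : D →ₗ[k] D) := by
    ext v
    rw [Submodule.mem_map_equiv, LinearMap.mem_ker, LinearMap.mem_ker, ht]
    simp
  funext i
  rw [alpha, alpha, hker, hflag, hflag, ← Submodule.map_inf _ g.injective,
    ← Submodule.map_inf _ g.injective, LinearEquiv.finrank_map_eq, LinearEquiv.finrank_map_eq]

theorem oneY_apply (a : OrientedLowerMatch d) {x : TV k D d} {b : LowerMatch d}
    {j : Fin (b.mu + 1)} (h : x.IsAt b j) : oneY k D a x =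
      open Classical in if a.toMatch = b ∧ a.down.card = j then 1 else 0 := by
  classical
  rw [oneY, Set.indicator_apply]
  refine if_congr ?_ rfl rfl
  rw [mem_Y_iff]
  constructor
  · intro h'
    obtain rfl := h'.match_unique h
    exact ⟨rfl, h'.index_unique h⟩
  · rintro ⟨rfl, h2⟩
    rwa [h2]

variable [FiniteDimensional k D] (hd : finrank k D = ∑ i, d i)

instance : DecidableEq (LowerMatch d) := Classical.decEq _

instance : Fintype (LowerMatch d) := Fintype.ofFinite _

/-- The function with given values on the sets of points with given match and number of unmatched
down arrows. -/
def ofCoords (g : ∀ b : LowerMatch d, Fin (b.mu + 1) → Cq) (x : TV k D d) : Cq :=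
  g x.exists_isAt.choose x.exists_isAt.choose_spec.choose

theorem ofCoords_apply (g : ∀ b : LowerMatch d, Fin (b.mu + 1) → Cq) {x : TV k D d}
    {b : LowerMatch d} {j : Fin (b.mu + 1)} (h : x.IsAt b j) : ofCoords g x = g b j := by
  have key : ∀ (b' : LowerMatch d) (j' : Fin (b'.mu + 1)), x.IsAt b' j' → g b' j' = g b j := by
    intro b' j' h'
    obtain rfl := h'.match_unique h
    obtain rfl : j' = j := Fin.ext (h'.index_unique h)
    rfl
  exact key _ _ x.exists_isAt.choose_spec.choose_spec

theorem ofCoords_mem (g : ∀ b : LowerMatch d, Fin (b.mu + 1) → Cq) : ofCoords g ∈ Ts k D d := by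
  have key : ∀ x y : TV k D d, finrank k x.W = finrank k y.W →
      alpha x.flag (LinearMap.ker x.t) = alpha y.flag (LinearMap.ker y.t) →
      ofCoords g x = ofCoords g y := by
    intro x y h1 h2
    obtain ⟨b, j, h⟩ := x.exists_isAt
    rw [ofCoords_apply g h, ofCoords_apply g ⟨h2.symm.trans h.alpha_ker, h1.symm.trans h.finrank_W⟩]
  refine ⟨fun e x y hflag hW ht => key y x ?_ (alpha_ker_conj x y e hflag ht), key⟩
  rw [hW, LinearEquiv.finrank_map_eq]

/-- A function in `T_s(d)` is given by arbitrary values on the sets `Y_a`. -/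
def coords : Ts k D d ≃ₗ[Cq] (∀ b : LowerMatch d, Fin (b.mu + 1) → Cq) where
  -- The value at a chosen point of the class `(b, j)`; membership in `Ts` makes it independent of
  -- the choice.
  toFun f := fun b j => (f : TV k D d → Cq) (exists_of_match hd b (Nat.le_of_lt_succ j.isLt)).choose
  map_add' f g := rfl
  map_smul' c f := rfl
  invFun g := ⟨ofCoords g, ofCoords_mem g⟩
  left_inv f := by
    refine Subtype.ext (funext fun x => ?_)
    obtain ⟨b, j, h⟩ := x.exists_isAt
    have h' := (exists_of_match hd b (Nat.le_of_lt_succ j.isLt)).choose_spec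
    exact (ofCoords_apply (fun b (j : Fin (b.mu + 1)) => (f : TV k D d → Cq)
      (exists_of_match hd b (Nat.le_of_lt_succ j.isLt)).choose) h).trans
        (f.2.2 _ _ (h'.finrank_W.trans h.finrank_W.symm) (h'.alpha_ker.trans h.alpha_ker.symm))
  right_inv g := funext fun b => funext fun j =>
    ofCoords_apply g (exists_of_match hd b (Nat.le_of_lt_succ j.isLt)).choose_spec

theorem coords_apply (f : Ts k D d) {x : TV k D d} {b : LowerMatch d} {j : Fin (b.mu + 1)}
    (h : x.IsAt b j) : coords hd f b j = (f : TV k D d → Cq) x := by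
  conv_rhs => rw [← (coords hd).symm_apply_apply f]
  exact (ofCoords_apply _ h).symm

/-- Here `dim ker t - dim W = μ - j`, the coefficient of `E` on `V_μ`. -/
theorem opE_coords [Finite k] (f : Ts k D d) {x : TV k D d} {b : LowerMatch d} {j : Fin (b.mu + 1)}
    (h : x.IsAt b j) : opE (f : TV k D d → Cq) x = irrE b.mu (coords hd f b) j := by
  have h1 := finrank_ker_of_alpha h.alpha_ker
  have h2 := h.finrank_W
  have h3 := b.mu_add
  have hj := j.isLt
  rw [opE_apply x f (coord (coords hd f b) (j + 1))]
  · change _ = qint ((b.mu : ℤ) - (j : ℕ)) * _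
    congr 2
    omega
  -- For `j = μ` no such `y` exists, since its `W` would be larger than `ker t`; this matches the
  -- value `0` of `coord` out of range.
  · intro y hy hy'
    have h4 := finrank_ker_of_alpha (hy'.trans h.alpha_ker)
    have h5 := Submodule.finrank_mono y.le_ker
    have hlt : (j : ℕ) + 1 < b.mu + 1 := by omega
    rw [coord, dif_pos hlt]
    exact (coords_apply hd f ⟨hy'.trans h.alpha_ker, by dsimp only; omega⟩).symm

theorem opF_coords [Finite k] (f : Ts k D d) {x : TV k D d} {b : LowerMatch d} {j : Fin (b.mu + 1)}
    (h : x.IsAt b j) : opF (f : TV k D d → Cq) x = irrF b.mu (coords hd f b) j := by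
  have h1 := finrank_range_of_alpha h.alpha_ker
  have h2 := h.finrank_W
  have hj := j.isLt
  rw [opF_apply x f (coord (coords hd f b) (j - 1))]
  · change _ = qint ((j : ℕ) : ℤ) * _
    congr 2
    omega
  -- For `j = 0` no such `y` exists, since its `W` would be smaller than `im t`. The truncated index
  -- `j - 1` is then harmless, being multiplied by `[0] = 0`.
  · intro y hy hy'
    have h4 := finrank_range_of_alpha (hy'.trans h.alpha_ker)
    have h5 := Submodule.finrank_mono y.range_le
    have hlt : (j : ℕ) - 1 < b.mu + 1 := by omega
    rw [coord, dif_pos hlt]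
    exact (coords_apply hd f ⟨hy'.trans h.alpha_ker, by dsimp only; omega⟩).symm

theorem opK_coords (s : ℤ) (f : Ts k D d) {x : TV k D d} {b : LowerMatch d}
    {j : Fin (b.mu + 1)} (h : x.IsAt b j) :
    opK s (f : TV k D d → Cq) x = irrK b.mu s (coords hd f b) j := by
  have h2 := h.finrank_W
  have h3 := b.mu_add
  change _ = q ^ (s * ((b.mu : ℤ) - 2 * (j : ℕ))) * coords hd f b j
  rw [coords_apply hd f h, opK, hd]
  congr 3
  omega

/-- The action of the quantum group on `T_s(d)`. -/
def geomRep : Uq →ₐ[Cq] Module.End Cq (Ts k D d) :=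
  ((coords hd).symm.conjAlgEquiv Cq).toAlgHom.comp
    (piRep fun b : LowerMatch d => irrRep b.mu)

theorem coords_geomRep (u : Uq) (f : Ts k D d) :
    coords hd (geomRep hd u f) = piRep (fun b : LowerMatch d => irrRep b.mu) u (coords hd f) :=
  (coords hd).apply_symm_apply _

/-- The action is transported from the product of the `V_μ`, so the relations of `U_q` need no
geometric verification. It remains to compare operators point by point, each point having a match
and an index. -/
theorem geomRep_eq (u : Uq) (f : Ts k D d) (T : TV k D d → Cq)
    (h : ∀ (x : TV k D d) (b : LowerMatch d) (j : Fin (b.mu + 1)), x.IsAt b j →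
      T x = irrRep b.mu u (coords hd f b) j) :
    ((geomRep hd u f : Ts k D d) : TV k D d → Cq) = T := by
  funext x
  obtain ⟨b, j, hx⟩ := x.exists_isAt
  rw [h x b j hx, ← coords_apply hd _ hx, coords_geomRep]
  rfl

/-- Both modules are the product of the same `V_μ`: a match corresponds to the admissible tuple of
its right endpoints, and `mu_eq` identifies the highest weights. -/
theorem isoRep_geomRep : IsoRep (geomRep (k := k) (D := D) hd) (UqMod.tensorProd m d).act := by
  have h1 : IsoRep (geomRep (k := k) (D := D) hd)
      (piRep fun b : LowerMatch d => irrRep b.mu) := ⟨coords hd, coords_geomRep hd⟩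
  exact h1.trans ((isoRep_irr_reindex (LowerMatch.equivAdmissible d) _ _
    LowerMatch.mu_eq).trans (isoRep_tensorProd d).symm)

/-! ### The summands spanned by the functions `1_{Y_a}` with a fixed match -/

section Blocks

/-- The embedding of `V_μ` onto the functions supported on the sets `Y_a` with a given match. -/
def block (b : LowerMatch d) : (Fin (b.mu + 1) → Cq) →ₗ[Cq] Ts k D d :=
  (coords hd).symm.toLinearMap ∘ₗ LinearMap.single Cq (fun b : LowerMatch d => Fin (b.mu + 1) → Cq) b

theorem coords_block (b : LowerMatch d) (y : Fin (b.mu + 1) → Cq) :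
    coords hd (block (k := k) (D := D) hd b y) b = y := by
  rw [block, LinearMap.comp_apply, LinearEquiv.coe_coe, LinearEquiv.apply_symm_apply,
    LinearMap.single_apply, Pi.single_eq_same]

theorem coords_block_of_ne {b b' : LowerMatch d} (h : b' ≠ b) (y : Fin (b.mu + 1) → Cq) :
    coords hd (block (k := k) (D := D) hd b y) b' = 0 := by
  rw [block, LinearMap.comp_apply, LinearEquiv.coe_coe, LinearEquiv.apply_symm_apply,
    LinearMap.single_apply, Pi.single_eq_of_ne h]

theorem block_injective (b : LowerMatch d) : Function.Injective (block (k := k) (D := D) hd b) :=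
  fun y y' h => by rw [← coords_block (k := k) (D := D) hd b y, h, coords_block]

theorem block_irrRep (b : LowerMatch d) (u : Uq) (y : Fin (b.mu + 1) → Cq) :
    block (k := k) (D := D) hd b (irrRep b.mu u y) = geomRep hd u (block hd b y) := by
  apply (coords hd).injective
  rw [coords_geomRep]
  funext b'
  rw [piRep_apply]
  by_cases h : b' = b
  · subst h
    rw [coords_block, coords_block]
  · rw [coords_block_of_ne hd h, coords_block_of_ne hd h, map_zero]

theorem block_wvec (a : OrientedLowerMatch d) :
    ((block (k := k) (D := D) hd a.toMatch (wvec a.toMatch.mu a.down.card) : Ts k D d) :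
      TV k D d → Cq) = oneY k D a := by
  classical
  funext x
  obtain ⟨b, j, h⟩ := x.exists_isAt
  rw [oneY_apply a h, ← coords_apply hd _ h]
  by_cases hb : a.toMatch = b
  · subst hb
    rw [coords_block, wvec]
    simp [eq_comm]
  · rw [coords_block_of_ne hd (Ne.symm hb), if_neg fun h => hb h.1]
    rfl

theorem range_block (b : LowerMatch d) :
    LinearMap.range (block (k := k) (D := D) hd b) = spanY k D b := by
  have h1 : LinearMap.range (block (k := k) (D := D) hd b) = Submodule.span Cq
      (Set.range fun j : Fin (b.mu + 1) => block (k := k) (D := D) hd b (wvec b.mu j)) := by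
    rw [LinearMap.range_eq_map, ← (Pi.basisFun Cq (Fin (b.mu + 1))).span_eq, Submodule.map_span,
      ← Set.range_comp]
    congr 2
    funext j
    rw [Function.comp_apply, Pi.basisFun_apply, wvec_eq_single]
  rw [h1, spanY]
  congr 1
  ext f
  constructor
  · rintro ⟨j, rfl⟩
    obtain ⟨a, rfl, ha⟩ := OrientedLowerMatch.exists_of_card b j (Nat.le_of_lt_succ j.isLt)
    refine ⟨a, rfl, ?_⟩
    dsimp only
    rw [← ha, block_wvec]
  · rintro ⟨a, rfl, ha⟩
    refine ⟨⟨a.down.card, Nat.lt_succ_of_le (Finset.card_le_card a.down_subset)⟩, ?_⟩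
    exact Subtype.ext ((block_wvec hd a).trans ha.symm)

/-- The functions `1_{Y_a}` form a basis. -/
def basisY : Module.Basis (OrientedLowerMatch d) Cq (Ts k D d) :=
  ((Pi.basis fun b : LowerMatch d => Pi.basisFun Cq (Fin (b.mu + 1))).map (coords hd).symm).reindex
    (OrientedLowerMatch.equivSigma d).symm

theorem basisY_apply (a : OrientedLowerMatch d) :
    ((basisY (k := k) (D := D) hd a : Ts k D d) : TV k D d → Cq) = oneY k D a := by
  rw [← block_wvec hd, basisY, Module.Basis.reindex_apply, Equiv.symm_symm, Module.Basis.map_apply,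
    Pi.basis_apply, Pi.basisFun_apply, ← wvec_eq_single]
  simp only [block, LinearMap.comp_apply, LinearMap.single_apply, LinearEquiv.coe_coe]
  rfl

/-- The coordinate at `b` kills the spans of all other matches and is injective on the span of `b`.
-/
theorem iSupIndep_spanY (hd : finrank k D = ∑ i, d i) : iSupIndep (spanY k D (d := d)) := by
  intro b
  have hle : (⨆ b', ⨆ (_ : b' ≠ b), spanY k D b')
      ≤ LinearMap.ker (LinearMap.proj b ∘ₗ (coords (k := k) (D := D) hd).toLinearMap) := by
    refine iSup₂_le fun b' hb' => ?_
    rw [← range_block hd]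
    rintro _ ⟨y, rfl⟩
    exact coords_block_of_ne hd hb'.symm y
  refine Disjoint.mono_right hle (Submodule.disjoint_def.2 fun f hf hf' => ?_)
  rw [← range_block hd] at hf
  obtain ⟨y, rfl⟩ := hf
  have hy : coords hd (block hd b y) b = 0 := hf'
  rw [coords_block] at hy
  rw [hy, map_zero]

theorem iSup_spanY (hd : finrank k D = ∑ i, d i) : (⨆ b : LowerMatch d, spanY k D b) = ⊤ := by
  rw [eq_top_iff, ← (basisY hd).span_eq, Submodule.span_le]
  rintro _ ⟨a, rfl⟩
  exact Submodule.mem_iSup_of_mem a.toMatch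
    (Submodule.subset_span ⟨a, rfl, basisY_apply hd a⟩)

/-- A subrepresentation of the span pulls back along the intertwining embedding `block` to one of
`V_μ`, which is irreducible. -/
theorem isIrredSubrep_spanY (b : LowerMatch d) : IsIrredSubrep (geomRep hd) (spanY k D b) := by
  rw [← range_block hd b]
  refine ⟨?_, ?_, ?_⟩
  · rintro u _ ⟨y, rfl⟩
    exact ⟨_, block_irrRep hd b u y⟩
  · rw [Submodule.ne_bot_iff]
    refine ⟨_, ⟨wvec b.mu 0, rfl⟩, fun h => ?_⟩
    have h1 := congrFun (block_injective hd b (h.trans (map_zero _).symm)) 0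
    simp [wvec] at h1
  · intro S hS hSr
    have hmap : (S.comap (block hd b)).map (block hd b) = S := by
      rw [Submodule.map_comap_eq, inf_eq_right]
      exact hS
    have hsub : IsSubrep (irrRep b.mu) (S.comap (block hd b)) := fun u y hy => by
      rw [Submodule.mem_comap, block_irrRep]
      exact hSr u _ hy
    rcases irrRep_irreducible b.mu _ hsub with h | h
    · left
      rw [← hmap, h, Submodule.map_bot]
    · right
      rw [← hmap, h, LinearMap.range_eq_map]

/-- The isomorphism from the functions supported on the sets `Y_a` with a given match to `V_μ`. -/
def spanYEquiv (b : LowerMatch d) : spanY k D b ≃ₗ[Cq] (Fin (b.mu + 1) → Cq) :=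
  ((LinearEquiv.ofInjective (block hd b) (block_injective hd b)).trans
    (LinearEquiv.ofEq _ _ (range_block hd b))).symm

theorem block_spanYEquiv (b : LowerMatch d) (f : spanY k D b) :
    block hd b (spanYEquiv hd b f) = (f : Ts k D d) :=
  congrArg Subtype.val ((spanYEquiv (k := k) (D := D) hd b).symm_apply_apply f)

theorem spanYEquiv_geomRep (b : LowerMatch d) (u : Uq) (f g : spanY k D b)
    (h : (g : Ts k D d) = geomRep hd u f) :
    spanYEquiv hd b g = irrRep b.mu u (spanYEquiv hd b f) := by
  apply block_injective (k := k) (D := D) hd b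
  rw [block_spanYEquiv, h, block_irrRep, block_spanYEquiv]

theorem spanYEquiv_oneY (a : OrientedLowerMatch d) (f : spanY k D a.toMatch)
    (h : ((f : Ts k D d) : TV k D d → Cq) = oneY k D a) :
    spanYEquiv hd a.toMatch f = wvec a.toMatch.mu a.down.card := by
  apply block_injective (k := k) (D := D) hd a.toMatch
  rw [block_spanYEquiv]
  exact Subtype.ext (h.trans (block_wvec hd a).symm)

end Blocks

end Coordinates

end QTensor

end

theorem mainTheorem4 {k : Type u} [Field k] [Finite k] {D : Type v} [AddCommGroup D] [Module k D]
    [FiniteDimensional k D] {m : ℕ} (d : Fin m → ℕ) (hd : finrank k D = ∑ i, d i) :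
    ∃ ρ : Uq →ₐ[Cq] Module.End Cq (Ts k D d),
      -- the `U_q`-module structure is the geometric one
      (∀ f : Ts k D d,
        ((ρ (gen Gen.E) f : Ts k D d) : TV k D d → Cq) = opE f ∧
        ((ρ (gen Gen.F) f : Ts k D d) : TV k D d → Cq) = opF f ∧
        ((ρ (gen Gen.K) f : Ts k D d) : TV k D d → Cq) = opK 1 f ∧
        ((ρ (gen Gen.Kinv) f : Ts k D d) : TV k D d → Cq) = opK (-1) f) ∧
      -- `T_s(d)` is isomorphic to the tensor product
      (∃ φ : Ts k D d ≃ₗ[Cq] (UqMod.tensorProd m d).carrier,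
        ∀ (u : Uq) (f : Ts k D d), φ (ρ u f) = (UqMod.tensorProd m d).act u (φ f)) ∧
      -- the functions `1_{Y_a}` form a basis
      (∃ B : Module.Basis (OrientedLowerMatch d) Cq (Ts k D d),
        ∀ a : OrientedLowerMatch d, (B a : TV k D d → Cq) = oneY k D a) ∧
      -- `T_s(d)` is the direct sum of the spans belonging to the unoriented matches
      iSupIndep (spanY k D (d := d)) ∧ (⨆ b : LowerMatch d, spanY k D b) = ⊤ ∧
      -- each of these spans is irreducible, and isomorphic to `V_μ` by the stated map
      ∀ b : LowerMatch d, IsIrredSubrep ρ (spanY k D b) ∧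
        ∃ ψ : spanY k D b ≃ₗ[Cq] (UqMod.irr b.mu).carrier,
          (∀ (u : Uq) (f g : spanY k D b), (g : Ts k D d) = ρ u f →
            ψ g = (UqMod.irr b.mu).act u (ψ f)) ∧
          (∀ (a : OrientedLowerMatch d) (f : spanY k D b), a.toMatch = b →
            ((f : Ts k D d) : TV k D d → Cq) = oneY k D a →
            ψ f = UqMod.vec b.mu a.down.card) := by
  refine ⟨geomRep hd, fun f => ⟨?_, ?_, ?_, ?_⟩, isoRep_geomRep hd, ⟨basisY hd, basisY_apply hd⟩,
    iSupIndep_spanY hd, iSup_spanY hd, fun b => ⟨isIrredSubrep_spanY hd b, spanYEquiv hd b, ?_, ?_⟩⟩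
  · exact geomRep_eq hd _ f _ fun x b j hx => by rw [irrRep_E, opE_coords hd f hx]
  · exact geomRep_eq hd _ f _ fun x b j hx => by rw [irrRep_F, opF_coords hd f hx]
  · exact geomRep_eq hd _ f _ fun x b j hx => by rw [irrRep_K, opK_coords hd 1 f hx]
  · exact geomRep_eq hd _ f _ fun x b j hx => by rw [irrRep_Kinv, opK_coords hd (-1) f hx]
  · exact spanYEquiv_geomRep hd b
  · rintro a f rfl hf
    exact spanYEquiv_oneY hd a f hf
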